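/- For $\phi,\theta\in\mathbb{R}$ let $R_\phi(\theta)=e^{-i\frac{\theta}{2}(\cos\phi\,\sigma_x+\sin\phi\,\sigma_y)}$, where $\sigma_x,\sigma_y,\sigma_z$ are the Pauli matrices. For odd $L$, a tuple $(A,B,C,D)$ of real polynomials is said to be achieved by a composite gate of length $L$ if there are phases $\phi_1,\dots,\phi_L\in\mathbb{R}$ such that for all $\theta\in\mathbb{R}$, with $x=\cos(\theta/2)$ and $y=\sin(\theta/2)$, $$R_{\phi_L}(\theta)\cdots R_{\phi_1}(\theta)=A(x)\mathbb{1}+iB(x)\sigma_z+iC(y)\sigma_x+iD(y)\sigma_y .$$ Let $L$ be odd and let $A,C$ be real odd polynomials of degree at most $L$ such that $A(1)=1$ and $A(\cos(\theta/2))^2+C(\sin(\theta/2))^2\le 1$ for all $\theta\in\mathbb{R}$. Then there exist real polynomials $B,D$ of degree at most $L$ such that $(A,B,C,D)$ is achieved by a composite gate of length $L$. Moreover, such $B,D$ can be computed in polynomial time: there are a single real random access machine program (exact arithmetic operations $+,-,\times,/$ and comparisons of real numbers at unit cost, rational constants, indirect addressing) and a polynomial $p$ such that for every such $L,A,C$ the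 polynomials $B,D$ above can be chosen so that for every $n\in\mathbb{N}$ the program, given $L$, $n$ and the coefficients of $A$ and $C$, halts after at most $p(L+n)$ steps and outputs the coefficients of $B$ and $D$, each up to an error of at most $2^{-n}$. -/

import Mathlib

open Polynomial

noncomputable section

namespace CompositeGate

/-- The Pauli matrix `σ_x`. -/
def pauliX : Matrix (Fin 2) (Fin 2) ℂ := !![0, 1; 1, 0]

/-- The Pauli matrix `σ_y`. -/
def pauliY : Matrix (Fin 2) (Fin 2) ℂ := !![0, -Complex.I; Complex.I, 0]

/-- The Pauli matrix `σ_z`. -/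
def pauliZ : Matrix (Fin 2) (Fin 2) ℂ := !![1, 0; 0, -1]

/-- `σ_φ = cos φ σ_x + sin φ σ_y`. -/
def pauliPhase (φ : ℝ) : Matrix (Fin 2) (Fin 2) ℂ :=
  (Real.cos φ : ℂ) • pauliX + (Real.sin φ : ℂ) • pauliY

/-- The primitive rotation `R_φ(θ) = exp(-i (θ/2) σ_φ)`. -/
def primitiveRotation (φ θ : ℝ) : Matrix (Fin 2) (Fin 2) ℂ :=
  NormedSpace.exp ((-(Complex.I * ((θ / 2 : ℝ) : ℂ))) • pauliPhase φ)

/-- The equiangular composite gate `U(θ) = R_{φ_L}(θ) ⋯ R_{φ_2}(θ) R_{φ_1}(θ)`;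
the phase `φ_k` of the text is `φ (k - 1)` here. -/
def compositeGate {L : ℕ} (φ : Fin L → ℝ) (θ : ℝ) : Matrix (Fin 2) (Fin 2) ℂ :=
  (List.ofFn fun k : Fin L => primitiveRotation (φ k) θ).reverse.prod

/-- The matrix represented by `(A, B, C, D)`: with `x = cos (θ/2)` and `y = sin (θ/2)`, it is
`A(x) 1 + i B(x) σ_z + i C(y) σ_x + i D(y) σ_y` for `L` odd and
`A(x) 1 + i B(x) σ_z + i x C(y) σ_x + i x D(y) σ_y` for `L` even. -/
def polynomialForm (L : ℕ) (A B C D : ℝ[X]) (θ : ℝ) : Matrix (Fin 2) (Fin 2) ℂ :=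
  let x : ℝ := Real.cos (θ / 2)
  let y : ℝ := Real.sin (θ / 2)
  let w : ℝ := if Odd L then 1 else x
  ((A.eval x : ℝ) : ℂ) • (1 : Matrix (Fin 2) (Fin 2) ℂ)
    + (Complex.I * ((B.eval x : ℝ) : ℂ)) • pauliZ
    + (Complex.I * ((w * C.eval y : ℝ) : ℂ)) • pauliX
    + (Complex.I * ((w * D.eval y : ℝ) : ℂ)) • pauliY

/-- The tuple `(A, B, C, D)` is achieved by a composite gate of length `L`. (A tuple is called
achievable if this holds for some `L`.) -/
def AchievableWithLength (L : ℕ) (A B C D : ℝ[X]) : Prop :=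
  ∃ φ : Fin L → ℝ, ∀ θ : ℝ, compositeGate φ θ = polynomialForm L A B C D θ

/-- `P` is an odd polynomial: `P(-X) = -P(X)`. -/
def IsOddPolynomial (P : ℝ[X]) : Prop := P.comp (-X) = -P

end CompositeGate

/-! A real random access machine: exact field operations and comparisons of real numbers, indirect
addressing through index registers, every operation and every test at unit cost. A program is a
finite piece of syntax, the same for inputs of all sizes, and its constants are rational. -/

namespace RealRAM

/-- A configuration: natural-number index registers `idx i`, and real memory organised in arrays,
`mem a k` being cell `k` of array `a`. -/
structure State where
  idx : ℕ → ℕ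
  mem : ℕ → ℕ → ℝ

/-- A memory operand: the cell of array `arr` whose position is held by index register `reg`. -/
structure Cell where
  arr : ℕ
  reg : ℕ

/-- The real number stored in an operand. -/
def State.get (s : State) (c : Cell) : ℝ := s.mem c.arr (s.idx c.reg)

/-- Store a real number in an operand. -/
def State.put (s : State) (c : Cell) (v : ℝ) : State :=
  ⟨s.idx, Function.update s.mem c.arr (Function.update (s.mem c.arr) (s.idx c.reg) v)⟩

/-- Store a natural number in an index register. -/
def State.putIdx (s : State) (i v : ℕ) : State :=
  ⟨Function.update s.idx i v, s.mem⟩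

/-- Elementary instructions; the first operand is the destination. -/
inductive Instr where
  | idxConst (i k : ℕ)
  | idxAdd (i j k : ℕ)
  | idxSub (i j k : ℕ)
  | const (d : Cell) (q : ℚ)
  | copy (d a : Cell)
  | add (d a b : Cell)
  | sub (d a b : Cell)
  | mul (d a b : Cell)
  | div (d a b : Cell)

/-- The effect of an instruction. Subtraction of indices is truncated at `0`, and a real division
by `0` returns `0`. -/
def Instr.run : Instr → State → State
  | idxConst i k, s => s.putIdx i k
  | idxAdd i j k, s => s.putIdx i (s.idx j + s.idx k)
  | idxSub i j k, s => s.putIdx i (s.idx j - s.idx k)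
  | const d q, s => s.put d (q : ℝ)
  | copy d a, s => s.put d (s.get a)
  | add d a b, s => s.put d (s.get a + s.get b)
  | sub d a b, s => s.put d (s.get a - s.get b)
  | mul d a b, s => s.put d (s.get a * s.get b)
  | div d a b, s => s.put d (s.get a / s.get b)

/-- Tests: comparison of two index registers or of two real cells. -/
inductive Test where
  | idxLt (i j : ℕ)
  | lt (a b : Cell)
  | le (a b : Cell)

/-- The outcome of a test. -/
def Test.Holds : Test → State → Prop
  | idxLt i j, s => s.idx i < s.idx j
  | lt a b, s => s.get a < s.get b
  | le a b, s => s.get a ≤ s.get b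

/-- Programs. -/
inductive Program where
  | instr (i : Instr)
  | seq (c₁ c₂ : Program)
  | cond (b : Test) (c₁ c₂ : Program)
  | loop (b : Test) (c : Program)

/-- `Exec c s t s'`: started in configuration `s`, the program `c` halts after exactly `t` steps
(executed instructions and evaluated tests) in configuration `s'`. `cond b c₁ c₂` runs `c₁` if `b`
holds and `c₂` otherwise; `loop b c` runs `c` as long as `b` holds. -/
inductive Exec : Program → State → ℕ → State → Prop
  | instr (i : Instr) (s : State) : Exec (.instr i) s 1 (i.run s)
  | seq {c₁ c₂ : Program} {s s₁ s₂ : State} {t₁ t₂ : ℕ} :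
      Exec c₁ s t₁ s₁ → Exec c₂ s₁ t₂ s₂ → Exec (.seq c₁ c₂) s (t₁ + t₂) s₂
  | cond_true {b : Test} {c₁ c₂ : Program} {s s' : State} {t : ℕ} :
      b.Holds s → Exec c₁ s t s' → Exec (.cond b c₁ c₂) s (t + 1) s'
  | cond_false {b : Test} {c₁ c₂ : Program} {s s' : State} {t : ℕ} :
      ¬ b.Holds s → Exec c₂ s t s' → Exec (.cond b c₁ c₂) s (t + 1) s'
  | loop_true {b : Test} {c : Program} {s s₁ s₂ : State} {t₁ t₂ : ℕ} :
      b.Holds s → Exec c s t₁ s₁ → Exec (.loop b c) s₁ t₂ s₂ →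
      Exec (.loop b c) s (t₁ + t₂ + 1) s₂
  | loop_false {b : Test} {c : Program} {s : State} :
      ¬ b.Holds s → Exec (.loop b c) s 1 s

/-- The initial configuration on input `(L, n, A, C)`: index registers `0` and `1` hold `L` and
`n`, arrays `0` and `1` hold the coefficients of `A` and of `C`, and everything else is `0`. -/
def input (L n : ℕ) (A C : ℝ[X]) : State where
  idx := fun i => if i = 0 then L else if i = 1 then n else 0
  mem := fun a k => if a = 0 then A.coeff k else if a = 1 then C.coeff k else 0

/-- Arrays `2` and `3` hold the coefficients up to degree `L` of `B` and of `D`, each up to an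
error of at most `2⁻ⁿ`. -/
def OutputApproximates (s : State) (L n : ℕ) (B D : ℝ[X]) : Prop :=
  ∀ k ≤ L, |s.mem 2 k - B.coeff k| ≤ (1 / 2 : ℝ) ^ n ∧ |s.mem 3 k - D.coeff k| ≤ (1 / 2 : ℝ) ^ n

end RealRAM

end

/-!
Write `w = e^{iθ/2}`. A composite gate of length `L` is an element of `SU(2)` whose entries are
`w⁻ᴸ a(w²)` and `w⁻ᴸ b(w²)` with polynomials `a`, `b` of degree at most `L` that satisfy
`a ā - b b̄ = X^L` (the bar conjugates the coefficients), with `a` symmetric, `b` antisymmetric and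
`a(1) = 1`. Conversely, such a pair comes from a composite gate: the phase of a rotation can be chosen
so that splitting it off lowers the degree (`exists_phases`).

The given `A` and `C` turn into real polynomials `h` and `g` with `h(w²) = w^L A(x)` and
`g(w²) = i w^L C(y)` (`lift`), and `a = h + i (P + P^*) / 2`, `b = g - i (P - P^*) / 2` is a pair as
above if `P` is a real polynomial with reciprocal `P^*` and `P P^* = F`, where `F = X^L - h² + g²`
(`achievable_of_factor`). On the unit circle `z⁻ᴸ F(z)` is `1 - A² - C² ≥ 0`, so the Fejér–Riesz
theorem (`fejer_riesz`) gives `F = c O O^*` with an outer factor `O = ∏ (1 - b z)`, `|b| ≤ 1`. This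
factor is real, and `P = √c O`. Then `B` and `D` are read off `P` in terms of odd Chebyshev
polynomials (`outPoly`).

To compute `P`, consider the Toeplitz form of the coefficients of `F`, which by Parseval's identity
sends a coefficient vector `q` to `c ‖q O‖²`. If one minimizes it over all vectors of `N` blocks of
length `L + 1` whose first block is a given one, the last row of the resulting form in the first block
tends to the coefficients of `c O` in reverse order as `N` grows. The outer factor may vanish on the
circle; it still has an approximate inverse, a product of Fejér means of geometric series
(`exists_approx_inverse`), and comparing the minimizer with it gives an error of order
`2^O(L) N^{-1/2}`, uniformly in `F` (`IsChainMin.last_row_approx`). The minimum for `N = 2^R` takes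
only `R` steps, as two minimized chains of blocks can be glued at a common block, which is then
eliminated (`isChainMin_doubling`). So a number of steps linear in `L + n` gives `n` correct digits.
Heron's iteration then supplies the square root in `√c O = (c O) / c * √c` (`exists_factor`).

The algorithm is written in a small array language, every statement of which is carried out by a
random access machine in polynomial time (`Stmt.computable`).
-/

/-! ### Running programs and evaluating index expressions -/

namespace RealRAM

/-- `c` takes `s` to `s'` in at most `T` steps. -/
def Runs (c : Program) (s s' : State) (T : ℕ) : Prop := ∃ t ≤ T, Exec c s t s'

theorem Runs.mono {c : Program} {s s' : State} {T T' : ℕ} (h : Runs c s s' T) (hT : T ≤ T') :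
    Runs c s s' T' :=
  let ⟨t, ht, he⟩ := h; ⟨t, ht.trans hT, he⟩

theorem Runs.instr (i : Instr) (s : State) : Runs (.instr i) s (i.run s) 1 :=
  ⟨1, le_rfl, .instr i s⟩

theorem Runs.seq {c₁ c₂ : Program} {s s₁ s₂ : State} {T₁ T₂ : ℕ}
    (h₁ : Runs c₁ s s₁ T₁) (h₂ : Runs c₂ s₁ s₂ T₂) : Runs (.seq c₁ c₂) s s₂ (T₁ + T₂) :=
  let ⟨_, ht₁, he₁⟩ := h₁; let ⟨_, ht₂, he₂⟩ := h₂
  ⟨_, Nat.add_le_add ht₁ ht₂, .seq he₁ he₂⟩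

/-- Set register `r` to `0` and `one` to `1`, then run `c` and increment `r` as long as `r` is
smaller than register `b`. -/
def countLoop (r b one : ℕ) (c : Program) : Program :=
  .seq (.instr (.idxConst r 0)) (.seq (.instr (.idxConst one 1))
    (.loop (.idxLt r b) (.seq c (.instr (.idxAdd r r one)))))

/-- The rule for counting loops: the invariant `I k` is kept by each of the `N` rounds, which take
at most `T` steps each, and the body preserves the three registers that control the loop. -/
theorem Runs.countLoop {r b one : ℕ} {c : Program} {N T : ℕ} (I : ℕ → State → Prop)
    (hrb : r ≠ b) (hro : r ≠ one) (hbo : b ≠ one)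
    (hstep : ∀ k < N, ∀ s, I k s → s.idx r = k → s.idx b = N → s.idx one = 1 →
      ∃ s', Runs c s s' T ∧ s'.idx r = k ∧ s'.idx b = N ∧ s'.idx one = 1 ∧
        I (k + 1) (s'.putIdx r (k + 1)))
    (s : State) (hb : s.idx b = N) (h0 : I 0 ((s.putIdx r 0).putIdx one 1)) :
    ∃ s', Runs (countLoop r b one c) s s' (N * (T + 2) + 3) ∧ I N s' := by
  have key : ∀ d k, k + d = N → ∀ s, I k s → s.idx r = k → s.idx b = N → s.idx one = 1 →
      ∃ s', Runs (.loop (.idxLt r b) (.seq c (.instr (.idxAdd r r one)))) s s'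
        (d * (T + 2) + 1) ∧ I N s' := by
    intro d
    induction d with
    | zero =>
      intro k hk s hI hr hb ho
      refine ⟨s, ⟨1, by omega, .loop_false ?_⟩, by simpa [← hk] using hI⟩
      simp only [Test.Holds]; omega
    | succ d ih =>
      intro k hk s hI hr hb ho
      obtain ⟨s₁, hs₁, hr₁, hb₁, ho₁, hI₁⟩ := hstep k (by omega) s hI hr hb ho
      have e : (Instr.idxAdd r r one).run s₁ = s₁.putIdx r (k + 1) := by
        simp [Instr.run, hr₁, ho₁]
      obtain ⟨s₂, ⟨t₂, ht₂, he₂⟩, hI₂⟩ := ih (k + 1) (by omega) (s₁.putIdx r (k + 1)) hI₁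
        (by simp [State.putIdx]) (by simp [State.putIdx, hrb.symm, hb₁])
        (by simp [State.putIdx, hro.symm, ho₁])
      obtain ⟨t₁, ht₁, he₁⟩ := hs₁
      refine ⟨s₂, ⟨(t₁ + 1) + t₂ + 1, by linarith, ?_⟩, hI₂⟩
      refine .loop_true (by simp only [Test.Holds]; omega) (.seq he₁ (.instr _ _)) ?_
      rw [e]; exact he₂
  obtain ⟨s', hs', hI'⟩ := key N 0 (by omega) _ h0 (by simp [State.putIdx, hro])
    (by simp [State.putIdx, hrb.symm, hbo, hb]) (by simp [State.putIdx])
  exact ⟨s', ((Runs.instr _ _).seq ((Runs.instr _ _).seq hs')).mono (by omega), hI'⟩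

/-- Index expressions in sixteen index variables. -/
inductive IExp where
  | var (r : Fin 16)
  | lit (k : ℕ)
  | add (a b : IExp)
  | sub (a b : IExp)
  | mul (a b : IExp)
  | half (a : IExp)

/-- The value of an index expression. Subtraction and halving are those of `ℕ`. -/
@[simp] def IExp.eval (ρ : Fin 16 → ℕ) : IExp → ℕ
  | var r => ρ r
  | lit k => k
  | add a b => a.eval ρ + b.eval ρ
  | sub a b => a.eval ρ - b.eval ρ
  | mul a b => a.eval ρ * b.eval ρ
  | half a => a.eval ρ / 2

/-- Index expressions grow polynomially, since they are evaluated without iteration. This bounds the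
length of loops and of the multiplications by repeated addition. -/
theorem IExp.exists_bound (e : IExp) :
    ∃ p : ℕ[X], ∀ (ρ : Fin 16 → ℕ) (B : ℕ), (∀ r, ρ r ≤ B) → e.eval ρ ≤ p.eval B := by
  induction e with
  | var r => exact ⟨X, fun ρ B h => by simpa using h r⟩
  | lit k => exact ⟨(k : ℕ[X]), fun ρ B h => by simp⟩
  | add a b iha ihb =>
    obtain ⟨p, hp⟩ := iha; obtain ⟨q, hq⟩ := ihb
    exact ⟨p + q, fun ρ B h => by simpa using Nat.add_le_add (hp ρ B h) (hq ρ B h)⟩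
  | sub a b iha ihb =>
    obtain ⟨p, hp⟩ := iha
    exact ⟨p, fun ρ B h => (Nat.sub_le _ _).trans (hp ρ B h)⟩
  | mul a b iha ihb =>
    obtain ⟨p, hp⟩ := iha; obtain ⟨q, hq⟩ := ihb
    exact ⟨p * q, fun ρ B h => by simpa using Nat.mul_le_mul (hp ρ B h) (hq ρ B h)⟩
  | half a iha =>
    obtain ⟨p, hp⟩ := iha
    exact ⟨p, fun ρ B h => (Nat.div_le_self _ _).trans (hp ρ B h)⟩

/-- The values of the index variables in a configuration. -/
def State.vars (s : State) : Fin 16 → ℕ := fun r => s.idx r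

theorem State.vars_congr {s s' : State} {d : ℕ} (hd : 16 ≤ d) (h : ∀ r < d, s'.idx r = s.idx r) :
    s'.vars = s.vars :=
  funext fun r => h _ (lt_of_lt_of_le r.2 hd)

/-- Some program evaluates the index function `f` into register `d`, in polynomial time with
respect to a bound on the index variables, and changes nothing else but registers beyond `d`. -/
def IdxComputable (f : (Fin 16 → ℕ) → ℕ) (d : ℕ) : Prop :=
  ∃ (c : Program) (p : ℕ[X]), ∀ (s : State) (B : ℕ), (∀ r, s.vars r ≤ B) →
    ∃ s', Runs c s s' (p.eval B) ∧ s'.mem = s.mem ∧ s'.idx d = f s.vars ∧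
      ∀ r < d, s'.idx r = s.idx r

/-- Multiplication is carried out by repeated addition and halving by repeated subtraction, as the
machine has neither on index registers; both take a number of steps linear in an operand. -/
theorem IExp.idxComputable (e : IExp) : ∀ d, 16 ≤ d → IdxComputable (e.eval ·) d := by
  have bin : ∀ (a b : IExp) (f : ℕ → ℕ → ℕ) (i : ℕ → Instr),
      (∀ d s, (i d).run s = s.putIdx d (f (s.idx d) (s.idx (d + 1)))) →
      (∀ d, 16 ≤ d → IdxComputable (a.eval ·) d) → (∀ d, 16 ≤ d → IdxComputable (b.eval ·) d) →
      ∀ d, 16 ≤ d → IdxComputable (fun ρ => f (a.eval ρ) (b.eval ρ)) d := by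
    intro a b f i hi ha hb d hd
    obtain ⟨c₁, p₁, h₁⟩ := ha d hd
    obtain ⟨c₂, p₂, h₂⟩ := hb (d + 1) (by omega)
    refine ⟨.seq c₁ (.seq c₂ (.instr (i d))), p₁ + (p₂ + 1), fun s B hB => ?_⟩
    obtain ⟨s₁, r₁, m₁, v₁, k₁⟩ := h₁ s B hB
    have e₁ := State.vars_congr hd k₁
    obtain ⟨s₂, r₂, m₂, v₂, k₂⟩ := h₂ s₁ B (by rwa [e₁])
    refine ⟨_, by simpa using r₁.seq (r₂.seq (.instr _ _)), ?_, ?_, ?_⟩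
    · simp [hi, State.putIdx, m₁, m₂]
    · simp [hi, State.putIdx, v₂, k₂ d (by omega), v₁, e₁]
    · intro r hr
      simp [hi, State.putIdx, hr.ne, k₂ r (by omega), k₁ r hr]
  induction e with
  | var r =>
    intro d hd
    refine ⟨.seq (.instr (.idxConst d 0)) (.instr (.idxAdd d d r)), 2, fun s B hB =>
      ⟨_, ((Runs.instr _ _).seq (.instr _ _)).mono (by simp), rfl, ?_, ?_⟩⟩
    · have : (r : ℕ) ≠ d := by omega
      simp [Instr.run, State.putIdx, State.vars, this]
    · intro r' hr'
      simp [Instr.run, State.putIdx, hr'.ne]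
  | lit k =>
    intro d hd
    refine ⟨.instr (.idxConst d k), 1, fun s B hB => ⟨_, (Runs.instr _ _).mono (by simp),
      rfl, ?_, ?_⟩⟩
    · simp [Instr.run, State.putIdx]
    · intro r' hr'
      simp [Instr.run, State.putIdx, hr'.ne]
  | add a b iha ihb =>
    exact bin a b (· + ·) (fun d => .idxAdd d d (d + 1)) (fun d s => rfl) iha ihb
  | sub a b iha ihb =>
    exact bin a b (· - ·) (fun d => .idxSub d d (d + 1)) (fun d s => rfl) iha ihb
  | mul a b iha ihb =>
    intro d hd
    obtain ⟨c₁, p₁, h₁⟩ := iha (d + 1) (by omega)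
    obtain ⟨c₂, p₂, h₂⟩ := ihb (d + 2) (by omega)
    obtain ⟨q, hq⟩ := b.exists_bound
    refine ⟨.seq c₁ (.seq c₂ (.seq (.instr (.idxConst d 0))
      (countLoop (d + 3) (d + 2) (d + 4) (.instr (.idxAdd d d (d + 1)))))),
      p₁ + (p₂ + (1 + (q * 3 + 3))), fun s B hB => ?_⟩
    obtain ⟨s₁, r₁, m₁, v₁, k₁⟩ := h₁ s B hB
    have e₁ := State.vars_congr (by omega) k₁
    obtain ⟨s₂, r₂, m₂, v₂, k₂⟩ := h₂ s₁ B (by rwa [e₁])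
    obtain ⟨s₃, r₃, I₃⟩ := Runs.countLoop (r := d + 3) (b := d + 2) (one := d + 4)
      (c := .instr (.idxAdd d d (d + 1))) (N := b.eval s.vars) (T := 1)
      (fun k σ => σ.mem = s.mem ∧ σ.idx d = k * a.eval s.vars ∧ σ.idx (d + 1) = a.eval s.vars ∧
        ∀ r < d, σ.idx r = s.idx r) (by omega) (by omega) (by omega)
      (by
        rintro k hk σ ⟨hm, hd', ha, hr⟩ h1 h2 h3
        refine ⟨_, Runs.instr _ _, ?_⟩
        simp only [Instr.run, State.putIdx]
        refine ⟨by simp [h1], by simp [h2], by simp [h3], hm, ?_, ?_, ?_⟩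
        · simp [hd', ha]; ring
        · simp [ha]
        · intro r hr'
          have : r ≠ d := by omega
          have : r ≠ d + 3 := by omega
          simp [*])
      ((Instr.idxConst d 0).run s₂) (by simp [Instr.run, State.putIdx, v₂, e₁])
      (by
        simp only [Instr.run, State.putIdx]
        refine ⟨by simp [m₁, m₂], by simp, by simp [v₁, k₂ (d + 1) (by omega)], ?_⟩
        intro r hr'
        have h1 : r ≠ d := by omega
        have h2 : r ≠ d + 3 := by omega
        have h3 : r ≠ d + 4 := by omega
        simp [h1, h2, h3, k₁ r (by omega), k₂ r (by omega)])
    refine ⟨s₃, (r₁.seq (r₂.seq ((Runs.instr _ _).seq r₃))).mono ?_, I₃.1, ?_, I₃.2.2.2⟩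
    · have := hq s.vars B hB
      simp; omega
    · simp [I₃.2.1, mul_comm]
  | half a iha =>
    intro d hd
    obtain ⟨c₁, p₁, h₁⟩ := iha (d + 1) (by omega)
    obtain ⟨q, hq⟩ := a.exists_bound
    -- register `d + 2` holds `a - 2 k`, register `d` holds `k`, for as long as `1 < a - 2 k`
    refine ⟨.seq c₁ (.seq (.instr (.idxConst d 0)) (.seq (.instr (.idxConst (d + 2) 1))
      (.seq (.instr (.idxConst (d + 3) 2)) (.loop (.idxLt (d + 2) (d + 1))
        (.seq (.instr (.idxSub (d + 1) (d + 1) (d + 3))) (.instr (.idxAdd d d (d + 2)))))))),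
      p₁ + (1 + (1 + (1 + (q * 3 + 1)))), fun s B hB => ?_⟩
    obtain ⟨s₁, r₁, m₁, v₁, k₁⟩ := h₁ s B hB
    have key : ∀ x (σ : State), σ.idx (d + 1) = x → σ.idx (d + 2) = 1 → σ.idx (d + 3) = 2 →
        ∃ σ', Runs (.loop (.idxLt (d + 2) (d + 1))
        (.seq (.instr (.idxSub (d + 1) (d + 1) (d + 3))) (.instr (.idxAdd d d (d + 2))))) σ σ'
          (x * 3 + 1) ∧ σ'.mem = σ.mem ∧ σ'.idx d = σ.idx d + x / 2 ∧
          ∀ r < d, σ'.idx r = σ.idx r := by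
      intro x
      induction x using Nat.strong_induction_on with
      | _ x ih =>
        intro σ hx h1 h2
        by_cases hlt : 1 < x
        · obtain ⟨σ', ⟨t, ht, he⟩, hm, hd', hr⟩ := ih (x - 2) (by omega)
            ((Instr.idxAdd d d (d + 2)).run ((Instr.idxSub (d + 1) (d + 1) (d + 3)).run σ))
            (by simp [Instr.run, State.putIdx, hx, h2]) (by simp [Instr.run, State.putIdx, h1])
            (by simp [Instr.run, State.putIdx, h2])
          refine ⟨σ', ⟨1 + 1 + t + 1, by omega, .loop_true (by simp [Test.Holds, hx, h1, hlt])
            (.seq (.instr _ _) (.instr _ _)) he⟩,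
            by simpa [Instr.run, State.putIdx] using hm, ?_, ?_⟩
          · simp [Instr.run, State.putIdx, h1] at hd'
            omega
          · intro r hr'
            rw [hr r hr']
            have h1 : r ≠ d := by omega
            have h2 : r ≠ d + 1 := by omega
            simp [Instr.run, State.putIdx, h1, h2]
        · exact ⟨σ, ⟨1, by omega, .loop_false (by simp [Test.Holds, hx, h1]; omega)⟩, rfl,
            by omega, fun _ _ => rfl⟩
    obtain ⟨s₂, r₂, m₂, v₂, k₂⟩ := key (a.eval s.vars) ((Instr.idxConst (d + 3) 2).run
      ((Instr.idxConst (d + 2) 1).run ((Instr.idxConst d 0).run s₁)))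
      (by simp [Instr.run, State.putIdx, v₁]) (by simp [Instr.run, State.putIdx])
      (by simp [Instr.run, State.putIdx])
    refine ⟨s₂, (r₁.seq ((Runs.instr _ _).seq ((Runs.instr _ _).seq
      ((Runs.instr _ _).seq r₂)))).mono ?_, ?_, ?_, ?_⟩
    · have := hq s.vars B hB
      simp; omega
    · simpa [Instr.run, State.putIdx, m₁] using m₂
    · simpa [Instr.run, State.putIdx] using v₂
    · intro r hr
      rw [k₂ r hr]
      have h1 : r ≠ d := by omega
      have h2 : r ≠ d + 2 := by omega
      have h3 : r ≠ d + 3 := by omega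
      simp [Instr.run, State.putIdx, h1, h2, h3, k₁ r (by omega)]

end RealRAM

/-! ### A small array language and its compilation -/

namespace RealRAM

/-- Binary real operations. -/
inductive ROp where
  | add
  | sub
  | mul
  | div

/-- The value of a binary operation; division by `0` gives `0`. -/
@[simp] noncomputable def ROp.eval : ROp → ℝ → ℝ → ℝ
  | add => (· + ·)
  | sub => (· - ·)
  | mul => (· * ·)
  | div => (· / ·)

/-- The instruction carrying out a binary operation. -/
def ROp.toInstr : ROp → Cell → Cell → Cell → Instr
  | add => .add
  | sub => .sub
  | mul => .mul
  | div => .div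

theorem ROp.toInstr_run (o : ROp) (c a b : Cell) (s : State) :
    (o.toInstr c a b).run s = s.put c (o.eval (s.get a) (s.get b)) := by
  cases o <;> rfl

/-- Real expressions over sixteen arrays; `ite i j e₁ e₂` is `e₁` if `i < j` and `e₂` otherwise. -/
inductive RExp where
  | cell (a : Fin 16) (i : IExp)
  | lit (q : ℚ)
  | op (o : ROp) (a b : RExp)
  | ite (i j : IExp) (a b : RExp)

/-- The value of a real expression. -/
@[simp] noncomputable def RExp.eval (ρ : Fin 16 → ℕ) (μ : Fin 16 → ℕ → ℝ) : RExp → ℝ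
  | cell a i => μ a (i.eval ρ)
  | lit q => q
  | op o a b => o.eval (a.eval ρ μ) (b.eval ρ μ)
  | ite i j a b => if i.eval ρ < j.eval ρ then a.eval ρ μ else b.eval ρ μ

/-- The first sixteen arrays of a configuration; the arrays beyond them hold temporaries. -/
def State.arrs (s : State) : Fin 16 → ℕ → ℝ := fun a => s.mem a

theorem State.arrs_congr {s s' : State} {k : ℕ} (hk : 16 ≤ k) (h : ∀ a < k, s'.mem a = s.mem a) :
    s'.arrs = s.arrs :=
  funext fun a => h _ (lt_of_lt_of_le a.2 hk)

/-- Some program evaluates the real function `f` into array `k`, at the position held by register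
`0`, in polynomial time with respect to a bound on the index variables; it may use the registers
from `d` on and the arrays from `k` on. -/
def RealComputable (f : (Fin 16 → ℕ) → (Fin 16 → ℕ → ℝ) → ℝ) (d k : ℕ) : Prop :=
  ∃ (c : Program) (p : ℕ[X]), ∀ (s : State) (B : ℕ), (∀ r, s.vars r ≤ B) →
    ∃ s', Runs c s s' (p.eval B) ∧ (∀ r < d, s'.idx r = s.idx r) ∧
      (∀ a < k, s'.mem a = s.mem a) ∧ s'.get ⟨k, 0⟩ = f s.vars s.arrs

/-- Expressions are evaluated on a stack: the second operand of an operation goes to the array after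
that of the first. -/
theorem RExp.realComputable (e : RExp) :
    ∀ d k, 16 ≤ d → 16 ≤ k → RealComputable (e.eval · ·) d k := by
  induction e with
  | cell a i =>
    intro d k hd hk
    obtain ⟨c, p, h⟩ := i.idxComputable d hd
    refine ⟨.seq c (.instr (.copy ⟨k, 0⟩ ⟨a, d⟩)), p + 1, fun s B hB => ?_⟩
    obtain ⟨s₁, r₁, m₁, v₁, k₁⟩ := h s B hB
    refine ⟨_, (r₁.seq (.instr _ _)).mono (by simp), k₁, fun b hb => ?_, ?_⟩
    · simp [Instr.run, State.put, hb.ne, m₁]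
    · simp [Instr.run, State.put, State.get, m₁, v₁, State.arrs]
  | lit q =>
    intro d k hd hk
    refine ⟨.instr (.const ⟨k, 0⟩ q), 1, fun s B hB => ⟨_, (Runs.instr _ _).mono (by simp),
      fun r _ => rfl, fun b hb => ?_, ?_⟩⟩
    · simp [Instr.run, State.put, hb.ne]
    · simp [Instr.run, State.put, State.get]
  | op o a b iha ihb =>
    intro d k hd hk
    obtain ⟨c₁, p₁, h₁⟩ := iha d k hd hk
    obtain ⟨c₂, p₂, h₂⟩ := ihb d (k + 1) hd (by omega)
    refine ⟨.seq c₁ (.seq c₂ (.instr (o.toInstr ⟨k, 0⟩ ⟨k, 0⟩ ⟨k + 1, 0⟩))), p₁ + (p₂ + 1),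
      fun s B hB => ?_⟩
    obtain ⟨s₁, r₁, i₁, m₁, v₁⟩ := h₁ s B hB
    have e₁ := State.vars_congr hd i₁
    obtain ⟨s₂, r₂, i₂, m₂, v₂⟩ := h₂ s₁ B (by rwa [e₁])
    rw [e₁, State.arrs_congr hk m₁] at v₂
    have v₁' : s₂.get ⟨k, 0⟩ = a.eval s.vars s.arrs := by
      refine Eq.trans ?_ v₁
      simp only [State.get, m₂ k (by omega), i₂ 0 (by omega)]
    refine ⟨_, (r₁.seq (r₂.seq (.instr _ _))).mono (by simp), fun r hr => ?_, fun b hb => ?_, ?_⟩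
    · simp [ROp.toInstr_run, State.put, i₂ r hr, i₁ r hr]
    · simp [ROp.toInstr_run, State.put, hb.ne, m₁ b hb, m₂ b (by omega)]
    · rw [ROp.toInstr_run, v₁', v₂]
      simp [State.put, State.get]
  | ite i j a b iha ihb =>
    intro d k hd hk
    obtain ⟨c₁, p₁, h₁⟩ := i.idxComputable d hd
    obtain ⟨c₂, p₂, h₂⟩ := j.idxComputable (d + 1) (by omega)
    obtain ⟨c₃, p₃, h₃⟩ := iha d k hd hk
    obtain ⟨c₄, p₄, h₄⟩ := ihb d k hd hk
    refine ⟨.seq c₁ (.seq c₂ (.cond (.idxLt d (d + 1)) c₃ c₄)), p₁ + (p₂ + (p₃ + p₄ + 1)),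
      fun s B hB => ?_⟩
    obtain ⟨s₁, r₁, m₁, v₁, k₁⟩ := h₁ s B hB
    have e₁ := State.vars_congr hd k₁
    obtain ⟨s₂, r₂, m₂, v₂, k₂⟩ := h₂ s₁ B (by rwa [e₁])
    have e₂ : s₂.vars = s.vars := by rw [State.vars_congr (by omega) k₂, e₁]
    have e₃ : s₂.arrs = s.arrs := by funext a; simp [State.arrs, m₁, m₂]
    obtain ⟨s₃, ⟨t₃, ht₃, r₃⟩, i₃, m₃, v₃⟩ := h₃ s₂ B (by rwa [e₂])
    obtain ⟨s₄, ⟨t₄, ht₄, r₄⟩, i₄, m₄, v₄⟩ := h₄ s₂ B (by rwa [e₂])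
    have hc : s₂.idx d = i.eval s.vars := by rw [k₂ d (by omega), v₁]
    rw [e₁] at v₂
    by_cases hlt : i.eval s.vars < j.eval s.vars
    · refine ⟨s₃, (r₁.seq (r₂.seq ⟨_, le_rfl, .cond_true (by simpa [Test.Holds, hc, v₂]) r₃⟩)).mono
        (by simp; omega), fun r hr => by rw [i₃ r hr, k₂ r (by omega), k₁ r hr],
        fun b hb => by rw [m₃ b hb, m₂, m₁], by simp [v₃, e₂, e₃, hlt]⟩
    · refine ⟨s₄, (r₁.seq (r₂.seq ⟨_, le_rfl, .cond_false (by simpa [Test.Holds, hc, v₂] using hlt)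
        r₄⟩)).mono (by simp; omega), fun r hr => by rw [i₄ r hr, k₂ r (by omega), k₁ r hr],
        fun b hb => by rw [m₄ b hb, m₂, m₁], by simp [v₄, e₂, e₃, hlt]⟩

/-- `iter F x n` applies `F 0`, …, `F (n - 1)` to `x`, in this order. -/
def iter {α : Type*} (F : ℕ → α → α) (x : α) : ℕ → α
  | 0 => x
  | k + 1 => F k (iter F x k)

/-- Statements. `par a N W e` assigns to the first `N * W` cells of array `a`, simultaneously, the
values of `e`, where in cell `i * W + j` the variables `14` and `15` stand for `i` and `j`;
`loop r N c` runs `c` for the values `0, …, N - 1` of the variable `r`. -/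
inductive Stmt where
  | par (a : Fin 16) (N W : IExp) (e : RExp)
  | seq (c₁ c₂ : Stmt)
  | loop (r : Fin 16) (N : IExp) (c : Stmt)

/-- The effect of a statement on the arrays. -/
@[simp] noncomputable def Stmt.run : Stmt → (Fin 16 → ℕ) → (Fin 16 → ℕ → ℝ) → Fin 16 → ℕ → ℝ
  | par a N W e, ρ, μ => Function.update μ a fun p =>
      if p < N.eval ρ * W.eval ρ then
        e.eval (Function.update (Function.update ρ 14 (p / W.eval ρ)) 15 (p % W.eval ρ)) μ
      else μ a p
  | seq c₁ c₂, ρ, μ => c₂.run ρ (c₁.run ρ μ)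
  | loop r N c, ρ, μ => iter (fun k => c.run (Function.update ρ r k)) μ (N.eval ρ)

/-- Some program carries out the transformation `F` of the arrays, in polynomial time with respect
to a bound on the index variables; it preserves the registers before `d`. -/
def StmtComputable (F : (Fin 16 → ℕ) → (Fin 16 → ℕ → ℝ) → Fin 16 → ℕ → ℝ) (d : ℕ) : Prop :=
  ∃ (c : Program) (p : ℕ[X]), ∀ (s : State) (B : ℕ), (∀ r, s.vars r ≤ B) →
    ∃ s', Runs c s s' (p.eval B) ∧ (∀ r < d, s'.idx r = s.idx r) ∧ s'.arrs = F s.vars s.arrs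

theorem stmtComputable_seq {F G : (Fin 16 → ℕ) → (Fin 16 → ℕ → ℝ) → Fin 16 → ℕ → ℝ} {d : ℕ}
    (hd : 16 ≤ d) (hF : StmtComputable F d) (hG : StmtComputable G d) :
    StmtComputable (fun ρ μ => G ρ (F ρ μ)) d := by
  obtain ⟨c₁, p₁, h₁⟩ := hF
  obtain ⟨c₂, p₂, h₂⟩ := hG
  refine ⟨.seq c₁ c₂, p₁ + p₂, fun s B hB => ?_⟩
  obtain ⟨s₁, r₁, i₁, v₁⟩ := h₁ s B hB
  have e₁ := State.vars_congr hd i₁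
  obtain ⟨s₂, r₂, i₂, v₂⟩ := h₂ s₁ B (by rwa [e₁])
  exact ⟨s₂, (r₁.seq r₂).mono (by simp), fun r hr => by rw [i₂ r hr, i₁ r hr],
    by rw [v₂, e₁, v₁]⟩

theorem stmtComputable_loop {F : (Fin 16 → ℕ) → (Fin 16 → ℕ → ℝ) → Fin 16 → ℕ → ℝ} {d : ℕ}
    (hd : 16 ≤ d) (r : Fin 16) (N : IExp) (hF : StmtComputable F (d + 3)) :
    StmtComputable (fun ρ μ => iter (fun k => F (Function.update ρ r k)) μ (N.eval ρ)) d := by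
  obtain ⟨c₁, p₁, h₁⟩ := N.idxComputable (d + 1) (by omega)
  obtain ⟨c₂, p₂, h₂⟩ := hF
  obtain ⟨q, hq⟩ := N.exists_bound
  -- register `d` saves the value of the variable `r`
  refine ⟨.seq (.instr (.idxConst d 0)) (.seq (.instr (.idxAdd d d r)) (.seq c₁
    (.seq (countLoop r (d + 1) (d + 2) c₂) (.seq (.instr (.idxConst r 0))
    (.instr (.idxAdd r r d)))))),
    1 + (1 + (p₁ + ((q * (p₂.comp (X + q) + 2) + 3) + (1 + 1)))), fun s B hB => ?_⟩
  have hr16 : (r : ℕ) < 16 := r.2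
  set s₀ := (Instr.idxAdd d d r).run ((Instr.idxConst d 0).run s) with hs₀
  have i₀ : ∀ x < d, s₀.idx x = s.idx x := by
    intro x hx
    simp [s₀, Instr.run, State.putIdx, hx.ne]
  have sv₀ : s₀.idx d = s.idx r := by
    have : (r : ℕ) ≠ d := by omega
    simp [s₀, Instr.run, State.putIdx, this]
  have v₀ := State.vars_congr hd i₀
  have m₀ : s₀.arrs = s.arrs := rfl
  obtain ⟨s₁, r₁, m₁, w₁, k₁⟩ := h₁ s₀ B (by rwa [v₀])
  rw [v₀] at w₁
  beta_reduce at w₁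
  obtain ⟨s₂, r₂, a₂, sv₂, k₂⟩ := Runs.countLoop (r := r) (b := d + 1) (one := d + 2) (c := c₂)
    (N := N.eval s.vars) (T := p₂.eval (B + q.eval B))
    (fun k σ => σ.arrs = iter (fun k => F (Function.update s.vars r k)) s.arrs k ∧
      σ.idx d = s.idx r ∧ ∀ x < d, x ≠ r → σ.idx x = s.idx x) (by omega) (by omega) (by omega)
    (by
      rintro k hk σ ⟨ha, hs, hx⟩ h1 h2 h3
      have hv : σ.vars = Function.update s.vars r k := by
        funext x
        by_cases hxr : x = r
        · subst hxr; simp [State.vars, h1]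
        · have : (x : ℕ) ≠ r := fun h => hxr (Fin.ext h)
          simp [hxr, State.vars, hx x (by omega) this]
      obtain ⟨σ', r', i', v'⟩ := h₂ σ (B + q.eval B) (by
        intro x
        have := hq s.vars B hB
        rw [hv]
        by_cases hxr : x = r
        · subst hxr; simp; omega
        · simp only [hxr, ne_eq, not_false_eq_true, Function.update_of_ne]
          exact (hB x).trans (by omega))
      refine ⟨σ', r', by rw [i' _ (by omega), h1], by rw [i' _ (by omega), h2],
        by rw [i' _ (by omega), h3], ?_, ?_, ?_⟩
      · change σ'.arrs = _
        rw [v', hv, ha]; rfl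
      · have : d ≠ r := by omega
        simp [State.putIdx, this, i' d (by omega), hs]
      · intro x hx' hxr
        simp [State.putIdx, hxr, i' x (by omega), hx x hx' hxr])
    s₁ w₁
    (by
      refine ⟨?_, ?_, ?_⟩
      · change s₁.arrs = _
        funext x
        simp [State.arrs, m₁, s₀, iter, Instr.run, State.putIdx]
      · have : d ≠ r := by omega
        simp [State.putIdx, this, k₁ d (by omega), sv₀]
      · intro x hx hxr
        have : x ≠ d + 2 := by omega
        simp [State.putIdx, hxr, this, k₁ x (by omega), i₀ x hx])
  refine ⟨_, ((Runs.instr _ _).seq ((Runs.instr _ _).seq (r₁.seq (r₂.seq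
    ((Runs.instr _ _).seq (.instr _ _)))))).mono ?_, ?_, a₂⟩
  · have := Nat.mul_le_mul_right (p₂.eval (B + q.eval B) + 2) (hq s.vars B hB)
    simp only [eval_add, eval_mul, eval_one, eval_ofNat, eval_comp, eval_X]
    omega
  · intro x hx
    have : d ≠ r := by omega
    by_cases hxr : x = r
    · subst hxr
      simp [Instr.run, State.putIdx, this, sv₂]
    · simp [Instr.run, State.putIdx, hxr, k₂ x hx hxr]

/-- All values are first collected in array `16` and only then copied to the target, because the
expression may refer to the old values of the target. -/
theorem stmtComputable_par (a : Fin 16) (N W : IExp) (e : RExp) {d : ℕ} (hd : 16 ≤ d) :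
    StmtComputable (Stmt.par a N W e).run d := by
  obtain ⟨c₁, p₁, h₁⟩ := N.idxComputable (d + 2) (by omega)
  obtain ⟨c₂, p₂, h₂⟩ := W.idxComputable (d + 3) (by omega)
  obtain ⟨c₃, p₃, h₃⟩ := e.realComputable (d + 7) 17 (by omega) (by omega)
  obtain ⟨qN, hqN⟩ := N.exists_bound
  obtain ⟨qW, hqW⟩ := W.exists_bound
  -- registers `d` and `d + 1` save the values of the variables `14` and `15`, register `d + 4`
  -- counts the cells, and the new values are collected in array `16` before they are copied
  refine ⟨.seq (.seq (.seq (.instr (.idxConst d 0)) (.instr (.idxAdd d d 14)))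
      (.seq (.instr (.idxConst (d + 1) 0)) (.instr (.idxAdd (d + 1) (d + 1) 15))))
    (.seq c₁ (.seq c₂ (.seq (.instr (.idxConst (d + 4) 0))
    (.seq (countLoop 14 (d + 2) (d + 5) (countLoop 15 (d + 3) (d + 5)
      (.seq c₃ (.seq (.instr (.copy ⟨16, d + 4⟩ ⟨17, 0⟩))
        (.instr (.idxAdd (d + 4) (d + 4) (d + 5)))))))
    (.seq (countLoop (d + 6) (d + 4) (d + 5) (.instr (.copy ⟨a, d + 6⟩ ⟨16, d + 6⟩)))
    (.seq (.seq (.instr (.idxConst 14 0)) (.instr (.idxAdd 14 14 d)))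
      (.seq (.instr (.idxConst 15 0)) (.instr (.idxAdd 15 15 (d + 1)))))))))),
    4 + (p₁ + (p₂ + (1 + ((qN * (qW * (p₃.comp (X + qN + qW) + 4) + 5) + 3) +
      ((qN * qW * 3 + 3) + 4))))), fun s B hB => ?_⟩
  set n := N.eval s.vars with hn
  set w := W.eval s.vars with hw
  have hnB : n ≤ qN.eval B := hqN _ _ hB
  have hwB : w ≤ qW.eval B := hqW _ _ hB
  set val : ℕ → ℝ := fun p =>
    e.eval (Function.update (Function.update s.vars 14 (p / w)) 15 (p % w)) s.arrs with hval
  obtain ⟨s₀, r₀, i₀, sv₀, sv₀', m₀⟩ : ∃ s₀, Runs (.seq (.seq (.instr (.idxConst d 0))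
      (.instr (.idxAdd d d 14))) (.seq (.instr (.idxConst (d + 1) 0))
      (.instr (.idxAdd (d + 1) (d + 1) 15)))) s s₀ 4 ∧ (∀ x < d, s₀.idx x = s.idx x) ∧
      s₀.idx d = s.idx 14 ∧ s₀.idx (d + 1) = s.idx 15 ∧ s₀.mem = s.mem := by
    have h14 : 14 ≠ d := by omega
    have h15 : 15 ≠ d := by omega
    have h14' : 14 ≠ d + 1 := by omega
    have h15' : 15 ≠ d + 1 := by omega
    refine ⟨_, ((Runs.instr _ _).seq (.instr _ _)).seq ((Runs.instr _ _).seq (.instr _ _)),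
      fun x hx => ?_, ?_, ?_, rfl⟩
    · have : x ≠ d := by omega
      have : x ≠ d + 1 := by omega
      simp [Instr.run, State.putIdx, *]
    · simp [Instr.run, State.putIdx, h14]
    · simp [Instr.run, State.putIdx, h15, h15']
  have e₀ := State.vars_congr hd i₀
  obtain ⟨s₁, r₁, m₁, v₁, i₁⟩ := h₁ s₀ B (by rwa [e₀])
  have e₁ : s₁.vars = s.vars := by rw [State.vars_congr (by omega) i₁, e₀]
  obtain ⟨s₂, r₂, m₂, v₂, i₂⟩ := h₂ s₁ B (by rwa [e₁])
  rw [e₀] at v₁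
  rw [e₁] at v₂
  beta_reduce at v₁ v₂
  -- the part of the configuration that stays the same while the new values are computed
  let Fixed : State → Prop := fun σ => (∀ x < d, x ≠ 14 → x ≠ 15 → σ.idx x = s.idx x) ∧
    σ.idx d = s.idx 14 ∧ σ.idx (d + 1) = s.idx 15
  have inner : ∀ k < n, ∀ σ, (Fixed σ ∧ σ.idx (d + 3) = w ∧ (∀ x < 16, σ.mem x = s.mem x) ∧
        σ.idx (d + 4) = k * w ∧ ∀ q < k * w, σ.mem 16 q = val q) →
      σ.idx 14 = k → σ.idx (d + 2) = n → σ.idx (d + 5) = 1 →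
      ∃ σ', Runs (countLoop 15 (d + 3) (d + 5) (.seq c₃ (.seq (.instr (.copy ⟨16, d + 4⟩ ⟨17, 0⟩))
        (.instr (.idxAdd (d + 4) (d + 4) (d + 5)))))) σ σ'
          (w * ((p₃.eval (B + qN.eval B + qW.eval B) + (1 + 1)) + 2) + 3) ∧
        σ'.idx 14 = k ∧ σ'.idx (d + 2) = n ∧ σ'.idx (d + 5) = 1 ∧
        (Fixed (σ'.putIdx 14 (k + 1)) ∧ (σ'.putIdx 14 (k + 1)).idx (d + 3) = w ∧
          (∀ x < 16, (σ'.putIdx 14 (k + 1)).mem x = s.mem x) ∧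
        (σ'.putIdx 14 (k + 1)).idx (d + 4) = (k + 1) * w ∧
        ∀ q < (k + 1) * w, (σ'.putIdx 14 (k + 1)).mem 16 q = val q) := by
    rintro k hk σ ⟨⟨f₁, f₂, f₃⟩, hw', hm, hp, hv⟩ h14 hn' h1
    obtain ⟨σ', r', ⟨⟨f₁', f₂', f₃'⟩, g₁, g₂, g₃, g₄, g₅, g₆, g₇⟩⟩ := Runs.countLoop (r := 15)
      (b := d + 3) (one := d + 5)
      (c := .seq c₃ (.seq (.instr (.copy ⟨16, d + 4⟩ ⟨17, 0⟩))
        (.instr (.idxAdd (d + 4) (d + 4) (d + 5)))))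
      (N := w) (T := p₃.eval (B + qN.eval B + qW.eval B) + (1 + 1))
      (fun j τ => Fixed τ ∧ τ.idx 14 = k ∧ τ.idx (d + 2) = n ∧ τ.idx (d + 3) = w ∧
        τ.idx (d + 5) = 1 ∧ (∀ x < 16, τ.mem x = s.mem x) ∧ τ.idx (d + 4) = k * w + j ∧
        ∀ q < k * w + j, τ.mem 16 q = val q) (by omega) (by omega) (by omega)
      (by
        rintro j hj τ ⟨⟨f₁, f₂, f₃⟩, h14, hn', hw', h1, hm, hp, hv⟩ h15 - -
        have hτ : τ.vars = Function.update (Function.update s.vars 14 ((k * w + j) / w)) 15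
            ((k * w + j) % w) := by
          have hd1 : (k * w + j) / w = k := by
            rw [mul_comm, Nat.mul_add_div (by omega), Nat.div_eq_of_lt hj, add_zero]
          have hd2 : (k * w + j) % w = j := by
            rw [mul_comm, Nat.mul_add_mod, Nat.mod_eq_of_lt hj]
          rw [hd1, hd2]
          funext x
          by_cases hx : x = 15
          · subst hx; simpa [State.vars] using h15
          by_cases hx' : x = 14
          · subst hx'; simpa [State.vars] using h14
          have hx1 : (x : ℕ) ≠ 15 := fun h => hx (Fin.ext h)
          have hx2 : (x : ℕ) ≠ 14 := fun h => hx' (Fin.ext h)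
          simp [State.vars, hx, hx', f₁ x (by omega) hx2 hx1]
        have hτ' : τ.arrs = s.arrs := State.arrs_congr le_rfl hm
        obtain ⟨τ', r', i', m', v'⟩ := h₃ τ (B + qN.eval B + qW.eval B) (by
          intro x
          have hkw : (k * w + j) / w < n := by
            rw [Nat.div_lt_iff_lt_mul (by omega)]
            calc k * w + j < (k + 1) * w := by rw [add_mul]; omega
              _ ≤ n * w := Nat.mul_le_mul_right _ hk
          have hjw : (k * w + j) % w < w := Nat.mod_lt _ (by omega)
          have hx := hB x
          rw [hτ]
          simp only [Function.update_apply]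
          split_ifs <;> omega)
        beta_reduce at v'
        rw [hτ', hτ] at v'
        refine ⟨_, r'.seq ((Runs.instr _ _).seq (.instr _ _)), ?_, ?_, ?_, ⟨?_, ?_, ?_⟩, ?_, ?_,
          ?_, ?_, ?_, ?_, ?_⟩
        · have : 15 ≠ d + 4 := by omega
          simp [Instr.run, State.putIdx, State.put, this, i' 15 (by omega), h15]
        · simp [Instr.run, State.putIdx, State.put, i' (d + 3) (by omega), hw']
        · simp [Instr.run, State.putIdx, State.put, i' (d + 5) (by omega), h1]
        · intro x hx hx1 hx2
          have : x ≠ d + 4 := by omega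
          simp [Instr.run, State.putIdx, State.put, this, hx2, i' x (by omega), f₁ x hx hx1 hx2]
        · have : d ≠ 15 := by omega
          simp [Instr.run, State.putIdx, State.put, this, i' d (by omega), f₂]
        · have : d ≠ 14 := by omega
          simp [Instr.run, State.putIdx, State.put, this, i' (d + 1) (by omega), f₃]
        · have : 14 ≠ d + 4 := by omega
          simp [Instr.run, State.putIdx, State.put, this, i' 14 (by omega), h14]
        · have : d + 2 ≠ 15 := by omega
          simp [Instr.run, State.putIdx, State.put, this, i' (d + 2) (by omega), hn']
        · have : d + 3 ≠ 15 := by omega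
          simp [Instr.run, State.putIdx, State.put, this, i' (d + 3) (by omega), hw']
        · have : d + 5 ≠ 15 := by omega
          simp [Instr.run, State.putIdx, State.put, this, i' (d + 5) (by omega), h1]
        · intro x hx
          simp [Instr.run, State.putIdx, State.put, hx.ne, m' x (by omega), hm x hx]
        · have : d + 4 ≠ 15 := by omega
          simp [Instr.run, State.putIdx, State.put, this, i' (d + 4) (by omega),
            i' (d + 5) (by omega), h1, hp, add_assoc]
        · intro q hq
          have hg : ((Instr.copy ⟨16, d + 4⟩ ⟨17, 0⟩).run τ').mem 16 =
              Function.update (τ.mem 16) (k * w + j) (val (k * w + j)) := by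
            simp only [Instr.run, State.put, v', Function.update_self, m' 16 (by omega),
              i' (d + 4) (by omega), hp, hval]
          change ((Instr.copy ⟨16, d + 4⟩ ⟨17, 0⟩).run τ').mem 16 q = val q
          rw [hg, Function.update_apply]
          split_ifs with h
          · rw [h]
          · exact hv q (by omega))
      σ hw'
      (by
        refine ⟨⟨fun x hx hx1 hx2 => ?_, ?_, ?_⟩, ?_, ?_, ?_, ?_, ?_, ?_, ?_⟩
        · have : x ≠ d + 5 := by omega
          simp [State.putIdx, this, hx2, f₁ x hx hx1 hx2]
        · have : d ≠ 15 := by omega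
          simp [State.putIdx, this, f₂]
        · have : d ≠ 14 := by omega
          simp [State.putIdx, this, f₃]
        · have : 14 ≠ d + 5 := by omega
          simp [State.putIdx, this, h14]
        · have : d + 2 ≠ 15 := by omega
          simp [State.putIdx, this, hn']
        · have : d + 3 ≠ 15 := by omega
          simp [State.putIdx, this, hw']
        · simp [State.putIdx]
        · exact hm
        · have : d + 4 ≠ 15 := by omega
          simp [State.putIdx, this, hp]
        · exact hv)
    refine ⟨σ', r', g₁, g₂, g₄, ⟨fun x hx hx1 hx2 => ?_, ?_, ?_⟩, ?_, ?_, ?_, ?_⟩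
    · simp [State.putIdx, hx1, f₁' x hx hx1 hx2]
    · have : d ≠ 14 := by omega
      simp [State.putIdx, this, f₂']
    · have : d + 1 ≠ 14 := by omega
      simp [State.putIdx, this, f₃']
    · have : d + 3 ≠ 14 := by omega
      simp [State.putIdx, this, g₃]
    · exact g₅
    · have : d + 4 ≠ 14 := by omega
      simp [State.putIdx, this, g₆, add_mul]
    · intro q hq
      exact g₇ q (by rwa [add_mul, one_mul] at hq)
  obtain ⟨s₃, r₃, ⟨f₁, f₂, f₃⟩, -, a₃, hp₃, v₃⟩ := Runs.countLoop (r := 14) (b := d + 2)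
    (one := d + 5)
    (fun k σ => Fixed σ ∧ σ.idx (d + 3) = w ∧ (∀ x < 16, σ.mem x = s.mem x) ∧
        σ.idx (d + 4) = k * w ∧ ∀ q < k * w, σ.mem 16 q = val q) (by omega) (by omega) (by omega)
    inner ((Instr.idxConst (d + 4) 0).run s₂)
    (by simp [Instr.run, State.putIdx, i₂ (d + 2) (by omega), v₁, hn])
    (by
      refine ⟨⟨fun x hx hx1 hx2 => ?_, ?_, ?_⟩, ?_, ?_, ?_, ?_⟩
      · have h1 : x ≠ d + 4 := by omega
        have h2 : x ≠ d + 5 := by omega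
        simp [Instr.run, State.putIdx, h1, h2, hx1, i₂ x (by omega), i₁ x (by omega), i₀ x hx]
      · have : d ≠ 14 := by omega
        simp [Instr.run, State.putIdx, this, i₂ d (by omega), i₁ d (by omega), sv₀]
      · have : d + 1 ≠ 14 := by omega
        simp [Instr.run, State.putIdx, this, i₂ (d + 1) (by omega), i₁ (d + 1) (by omega), sv₀']
      · have : d + 3 ≠ 14 := by omega
        simp [Instr.run, State.putIdx, this, v₂, hw]
      · simp [Instr.run, State.putIdx, m₂, m₁, m₀]
      · have : d + 4 ≠ 14 := by omega
        simp [Instr.run, State.putIdx, this]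
      · simp)
  obtain ⟨s₄, r₄, ⟨g₁, g₂, g₃⟩, a₄, v₄, v₅⟩ := Runs.countLoop (r := d + 6) (b := d + 4)
    (one := d + 5) (c := .instr (.copy ⟨a, d + 6⟩ ⟨16, d + 6⟩)) (N := n * w) (T := 1)
    (fun k σ => Fixed σ ∧ (∀ x : ℕ, x < 16 → x ≠ a → σ.mem x = s.mem x) ∧ σ.mem 16 = s₃.mem 16 ∧
      ∀ p, σ.mem a p = if p < k then val p else s.mem a p) (by omega) (by omega) (by omega)
    (by
      rintro k hk σ ⟨⟨f₁, f₂, f₃⟩, hm, h16, ha⟩ h1 h2 h3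
      refine ⟨_, .instr _ _, h1, h2, h3, ⟨fun x hx hx1 hx2 => ?_, ?_, ?_⟩, fun x hx hxa => ?_,
        ?_, fun p => ?_⟩
      · have : x ≠ d + 6 := by omega
        simp [Instr.run, State.putIdx, State.put, this, f₁ x hx hx1 hx2]
      · simp [Instr.run, State.putIdx, State.put, f₂]
      · simp [Instr.run, State.putIdx, State.put, f₃]
      · simp [Instr.run, State.putIdx, State.put, hxa, hm x hx hxa]
      · have : 16 ≠ (a : ℕ) := by omega
        simp [Instr.run, State.putIdx, State.put, this, h16]
      · simp only [Instr.run, State.putIdx, State.put, State.get, Function.update_self, h1, h16,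
          Function.update_apply, ha, v₃ k hk]
        by_cases hpk : p = k
        · simp [hpk]
        · have : p < k + 1 ↔ p < k := by omega
          simp [hpk, this])
    s₃ hp₃
    (by
      refine ⟨⟨fun x hx hx1 hx2 => ?_, ?_, ?_⟩, fun x hx _ => a₃ x hx, rfl, fun p => ?_⟩
      · have h1 : x ≠ d + 6 := by omega
        have h2 : x ≠ d + 5 := by omega
        simp [State.putIdx, h1, h2, f₁ x hx hx1 hx2]
      · simp [State.putIdx, f₂]
      · simp [State.putIdx, f₃]
      · simp [State.putIdx, a₃ a a.2])
  refine ⟨_, (r₀.seq (r₁.seq (r₂.seq ((Runs.instr _ _).seq (r₃.seq (r₄.seq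
    (((Runs.instr _ _).seq (.instr _ _)).seq ((Runs.instr _ _).seq (.instr _ _))))))))).mono ?_,
    fun x hx => ?_, ?_⟩
  · have hb1 : w * ((p₃.eval (B + qN.eval B + qW.eval B) + (1 + 1)) + 2) + 3 + 2 ≤
        qW.eval B * (p₃.eval (B + qN.eval B + qW.eval B) + 4) + 5 := by
      have := Nat.mul_le_mul_right (p₃.eval (B + qN.eval B + qW.eval B) + 4) hwB
      linarith
    have hb2 := Nat.mul_le_mul hnB hb1
    have hb3 := Nat.mul_le_mul hnB hwB
    simp only [eval_add, eval_mul, eval_one, eval_ofNat, eval_comp, eval_X]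
    omega
  · have h14 : d ≠ 14 := by omega
    have h15 : d ≠ 15 := by omega
    by_cases hx1 : x = 14
    · subst hx1
      simp [Instr.run, State.putIdx, h14, g₂]
    by_cases hx2 : x = 15
    · subst hx2
      have h14 : d + 1 ≠ 14 := by omega
      have h15 : d + 1 ≠ 15 := by omega
      simp [Instr.run, State.putIdx, h14, h15, g₃]
    · simp [Instr.run, State.putIdx, hx1, hx2, g₁ x hx hx1 hx2]
  · funext x
    by_cases hx : x = a
    · subst hx
      funext p
      simp [Instr.run, State.putIdx, State.arrs, v₅, ← hn, ← hw, hval]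
    · have hx' : (x : ℕ) ≠ a := fun h => hx (Fin.ext h)
      simp [Instr.run, State.putIdx, State.arrs, hx, a₄ x x.2 hx']

/-- Every statement is carried out by a polynomial-time program. -/
theorem Stmt.computable (c : Stmt) : ∀ d, 16 ≤ d → StmtComputable c.run d := by
  induction c with
  | par a N W e => exact fun d hd => stmtComputable_par a N W e hd
  | seq c₁ c₂ ih₁ ih₂ =>
    exact fun d hd => stmtComputable_seq (F := c₁.run) (G := c₂.run) hd (ih₁ d hd) (ih₂ d hd)
  | loop r N c ih => exact fun d hd => stmtComputable_loop hd r N (ih (d + 3) (by omega))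

end RealRAM

/-! ### Composite gates with polynomial entries -/

namespace CompositeGate

open Complex ComplexConjugate

/-- The matrix `!![u, v; -v̄, ū]`, the general form of an element of `SU(2)`. -/
def suMatrix (u v : ℂ) : Matrix (Fin 2) (Fin 2) ℂ := !![u, v; -conj v, conj u]

theorem primitiveRotation_eq (φ θ : ℝ) : primitiveRotation φ θ =
    suMatrix (Real.cos (θ / 2)) (-(I * Real.sin (θ / 2) * exp (-(I * φ)))) := by
  -- diagonalize `σ_φ`: the columns of `U` are eigenvectors for the eigenvalues `1` and `-1`
  set e := exp (I * φ) with he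
  set e' := exp (-(I * φ)) with he'
  have hee' : e * e' = 1 := by rw [he, he', ← exp_add]; simp
  have hcos : (Real.cos φ : ℂ) = (e + e') / 2 := by
    rw [he, he', ofReal_cos, Complex.cos]; ring_nf
  have hsin : (Real.sin φ : ℂ) = (e' - e) * I / 2 := by
    rw [he, he', ofReal_sin, Complex.sin]; ring_nf
  set U : Matrix (Fin 2) (Fin 2) ℂ := !![1, 1; e, -e] with hU
  set V : Matrix (Fin 2) (Fin 2) ℂ := !![1/2, e'/2; 1/2, -e'/2] with hV
  have hUV : U * V = 1 := by
    ext i j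
    fin_cases i <;> fin_cases j <;> simp [hU, hV, Matrix.mul_apply]
    · norm_num
    · ring
    · linear_combination hee'
  have hinv : U⁻¹ = V := Matrix.inv_eq_right_inv hUV
  have hdet : IsUnit U := IsUnit.of_mul_eq_one _ hUV
  set τ : ℂ := -(I * ((θ / 2 : ℝ) : ℂ)) with hτ
  have hD : ∀ s t : ℂ, U * Matrix.diagonal ![s, t] * V =
      !![(s + t) / 2, (s - t) * e' / 2; (s - t) * e / 2, (s + t) / 2] := by
    intro s t
    have h : Matrix.diagonal ![s, t] = !![s, 0; 0, t] := by
      ext i j; fin_cases i <;> fin_cases j <;> simp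
    rw [h, hU, hV]
    ext i j
    fin_cases i <;> fin_cases j <;> simp [Matrix.mul_apply, Fin.sum_univ_two]
    · ring
    · ring
    · ring
    · linear_combination (s + t) / 2 * hee'
  have hdiag : τ • pauliPhase φ = U * Matrix.diagonal ![τ, -τ] * U⁻¹ := by
    rw [hinv, hD, pauliPhase, hcos, hsin]
    ext i j
    fin_cases i <;> fin_cases j <;> simp [pauliX, pauliY]
    · linear_combination (-τ * (e' - e) / 2) * I_sq
    · linear_combination (τ * (e' - e) / 2) * I_sq
  have hexp : NormedSpace.exp ![τ, -τ] = ![exp τ, exp (-τ)] := by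
    ext i
    rw [Pi.coe_exp, Complex.exp_eq_exp_ℂ]
    fin_cases i <;> rfl
  have hc : (Real.cos (θ / 2) : ℂ) = (exp τ + exp (-τ)) / 2 := by
    rw [hτ, ofReal_cos, Complex.cos]; ring_nf
  have hs : I * (Real.sin (θ / 2) : ℂ) = (exp (-τ) - exp τ) / 2 := by
    rw [hτ, ofReal_sin, Complex.sin]; ring_nf; simp; ring_nf
  have hce' : conj e' = e := by rw [he, he', ← exp_conj]; simp
  rw [primitiveRotation, hdiag, Matrix.exp_conj _ _ hdet, Matrix.exp_diagonal, hinv, hexp, hD]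
  simp only [suMatrix, map_neg, map_mul, conj_I, conj_ofReal, hce']
  simp only [neg_mul, neg_neg, hs, hc]
  ext i j
  fin_cases i <;> fin_cases j <;> simp
  · ring
  · ring

theorem suMatrix_one_zero : suMatrix 1 0 = 1 := by
  ext i j; fin_cases i <;> fin_cases j <;> simp [suMatrix]

theorem suMatrix_mul (u v x y : ℂ) :
    suMatrix u v * suMatrix x y = suMatrix (u * x - v * conj y) (u * y + v * conj x) := by
  ext i j
  fin_cases i <;> fin_cases j <;> simp [suMatrix, Matrix.mul_apply, Fin.sum_univ_two] <;> ring

theorem compositeGate_cons {L : ℕ} (φ₀ : ℝ) (φ : Fin L → ℝ) (θ : ℝ) :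
    compositeGate (Fin.cons φ₀ φ : Fin (L + 1) → ℝ) θ =
      compositeGate φ θ * primitiveRotation φ₀ θ := by
  simp [compositeGate, List.ofFn_succ]

/-- A pair of complex numbers of the same absolute value is annihilated by some `(1, e^{iφ})`. -/
theorem exists_phase {a b : ℂ} (h : a * conj a = b * conj b) :
    ∃ φ : ℝ, a + exp (I * φ) * b = 0 := by
  have hn : ‖a‖ = ‖b‖ := by
    rw [mul_conj, mul_conj, ofReal_inj, normSq_eq_norm_sq, normSq_eq_norm_sq] at h
    exact (sq_eq_sq₀ (norm_nonneg _) (norm_nonneg _)).1 h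
  by_cases hb : b = 0
  · exact ⟨0, by simpa [hb] using hn⟩
  · refine ⟨arg (-a / b), ?_⟩
    have h1 : ‖-a / b‖ = 1 := by simp [hn, hb]
    have := norm_mul_exp_arg_mul_I (-a / b)
    rw [h1, ofReal_one, one_mul, mul_comm] at this
    rw [this]; field_simp; ring

/-- Every element of `SU(2)` with polynomial entries of the right degree, parity and value at
`θ = 0` is a composite gate. The entries are `w⁻ᴸ a(w²)` and `w⁻ᴸ b(w²)` with `w = e^{iθ/2}`. The
first rotation is split off on the right: its phase is chosen such that the degree drops. -/
theorem exists_phases (L : ℕ) : ∀ a b : ℂ[X], a.natDegree ≤ L → b.natDegree ≤ L →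
    (∀ i ≤ L, a.coeff (L - i) = a.coeff i) → (∀ i ≤ L, b.coeff (L - i) = -b.coeff i) →
    a * a.map (starRingEnd ℂ) - b * b.map (starRingEnd ℂ) = X ^ L → a.eval 1 = 1 →
    ∃ φ : Fin L → ℝ, ∀ θ : ℝ, compositeGate φ θ =
      suMatrix ((exp (I * (θ / 2)))⁻¹ ^ L * a.eval (exp (I * (θ / 2)) ^ 2))
        ((exp (I * (θ / 2)))⁻¹ ^ L * b.eval (exp (I * (θ / 2)) ^ 2)) := by
  induction L with
  | zero =>
    intro a b ha hb hsa hsb hab h1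
    rw [eq_C_of_natDegree_le_zero ha] at h1 ⊢
    rw [eq_C_of_natDegree_le_zero hb]
    have hb0 : b.coeff 0 = 0 := by
      have := hsb 0 le_rfl
      simpa [self_eq_neg] using this
    refine ⟨Fin.elim0, fun θ => ?_⟩
    simp only [eval_C] at h1
    simp [h1, hb0, suMatrix_one_zero, compositeGate]
  | succ L ih =>
    intro a b ha hb hsa hsb hab h1
    have htop : a.coeff (L + 1) * conj (a.coeff (L + 1)) =
        b.coeff (L + 1) * conj (b.coeff (L + 1)) := by
      have h := congrArg (fun p => p.coeff ((L + 1) + (L + 1))) hab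
      simp only [coeff_sub, coeff_X_pow] at h
      rw [coeff_mul_add_eq_of_natDegree_le ha (natDegree_map_le.trans ha),
        coeff_mul_add_eq_of_natDegree_le hb (natDegree_map_le.trans hb), if_neg (by omega)] at h
      simpa [sub_eq_zero] using h
    obtain ⟨φ₀, hφ₀⟩ := exists_phase htop
    set e := exp (I * φ₀) with he
    set e' := exp (-(I * φ₀)) with he'
    have hee' : e * e' = 1 := by rw [he, he', ← exp_add]; simp
    have hce : conj e = e' := by
      rw [he, he', ← exp_conj]; simp
    have hce' : conj e' = e := by rw [← hce, conj_conj]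
    set p : ℂ[X] := C (1 / 2) * ((X + 1) * a + C e * ((X - 1) * b)) with hp
    set q : ℂ[X] := C (1 / 2) * (C e' * ((X - 1) * a) + (X + 1) * b) with hq
    have hpc : ∀ n, p.coeff (n + 1) =
        1 / 2 * (a.coeff n + a.coeff (n + 1) + e * (b.coeff n - b.coeff (n + 1))) := by
      intro n; simp [hp, add_mul, sub_mul, coeff_X_mul]
    have hqc : ∀ n, q.coeff (n + 1) =
        1 / 2 * (e' * (a.coeff n - a.coeff (n + 1)) + (b.coeff n + b.coeff (n + 1))) := by
      intro n; simp [hq, add_mul, sub_mul, coeff_X_mul]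
    have ha0 : a.coeff 0 = a.coeff (L + 1) := by simpa using hsa (L + 1) le_rfl
    have hb0 : b.coeff 0 = -b.coeff (L + 1) := by simpa using hsb (L + 1) le_rfl
    have hp0 : p.coeff 0 = 0 := by
      simp only [hp, mul_coeff_zero, coeff_C_zero, coeff_add, coeff_sub, coeff_X_zero,
        coeff_one_zero, ha0, hb0]
      linear_combination (1 / 2) * hφ₀
    have hφ' : e' * a.coeff (L + 1) + b.coeff (L + 1) = 0 := by
      linear_combination e' * hφ₀ - b.coeff (L + 1) * hee'
    have hq0 : q.coeff 0 = 0 := by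
      simp only [hq, mul_coeff_zero, coeff_C_zero, coeff_add, coeff_sub, coeff_X_zero,
        coeff_one_zero, ha0, hb0]
      linear_combination -(1 / 2) * hφ'
    have hpX : X * p.divX = p := by
      conv_rhs => rw [← X_mul_divX_add p, hp0]
      simp
    have hqX : X * q.divX = q := by
      conv_rhs => rw [← X_mul_divX_add q, hq0]
      simp
    have haz : ∀ n, L + 1 < n → a.coeff n = 0 := fun n hn =>
      coeff_eq_zero_of_natDegree_lt (by omega)
    have hbz : ∀ n, L + 1 < n → b.coeff n = 0 := fun n hn =>
      coeff_eq_zero_of_natDegree_lt (by omega)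
    obtain ⟨φ, hφ⟩ := ih p.divX q.divX
      (by
        refine natDegree_le_iff_coeff_eq_zero.2 fun n hn => ?_
        rw [coeff_divX, hpc, haz (n + 1) (by omega), hbz (n + 1) (by omega)]
        rcases Nat.eq_or_lt_of_le (Nat.succ_le_of_lt hn) with h | h
        · rw [← h]; simpa using hφ₀
        · simp [haz n h, hbz n h])
      (by
        refine natDegree_le_iff_coeff_eq_zero.2 fun n hn => ?_
        rw [coeff_divX, hqc, haz (n + 1) (by omega), hbz (n + 1) (by omega)]
        rcases Nat.eq_or_lt_of_le (Nat.succ_le_of_lt hn) with h | h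
        · rw [← h]; simpa using hφ'
        · simp [haz n h, hbz n h])
      (by
        intro i hi
        have h1 := hsa i (by omega)
        have h2 := hsa (i + 1) (by omega)
        have h3 := hsb i (by omega)
        have h4 := hsb (i + 1) (by omega)
        rw [show L + 1 - i = L - i + 1 by omega] at h1 h3
        rw [show L + 1 - (i + 1) = L - i by omega] at h2 h4
        rw [coeff_divX, coeff_divX, hpc, hpc, h1, h2, h3, h4]; ring)
      (by
        intro i hi
        have h1 := hsa i (by omega)
        have h2 := hsa (i + 1) (by omega)
        have h3 := hsb i (by omega)
        have h4 := hsb (i + 1) (by omega)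
        rw [show L + 1 - i = L - i + 1 by omega] at h1 h3
        rw [show L + 1 - (i + 1) = L - i by omega] at h2 h4
        rw [coeff_divX, coeff_divX, hqc, hqc, h1, h2, h3, h4]; ring)
      (by
        have hX : (X : ℂ[X]) ^ 2 ≠ 0 := pow_ne_zero _ X_ne_zero
        refine mul_left_cancel₀ hX ?_
        have h1 : X * (p.divX).map (starRingEnd ℂ) = C (1 / 2) *
            ((X + 1) * a.map (starRingEnd ℂ) + C e' * ((X - 1) * b.map (starRingEnd ℂ))) := by
          have := congrArg (Polynomial.map (starRingEnd ℂ)) hpX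
          rw [Polynomial.map_mul, map_X] at this
          rw [this, hp]
          simp [hce]
          exact Or.inl (map_ofNat _ 2)
        have h2 : X * (q.divX).map (starRingEnd ℂ) = C (1 / 2) *
            (C e * ((X - 1) * a.map (starRingEnd ℂ)) + (X + 1) * b.map (starRingEnd ℂ)) := by
          have := congrArg (Polynomial.map (starRingEnd ℂ)) hqX
          rw [Polynomial.map_mul, map_X] at this
          rw [this, hq]
          simp [hce']
          exact Or.inl (map_ofNat _ 2)
        have h3 : (C e : ℂ[X]) * C e' = 1 := by rw [← C_mul, hee', C_1]
        have h4 : (C (1 / 2) : ℂ[X]) * C (1 / 2) * 4 = 1 := by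
          rw [← C_mul, show (4 : ℂ[X]) = C 4 from rfl, ← C_mul]; norm_num
        calc X ^ 2 * (p.divX * p.divX.map (starRingEnd ℂ) - q.divX * q.divX.map (starRingEnd ℂ))
            = (X * p.divX) * (X * p.divX.map (starRingEnd ℂ)) -
              (X * q.divX) * (X * q.divX.map (starRingEnd ℂ)) := by ring
          _ = C (1 / 2) * C (1 / 2) * 4 * (X * (a * a.map (starRingEnd ℂ) -
              b * b.map (starRingEnd ℂ))) := by
            rw [hpX, hqX, h1, h2, hp, hq]
            linear_combination (C (1 / 2) * C (1 / 2) * (X - 1) ^ 2 * (b * b.map (starRingEnd ℂ) -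
              a * a.map (starRingEnd ℂ))) * h3
          _ = X ^ 2 * X ^ L := by rw [h4, hab]; ring)
      (by
        have := congrArg (eval 1) hpX
        rw [eval_mul, eval_X, one_mul] at this
        rw [this, hp]
        simp [h1]; norm_num)
    refine ⟨Fin.cons φ₀ φ, fun θ => ?_⟩
    rw [compositeGate_cons, hφ, primitiveRotation_eq, suMatrix_mul]
    set w := exp (I * (θ / 2)) with hw
    have hw0 : w ≠ 0 := exp_ne_zero _
    have hcos : (Real.cos (θ / 2) : ℂ) = (w + w⁻¹) / 2 := by
      rw [hw, ← exp_neg, ofReal_cos, Complex.cos]; push_cast; ring_nf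
    have hsin : I * (Real.sin (θ / 2) : ℂ) = (w - w⁻¹) / 2 := by
      rw [hw, ← exp_neg, ofReal_sin, Complex.sin]; push_cast; ring_nf; simp; ring_nf
    have hcs : conj (I * (Real.sin (θ / 2) : ℂ)) = -(I * (Real.sin (θ / 2) : ℂ)) := by
      rw [map_mul, conj_I, conj_ofReal]; ring
    have hpe : w ^ 2 * p.divX.eval (w ^ 2) = 1 / 2 * ((w ^ 2 + 1) * a.eval (w ^ 2) +
        e * ((w ^ 2 - 1) * b.eval (w ^ 2))) := by
      have := congrArg (eval (w ^ 2)) hpX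
      rw [eval_mul, eval_X] at this
      rw [this, hp]; simp
    have hqe : w ^ 2 * q.divX.eval (w ^ 2) = 1 / 2 * (e' * ((w ^ 2 - 1) * a.eval (w ^ 2)) +
        (w ^ 2 + 1) * b.eval (w ^ 2)) := by
      have := congrArg (eval (w ^ 2)) hqX
      rw [eval_mul, eval_X] at this
      rw [this, hq]; simp
    have hww : w⁻¹ * w = 1 := inv_mul_cancel₀ hw0
    have hpe' : p.divX.eval (w ^ 2) = w⁻¹ / 2 * ((w + w⁻¹) * a.eval (w ^ 2) +
        e * ((w - w⁻¹) * b.eval (w ^ 2))) := by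
      refine mul_left_cancel₀ (pow_ne_zero 2 hw0) (hpe.trans ?_)
      field_simp
    have hqe' : q.divX.eval (w ^ 2) = w⁻¹ / 2 * (e' * ((w - w⁻¹) * a.eval (w ^ 2)) +
        (w + w⁻¹) * b.eval (w ^ 2)) := by
      refine mul_left_cancel₀ (pow_ne_zero 2 hw0) (hqe.trans ?_)
      field_simp
    congr 1
    · rw [map_neg, map_mul, hcs, ← he', hce', hsin, hcos, hpe', hqe', pow_succ w⁻¹ L]
      generalize w⁻¹ ^ L = k
      linear_combination -(k * w⁻¹ * (w - w⁻¹) ^ 2 / 4 * a.eval (w ^ 2)) * hee' +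
        (k * w⁻¹ * a.eval (w ^ 2)) * hww
    · rw [conj_ofReal, ← he', hsin, hcos, hpe', hqe', pow_succ w⁻¹ L]
      generalize w⁻¹ ^ L = k
      linear_combination -(k * w⁻¹ * (w - w⁻¹) ^ 2 / 4 * b.eval (w ^ 2)) * hee' +
        (k * w⁻¹ * b.eval (w ^ 2)) * hww

end CompositeGate

/-! ### The Fejér–Riesz factorization -/

namespace SpectralFactor

open Complex ComplexConjugate

theorem infinite_unit_circle : {z : ℂ | ‖z‖ = 1}.Infinite := by
  have h : IsPreconnected (Metric.sphere (0 : ℂ) 1) := isPreconnected_sphere (by simp) 0 1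
  have := h.infinite_of_nontrivial ⟨1, by simp, -1, by simp, by norm_num⟩
  simpa [Metric.sphere, dist_zero_right] using this

theorem eq_of_eval_circle {p q : ℂ[X]} (h : ∀ z : ℂ, ‖z‖ = 1 → p.eval z = q.eval z) : p = q :=
  eq_of_infinite_eval_eq p q (infinite_unit_circle.mono h)

theorem eval_reflect {N : ℕ} {p : ℂ[X]} (hp : p.natDegree ≤ N) {z : ℂ} (hz : z ≠ 0) :
    (reflect N p).eval z = z ^ N * p.eval z⁻¹ := by
  let _ : Invertible z⁻¹ := invertibleOfNonzero (inv_ne_zero hz)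
  have h := eval₂_reflect_mul_pow (RingHom.id ℂ) z⁻¹ N p hp
  simp only [invOf_eq_inv, inv_inv, inv_pow] at h
  change (reflect N p).eval z * (z ^ N)⁻¹ = p.eval z⁻¹ at h
  rw [← h]
  field_simp

theorem conj_eq_inv_of_norm_eq_one {z : ℂ} (hz : ‖z‖ = 1) : conj z = z⁻¹ := by
  rw [Complex.inv_def, normSq_eq_norm_sq, hz]; simp

theorem eval_map_conj (p : ℂ[X]) (z : ℂ) :
    (p.map (starRingEnd ℂ)).eval z = conj (p.eval (conj z)) := by
  conv_lhs => rw [← conj_conj z]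
  rw [eval_map, eval₂_at_apply]

/-- `z⁻ᴸ G(z)` is real and nonnegative on the unit circle. -/
def CircleNonneg (L : ℕ) (G : ℂ[X]) : Prop :=
  ∀ z : ℂ, ‖z‖ = 1 → 0 ≤ (G.eval z * conj z ^ L).re ∧ (G.eval z * conj z ^ L).im = 0

/-- A polynomial that is real on the circle after division by `z ^ L` has conjugate-symmetric
coefficients, so its zeros come in pairs `β`, `1 / β̄`. -/
theorem CircleNonneg.reflect_eq {L : ℕ} {G : ℂ[X]} (hd : G.natDegree ≤ 2 * L)
    (h : CircleNonneg L G) : reflect (2 * L) (G.map (starRingEnd ℂ)) = G := by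
  refine eq_of_eval_circle fun z hz => ?_
  have hz0 : z ≠ 0 := by rintro rfl; simp at hz
  rw [eval_reflect (natDegree_map_le.trans hd) hz0, eval_map_conj, ← conj_eq_inv_of_norm_eq_one hz,
    conj_conj]
  have h1 := conj_eq_iff_im.2 (h z hz).2
  rw [map_mul, map_pow, conj_conj, conj_eq_inv_of_norm_eq_one hz] at h1
  rw [two_mul, pow_add, mul_assoc, mul_comm (z ^ L) (conj _), h1, inv_pow]
  field_simp

/-- A zero of `G` on the unit circle, where `z⁻ᴸ G(z)` has a minimum, is a double zero. -/
theorem CircleNonneg.double_root {L : ℕ} {G G₁ : ℂ[X]} (h : CircleNonneg L G) {β : ℂ}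
    (hβ : ‖β‖ = 1) (hG : G = (X - C β) * G₁) : G₁.eval β = 0 := by
  have hβ0 : β ≠ 0 := by rintro rfl; simp at hβ
  set z : ℝ → ℂ := fun s => β * exp (s * I) with hz
  have hz1 : ∀ s, ‖z s‖ = 1 := fun s => by simp [hz, hβ, norm_exp_ofReal_mul_I]
  have hzd : HasDerivAt z (β * I) 0 := by
    have h1 : HasDerivAt (fun s : ℝ => (s : ℂ) * I) I 0 := by
      simpa using (hasDerivAt_id (0 : ℝ)).ofReal_comp.mul_const I
    simpa using (h1.cexp).const_mul β
  have hz0 : z 0 = β := by simp [hz]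
  have hk : DifferentiableAt ℝ (fun s => G₁.eval (z s) * conj (z s) ^ L) 0 := by
    have h1 : DifferentiableAt ℝ (fun s => G₁.eval (z s)) 0 := by
      have h2 : DifferentiableAt ℝ (fun w : ℂ => G₁.eval w) (z 0) :=
        (G₁.differentiable.differentiableAt).restrictScalars ℝ
      exact h2.comp 0 hzd.differentiableAt
    exact h1.mul (((conjCLE : ℂ →L[ℝ] ℂ).differentiableAt.comp 0 hzd.differentiableAt).pow L)
  have hg : HasDerivAt (fun s => (z s - β) * (G₁.eval (z s) * conj (z s) ^ L))
      (β * I * (G₁.eval β * conj β ^ L)) 0 := by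
    exact ((hzd.sub_const β).mul hk.hasDerivAt).congr_deriv (by simp [hz0])
  have hgG : ∀ s, (z s - β) * (G₁.eval (z s) * conj (z s) ^ L) =
      G.eval (z s) * conj (z s) ^ L := by
    intro s; rw [hG]; simp [mul_assoc]
  have hre : HasDerivAt (fun s => (G.eval (z s) * conj (z s) ^ L).re)
      (β * I * (G₁.eval β * conj β ^ L)).re 0 := by
    have := (reCLM.hasFDerivAt (x := _)).comp_hasDerivAt 0 hg
    simpa [Function.comp_def, hgG] using this
  have him : HasDerivAt (fun s => (G.eval (z s) * conj (z s) ^ L).im)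
      (β * I * (G₁.eval β * conj β ^ L)).im 0 := by
    have := (imCLM.hasFDerivAt (x := _)).comp_hasDerivAt 0 hg
    simpa [Function.comp_def, hgG] using this
  have h0 : G.eval (z 0) * conj (z 0) ^ L = 0 := by rw [← hgG, hz0]; simp
  have hmin : IsLocalMin (fun s => (G.eval (z s) * conj (z s) ^ L).re) 0 :=
    Filter.Eventually.of_forall fun s => by
      simp only [h0, zero_re]; exact (h _ (hz1 s)).1
  have hre0 := hmin.hasDerivAt_eq_zero hre
  have him0 : (β * I * (G₁.eval β * conj β ^ L)).im = 0 := by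
    refine him.unique ?_
    simp only [fun s => (h _ (hz1 s)).2]
    exact hasDerivAt_const _ _
  have : β * I * (G₁.eval β * conj β ^ L) = 0 := Complex.ext hre0 him0
  have hc : conj β ≠ 0 := by simpa using hβ0
  simpa [hβ0, hc] using this

/-- Nonnegativity on the circle passes to a cofactor of `|1 - bz|²`, by continuity at the possible
zero of this factor. -/
theorem CircleNonneg.of_mul {L : ℕ} {G : ℂ[X]} {b : ℂ}
    (h : ∀ z : ℂ, ‖z‖ = 1 → 0 ≤ ((‖1 - b * z‖ ^ 2 : ℝ) * (G.eval z * conj z ^ L)).re ∧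
      ((‖1 - b * z‖ ^ 2 : ℝ) * (G.eval z * conj z ^ L)).im = 0) : CircleNonneg L G := by
  have main : ∀ z : ℂ, ‖z‖ = 1 → 1 - b * z ≠ 0 →
      0 ≤ (G.eval z * conj z ^ L).re ∧ (G.eval z * conj z ^ L).im = 0 := by
    intro z hz hb
    have hpos : 0 < ‖1 - b * z‖ ^ 2 := by positivity
    obtain ⟨h1, h2⟩ := h z hz
    rw [re_ofReal_mul] at h1
    rw [im_ofReal_mul] at h2
    exact ⟨nonneg_of_mul_nonneg_right h1 hpos, by simpa [hpos.ne'] using h2⟩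
  intro z hz
  by_cases hb : 1 - b * z = 0
  · set w : ℝ → ℂ := fun s => z * exp (s * I) with hw
    have hw1 : ∀ s, ‖w s‖ = 1 := fun s => by simp [hw, hz, norm_exp_ofReal_mul_I]
    have hne : ∀ᶠ s in nhdsWithin (0 : ℝ) {0}ᶜ, 1 - b * w s ≠ 0 := by
      have hd : HasDerivAt (fun s : ℝ => exp (s * I)) I 0 := by
        have h1 : HasDerivAt (fun s : ℝ => (s : ℂ) * I) I 0 := by
          simpa using (hasDerivAt_id (0 : ℝ)).ofReal_comp.mul_const I
        simpa using h1.cexp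
      filter_upwards [hd.eventually_ne I_ne_zero (c := 1)] with s hs h0
      apply hs
      have hbz : b * z = 1 := (sub_eq_zero.1 hb).symm
      have : b * w s = 1 := (sub_eq_zero.1 h0).symm
      rw [hw] at this
      simp only at this
      rw [← mul_assoc, hbz, one_mul] at this
      exact this
    have hcont : Continuous fun s : ℝ => G.eval (w s) * conj (w s) ^ L := by
      have : Continuous w := by fun_prop
      exact (G.continuous.comp this).mul ((continuous_conj.comp this).pow L)
    have ht : Filter.Tendsto (fun s : ℝ => G.eval (w s) * conj (w s) ^ L)
        (nhdsWithin 0 {0}ᶜ) (nhds (G.eval z * conj z ^ L)) := by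
      have := (hcont.tendsto 0).mono_left (nhdsWithin_le_nhds (s := {0}ᶜ))
      simpa [hw] using this
    constructor
    · exact ge_of_tendsto ((continuous_re.tendsto _).comp ht)
        (hne.mono fun s hs => (main _ (hw1 s) hs).1)
    · refine tendsto_nhds_unique ((continuous_im.tendsto _).comp ht) ?_
      refine (tendsto_const_nhds (x := (0 : ℝ))).congr' ?_
      exact hne.mono fun s hs => (main _ (hw1 s) hs).2.symm
  · exact main z hz hb

/-- The polynomial `∏ (1 - b z)`, over a list of numbers `b`. It has no zero in the open unit disc
if all of them have absolute value at most `1`. -/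
noncomputable def outerPoly (bs : List ℂ) : ℂ[X] := (bs.map fun b => 1 - C b * X).prod

/-- **Fejér–Riesz**: a trigonometric polynomial that is nonnegative on the unit circle is the square
of the absolute value of a polynomial without zeros in the open unit disc. -/
theorem fejer_riesz (L : ℕ) : ∀ G : ℂ[X], G.natDegree ≤ 2 * L → CircleNonneg L G →
    ∃ (c : ℝ) (bs : List ℂ), 0 ≤ c ∧ bs.length = L ∧ (∀ b ∈ bs, ‖b‖ ≤ 1) ∧
      ∀ z : ℂ, ‖z‖ = 1 → G.eval z * conj z ^ L = (c * ‖(outerPoly bs).eval z‖ ^ 2 : ℝ) := by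
  induction L with
  | zero =>
    intro G hd h
    rw [eq_C_of_natDegree_le_zero hd] at h ⊢
    obtain ⟨h1, h2⟩ := h 1 (by simp)
    simp only [eval_C, pow_zero, mul_one] at h1 h2
    refine ⟨(G.coeff 0).re, [], h1, rfl, by simp, fun z _ => ?_⟩
    apply Complex.ext <;> simp [outerPoly, h2]
  | succ L ih =>
    intro G hd h
    by_cases h0 : G.coeff 0 = 0
    · -- the leading coefficient vanishes as well, and the factor is `1 - 0 z`
      have hG : X * G.divX = G := by
        conv_rhs => rw [← X_mul_divX_add G, h0]
        simp
      have htop : G.coeff (2 * (L + 1)) = 0 := by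
        rw [← h.reflect_eq hd, coeff_reflect, revAt_le le_rfl]
        simp [h0]
      have hcirc : ∀ z : ℂ, ‖z‖ = 1 →
          G.eval z * conj z ^ (L + 1) = G.divX.eval z * conj z ^ L := by
        intro z hz
        have hzz : z * conj z = 1 := by rw [mul_conj, normSq_eq_norm_sq, hz]; simp
        conv_lhs => rw [← hG]
        rw [eval_mul, eval_X]
        linear_combination (G.divX.eval z * conj z ^ L) * hzz
      obtain ⟨c, bs, hc, hbs, hb, hP⟩ := ih G.divX
        (by
          refine natDegree_le_iff_coeff_eq_zero.2 fun n hn => ?_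
          rw [coeff_divX]
          rcases Nat.eq_or_lt_of_le (Nat.succ_le_of_lt hn) with h1 | h1
          · exact coeff_eq_zero_of_natDegree_lt (by
              refine lt_of_le_of_ne (hd.trans (by omega)) fun he => ?_
              have : G ≠ 0 := by
                rintro rfl; simp at he
              apply leadingCoeff_ne_zero.2 this
              rw [leadingCoeff, he, ← htop]; congr 1; omega)
          · exact coeff_eq_zero_of_natDegree_lt (by omega))
        (fun z hz => by rw [← hcirc z hz]; exact h z hz)
      refine ⟨c, 0 :: bs, hc, by simp [hbs], by simpa using hb, fun z hz => ?_⟩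
      rw [hcirc z hz, hP z hz]
      simp [outerPoly]
    · have hG0 : G ≠ 0 := by rintro rfl; simp at h0
      have htop : G.coeff (2 * (L + 1)) ≠ 0 := by
        rw [← h.reflect_eq hd, coeff_reflect, revAt_le le_rfl]
        simpa using h0
      have hdeg : G.natDegree = 2 * (L + 1) := le_antisymm hd (le_natDegree_of_ne_zero htop)
      have hrec : ∀ z : ℂ, z ≠ 0 → G.eval z = 0 → G.eval (conj z)⁻¹ = 0 := by
        intro z hz hGz
        rw [← h.reflect_eq hd, eval_reflect (natDegree_map_le.trans hd) (by simpa using hz),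
          inv_inv, eval_map_conj, conj_conj, hGz]
        simp
      obtain ⟨β, hβ0, hβ1, hGβ⟩ : ∃ β : ℂ, β ≠ 0 ∧ 1 ≤ ‖β‖ ∧ G.eval β = 0 := by
        obtain ⟨z, hz⟩ := IsAlgClosed.exists_root G (by
          rw [degree_eq_natDegree hG0, hdeg]; exact Nat.cast_ne_zero.2 (by omega))
        have hz0 : z ≠ 0 := by
          rintro rfl; exact h0 (by rw [coeff_zero_eq_eval_zero]; exact hz)
        rcases le_total 1 ‖z‖ with h1 | h1
        · exact ⟨z, hz0, h1, hz⟩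
        · refine ⟨(conj z)⁻¹, by simpa using hz0, ?_, hrec z hz0 hz⟩
          rw [norm_inv, RCLike.norm_conj]
          exact (one_le_inv₀ (norm_pos_iff.2 hz0)).2 h1
      set γ := (conj β)⁻¹ with hγ
      have hγβ : γ * conj β = 1 := inv_mul_cancel₀ (by simpa using hβ0)
      obtain ⟨G₁, hG₁⟩ := dvd_iff_isRoot.2 hGβ
      have hG₁γ : G₁.eval γ = 0 := by
        by_cases hne : γ = β
        · have hn : ‖β‖ = 1 := by
            have := congrArg norm hγβ
            rw [hne, norm_mul, RCLike.norm_conj, norm_one] at this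
            nlinarith [norm_nonneg β]
          rw [hne]
          exact h.double_root hn hG₁
        · have := hrec β hβ0 hGβ
          rw [← hγ, hG₁, eval_mul, eval_sub, eval_X, eval_C] at this
          exact (mul_eq_zero.1 this).resolve_left (sub_ne_zero.2 hne)
      obtain ⟨G₂, hG₂⟩ := dvd_iff_isRoot.2 hG₁γ
      have hG₂0 : G₂ ≠ 0 := by
        rintro rfl; apply hG0; rw [hG₁, hG₂]; simp
      have hcirc : ∀ z : ℂ, ‖z‖ = 1 → G.eval z * conj z ^ (L + 1) =
          (‖1 - β⁻¹ * z‖ ^ 2 : ℝ) * ((C (-β) * G₂).eval z * conj z ^ L) := by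
        intro z hz
        have hzz : z * conj z = 1 := by rw [mul_conj, normSq_eq_norm_sq, hz]; simp
        have hb : β * β⁻¹ = 1 := mul_inv_cancel₀ hβ0
        have hn : ((‖1 - β⁻¹ * z‖ ^ 2 : ℝ) : ℂ) = (1 - β⁻¹ * z) * (1 - γ * conj z) := by
          rw [← normSq_eq_norm_sq, ← mul_conj]; simp [hγ]
        rw [hn, hG₁, hG₂]
        simp only [eval_mul, eval_sub, eval_X, eval_C]
        linear_combination ((z - β) * G₂.eval z * conj z ^ L) * hzz +
          (-z * (1 - γ * conj z) * G₂.eval z * conj z ^ L) * hb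
      obtain ⟨c, bs, hc, hbs, hb, hP⟩ := ih (C (-β) * G₂)
        (by
          rw [natDegree_C_mul (neg_ne_zero.2 hβ0)]
          have h1 : G.natDegree = 1 + (1 + G₂.natDegree) := by
            rw [hG₁, hG₂, natDegree_mul (X_sub_C_ne_zero _) (mul_ne_zero (X_sub_C_ne_zero _) hG₂0),
              natDegree_mul (X_sub_C_ne_zero _) hG₂0, natDegree_X_sub_C, natDegree_X_sub_C]
          omega)
        (CircleNonneg.of_mul fun z hz => by rw [← hcirc z hz]; exact h z hz)
      refine ⟨c, β⁻¹ :: bs, hc, by simp [hbs], ?_, fun z hz => ?_⟩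
      · intro b hb'
        rcases List.mem_cons.1 hb' with rfl | hb'
        · rw [norm_inv]; exact inv_le_one_of_one_le₀ hβ1
        · exact hb b hb'
      · rw [hcirc z hz, hP z hz, ← ofReal_mul]
        simp only [outerPoly, List.map_cons, List.prod_cons, eval_mul, norm_mul, eval_sub, eval_one,
          eval_C, eval_X]
        congr 1; ring

end SpectralFactor

/-! ### Minimum energy of a chain of blocks, by doubling -/

namespace SpectralFactor

open Finset

/-- The quadratic form `∑ S i j x i x j` over the indices below `n`. -/
def quad (n : ℕ) (S : ℕ → ℕ → ℝ) (x : ℕ → ℝ) : ℝ :=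
  ∑ i ∈ range n, ∑ j ∈ range n, S i j * x i * x j

theorem quad_congr {n : ℕ} {S S' : ℕ → ℕ → ℝ} {x x' : ℕ → ℝ}
    (h : ∀ i < n, ∀ j < n, S i j * x i * x j = S' i j * x' i * x' j) :
    quad n S x = quad n S' x' :=
  sum_congr rfl fun i hi => sum_congr rfl fun j hj => h i (mem_range.1 hi) j (mem_range.1 hj)

theorem sum_range_ite_lt {a N : ℕ} (h : a ≤ N) (F : ℕ → ℝ) :
    ∑ i ∈ range N, (if i < a then F i else 0) = ∑ i ∈ range a, F i := by
  obtain ⟨c, rfl⟩ := Nat.exists_eq_add_of_le h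
  rw [sum_range_add, sum_congr rfl fun i hi => if_pos (mem_range.1 hi)]
  simp

theorem sum_range_ite_ge (b c : ℕ) (F : ℕ → ℝ) :
    ∑ i ∈ range (b + c), (if b ≤ i then F i else 0) = ∑ i ∈ range c, F (b + i) := by
  rw [sum_range_add, sum_congr rfl fun i hi => if_neg (not_le.2 (mem_range.1 hi))]
  simp

theorem quad_ite_lt {a N : ℕ} (h : a ≤ N) (S : ℕ → ℕ → ℝ) (y : ℕ → ℝ) :
    quad N (fun i j => if i < a ∧ j < a then S i j else 0) y = quad a S y := by
  have key : ∀ i j, (if i < a ∧ j < a then S i j else 0) * y i * y j =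
      if i < a then (if j < a then S i j * y i * y j else 0) else 0 := by
    intro i j; by_cases h1 : i < a <;> by_cases h2 : j < a <;> simp [h1, h2]
  have key' : ∀ i, ∑ j ∈ range N, (if i < a ∧ j < a then S i j else 0) * y i * y j =
      if i < a then ∑ j ∈ range a, S i j * y i * y j else 0 := by
    intro i
    simp only [key]
    split_ifs
    · exact sum_range_ite_lt h _
    · simp
  rw [quad, sum_congr rfl fun i _ => key' i, sum_range_ite_lt h]
  rfl

theorem quad_ite_ge (b c : ℕ) (S : ℕ → ℕ → ℝ) (y : ℕ → ℝ) :
    quad (b + c) (fun i j => if b ≤ i ∧ b ≤ j then S (i - b) (j - b) else 0) y =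
      quad c S fun i => y (b + i) := by
  have key : ∀ i j, (if b ≤ i ∧ b ≤ j then S (i - b) (j - b) else 0) * y i * y j =
      if b ≤ i then (if b ≤ j then S (i - b) (j - b) * y i * y j else 0) else 0 := by
    intro i j; by_cases h1 : b ≤ i <;> by_cases h2 : b ≤ j <;> simp [h1, h2]
  have key' : ∀ i, ∑ j ∈ range (b + c),
      (if b ≤ i ∧ b ≤ j then S (i - b) (j - b) else 0) * y i * y j =
      if b ≤ i then ∑ j ∈ range c, S (i - b) j * y i * y (b + j) else 0 := by
    intro i
    simp only [key]
    split_ifs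
    · rw [sum_range_ite_ge b c fun j => S (i - b) (j - b) * y i * y j]
      simp
    · simp
  rw [quad, sum_congr rfl fun i _ => key' i,
    sum_range_ite_ge b c fun i => ∑ j ∈ range c, S (i - b) j * y i * y (b + j)]
  simp [quad]

theorem quad_add (n : ℕ) (S S' : ℕ → ℕ → ℝ) (y : ℕ → ℝ) :
    quad n (fun i j => S i j + S' i j) y = quad n S y + quad n S' y := by
  simp [quad, add_mul, sum_add_distrib]

/-- Elimination of the variable `k` from a quadratic form by minimization. -/
noncomputable def pivot (W : ℕ → ℕ → ℝ) (k : ℕ) : ℕ → ℕ → ℝ :=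
  fun i j => W i j - W i k * W k j / W k k

/-- Completion of the square. -/
theorem quad_pivot {n : ℕ} {W : ℕ → ℕ → ℝ} (hs : ∀ i j, W i j = W j i) (k : ℕ) (y : ℕ → ℝ) :
    quad n (pivot W k) y = quad n W y - (∑ j ∈ range n, W k j * y j) ^ 2 / W k k := by
  have h : (∑ j ∈ range n, W k j * y j) ^ 2 / W k k =
      ∑ i ∈ range n, ∑ j ∈ range n, W i k * W k j / W k k * y i * y j := by
    rw [sq, sum_mul_sum, sum_div]
    refine sum_congr rfl fun i _ => ?_
    rw [sum_div]
    refine sum_congr rfl fun j _ => ?_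
    rw [hs i k]; ring
  rw [h]
  simp only [quad, pivot, sub_mul, sum_sub_distrib]

/-- Elimination of the variables `M`, …, `M + k - 1`. -/
noncomputable def pivots (M : ℕ) (W : ℕ → ℕ → ℝ) : ℕ → ℕ → ℕ → ℝ
  | 0 => W
  | k + 1 => pivot (pivots M W k) (M + k)

theorem quad_single {n p : ℕ} (hp : p < n) (S : ℕ → ℕ → ℝ) :
    quad n S (Pi.single p 1) = S p p := by
  rw [quad, sum_eq_single p, sum_eq_single p]
  · simp
  · intro j _ hj; simp [hj]
  · intro h; exact absurd (mem_range.2 hp) h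
  · intro i _ hi; simp [hi]
  · intro h; exact absurd (mem_range.2 hp) h

/-- Elimination of a block on which the form is positive definite computes the minimum of the form
over the variables of this block. -/
theorem pivots_spec {M N : ℕ} (hN : 2 * M ≤ N) {W : ℕ → ℕ → ℝ} (hs : ∀ i j, W i j = W j i)
    (hpos : ∀ y : ℕ → ℝ, (∀ i, i < M ∨ 2 * M ≤ i → y i = 0) → (∃ i, y i ≠ 0) → 0 < quad N W y) :
    ∀ k ≤ M, (∀ i j, pivots M W k i j = pivots M W k j i) ∧
      (∀ i j, M ≤ i → i < M + k → pivots M W k i j = 0) ∧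
      (∀ y, quad N (pivots M W k) y ≤ quad N W y) ∧
      ∀ y, ∃ y', (∀ i, i < M ∨ M + k ≤ i → y' i = y i) ∧
        quad N W y' = quad N (pivots M W k) y := by
  intro k
  induction k with
  | zero =>
    exact fun _ => ⟨hs, fun i j h1 h2 => by omega, fun y => le_rfl,
      fun y => ⟨y, fun _ _ => rfl, rfl⟩⟩
  | succ k ih =>
    intro hk
    obtain ⟨is, iz, il, ia⟩ := ih (by omega)
    set E := pivots M W k with hE
    have hEs : pivots M W (k + 1) = pivot E (M + k) := rfl
    have hd : 0 < E (M + k) (M + k) := by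
      obtain ⟨y', h1, h2⟩ := ia (Pi.single (M + k) 1)
      rw [quad_single (by omega)] at h2
      rw [← h2]
      refine hpos y' (fun i hi => ?_) ⟨M + k, ?_⟩
      · rw [h1 i (by omega), Pi.single_eq_of_ne (by omega)]
      · rw [h1 _ (by omega)]; simp
    have hsym : ∀ i j, pivot E (M + k) i j = pivot E (M + k) j i := by
      intro i j
      simp only [pivot, is i j, is i (M + k), is (M + k) j]; ring
    have hz : ∀ i j, M ≤ i → i < M + (k + 1) → pivot E (M + k) i j = 0 := by
      intro i j h1 h2
      rcases Nat.lt_or_ge i (M + k) with h | h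
      · simp [pivot, iz i _ h1 h]
      · obtain rfl : i = M + k := by omega
        simp only [pivot]; field_simp; ring
    rw [hEs]
    refine ⟨hsym, hz, fun y => ?_, fun y => ?_⟩
    · rw [quad_pivot is]
      have : 0 ≤ (∑ j ∈ range N, E (M + k) j * y j) ^ 2 / E (M + k) (M + k) := by positivity
      linarith [il y]
    · set t := y (M + k) - (∑ j ∈ range N, E (M + k) j * y j) / E (M + k) (M + k) with ht
      set y₁ := Function.update y (M + k) t with hy₁
      have hsum : ∑ j ∈ range N, E (M + k) j * y₁ j = 0 := by
        have h1 : ∀ j ∈ range N, E (M + k) j * y₁ j = E (M + k) j * y j +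
            if j = M + k then E (M + k) (M + k) * (t - y (M + k)) else 0 := by
          intro j _
          by_cases hj : j = M + k
          · subst hj; simp [hy₁]; ring
          · simp [hy₁, hj]
        rw [sum_congr rfl h1, sum_add_distrib, sum_ite_eq' (range N),
          if_pos (mem_range.2 (by omega)), ht]
        field_simp; ring
      obtain ⟨y', h1, h2⟩ := ia y₁
      refine ⟨y', fun i hi => ?_, ?_⟩
      · rw [h1 i (by omega), hy₁, Function.update_of_ne (by omega)]
      · rw [h2]
        have h3 := quad_pivot (n := N) is (M + k) y₁
        rw [hsum] at h3
        have h4 : quad N E y₁ = quad N (pivot E (M + k)) y₁ := by rw [h3]; simp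
        rw [h4]
        refine quad_congr fun i _ j _ => ?_
        by_cases hi : i = M + k
        · rw [hi, hz _ _ (by omega) (by omega)]; simp
        by_cases hj : j = M + k
        · rw [hj, hsym, hz _ _ (by omega) (by omega)]; simp
        · simp [hy₁, hi, hj]

/-- The Toeplitz matrix of `f`. -/
def toeplitz (f : ℕ → ℝ) : ℕ → ℕ → ℝ := fun i j => f ((i - j) + (j - i))

/-- The Toeplitz matrix of `f` without the entries beyond `m`. -/
def chain (f : ℕ → ℝ) (m : ℕ) : ℕ → ℕ → ℝ :=
  fun i j => if i < m ∨ j < m then toeplitz f i j else 0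

/-- Two forms on `2 M` variables glued along one block of `M` variables. -/
def glue (M : ℕ) (S : ℕ → ℕ → ℝ) : ℕ → ℕ → ℝ := fun i j =>
  (if i < 2 * M ∧ j < 2 * M then S i j else 0) +
    (if M ≤ i ∧ M ≤ j then S (i - M) (j - M) else 0)

/-- One doubling step: glue two copies of a form and eliminate the common block. -/
noncomputable def double (M : ℕ) (S : ℕ → ℕ → ℝ) : ℕ → ℕ → ℝ := fun i j =>
  pivots M (glue M S) M (if i < M then i else i + M) (if j < M then j else j + M)

/-- The first and the last of `n + 1` blocks of length `M`. -/
def ends (M n : ℕ) (v : ℕ → ℝ) : ℕ → ℝ := fun i => if i < M then v i else v (n * M + (i - M))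

/-- `S` is the minimum of the energy of a chain of `n + 1` blocks of length `M` over the inner
blocks, as a form in the first and the last block. The energy is that of the Toeplitz matrix of `f`,
without the inner energy of the last block. -/
structure IsChainMin (f : ℕ → ℝ) (M n : ℕ) (S : ℕ → ℕ → ℝ) : Prop where
  symm : ∀ i j, S i j = S j i
  le : ∀ v, quad (2 * M) S (ends M n v) ≤ quad ((n + 1) * M) (chain f (n * M)) v
  exists_eq : ∀ x, ∃ v, (∀ i < 2 * M, ends M n v i = x i) ∧
    quad ((n + 1) * M) (chain f (n * M)) v = quad (2 * M) S x

theorem toeplitz_symm (f : ℕ → ℝ) (i j : ℕ) : toeplitz f i j = toeplitz f j i := by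
  simp [toeplitz, add_comm]

theorem chain_symm (f : ℕ → ℝ) (m i j : ℕ) : chain f m i j = chain f m j i := by
  simp [chain, toeplitz_symm f i j, or_comm]

theorem isChainMin_one (f : ℕ → ℝ) (M : ℕ) : IsChainMin f M 1 (chain f M) := by
  have he : ∀ v, ends M 1 v = v := by
    intro v; funext i
    simp only [ends, one_mul]
    split_ifs with h
    · rfl
    · congr 1; omega
  refine ⟨chain_symm f M, fun v => ?_, fun x => ⟨x, fun i _ => by rw [he], ?_⟩⟩
  · rw [he, one_mul]
  · rw [one_mul]

/-- The energy of a chain of `2 n + 1` blocks is the sum of the energies of two chains of `n + 1`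
blocks with one block in common: blocks interact only with their neighbours, and the inner energy of
a common block is counted in the second chain only. -/
theorem chain_add {f : ℕ → ℝ} {M n : ℕ} (hf : ∀ d, M ≤ d → f d = 0) (hn : 0 < n) (v : ℕ → ℝ) :
    quad ((2 * n + 1) * M) (chain f (2 * n * M)) v =
      quad ((n + 1) * M) (chain f (n * M)) v +
        quad ((n + 1) * M) (chain f (n * M)) fun i => v (n * M + i) := by
  have e1 : (n + 1) * M = n * M + M := by ring
  have e2 : 2 * n * M = n * M + n * M := by ring
  have e3 : (2 * n + 1) * M = n * M + (n + 1) * M := by ring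
  have hM : M ≤ n * M := Nat.le_mul_of_pos_left M hn
  rw [← quad_ite_lt (a := (n + 1) * M) (N := n * M + (n + 1) * M) (by omega), ← quad_ite_ge,
    ← quad_add, e3]
  refine quad_congr fun i hi j hj => ?_
  congr 2
  have ht : toeplitz f (i - n * M) (j - n * M) = toeplitz f i j ∨ i < n * M ∨ j < n * M := by
    by_cases h : i < n * M ∨ j < n * M
    · exact .inr h
    · left; simp only [toeplitz]; congr 1; omega
  have h0 : ∀ i j, i < n * M → (n + 1) * M ≤ j → toeplitz f i j = 0 := fun i j h1 h2 =>
    hf _ (by omega)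
  simp only [chain]
  by_cases h1 : i < n * M <;> by_cases h2 : j < n * M
  · have a1 : i < (n + 1) * M := by omega
    have a2 : j < (n + 1) * M := by omega
    have a3 : i < 2 * n * M := by omega
    simp [h1, h2, a1, a2, a3]
  · have a1 : i < (n + 1) * M := by omega
    have a3 : i < 2 * n * M := by omega
    by_cases a2 : j < (n + 1) * M
    · simp [h1, a1, a2, a3]
    · simp [h1, a2, a3, h0 i j h1 (by omega)]
  · have a1 : j < (n + 1) * M := by omega
    have a3 : j < 2 * n * M := by omega
    by_cases a2 : i < (n + 1) * M
    · simp [h2, a1, a2, a3]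
    · simp [h2, a2, a3, toeplitz_symm f i j, h0 j i h2 (by omega)]
  · rw [ht.resolve_right (by omega)]
    have b1 : i < 2 * n * M ↔ i - n * M < n * M := by omega
    have b2 : j < 2 * n * M ↔ j - n * M < n * M := by omega
    simp [h1, h2, b1, b2, not_lt.1 h1, not_lt.1 h2]

/-- With the last block clamped to zero, the energy of a chain is the full Toeplitz form in the
other blocks. -/
theorem chain_zero_end {f : ℕ → ℝ} {M n : ℕ} {v : ℕ → ℝ} (hv : ∀ i < M, v (n * M + i) = 0) :
    quad ((n + 1) * M) (chain f (n * M)) v = quad (n * M) (toeplitz f) v := by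
  rw [← quad_ite_lt (a := n * M) (N := (n + 1) * M) (by gcongr; omega)]
  refine quad_congr fun i hi j hj => ?_
  have hv' : ∀ i < (n + 1) * M, ¬ i < n * M → v i = 0 := by
    intro i hi h
    have := hv (i - n * M) (by rw [add_mul, one_mul] at hi; omega)
    rwa [Nat.add_sub_cancel' (by omega)] at this
  by_cases h1 : i < n * M
  · by_cases h2 : j < n * M
    · simp [chain, h1, h2]
    · simp [hv' j hj h2]
  · simp [hv' i hi h1]

theorem glue_symm {M : ℕ} {S : ℕ → ℕ → ℝ} (h : ∀ i j, S i j = S j i) (i j : ℕ) :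
    glue M S i j = glue M S j i := by
  simp only [glue, h i j, h (i - M) (j - M), and_comm]

theorem quad_glue (M : ℕ) (S : ℕ → ℕ → ℝ) (y : ℕ → ℝ) :
    quad (3 * M) (glue M S) y = quad (2 * M) S y + quad (2 * M) S fun i => y (M + i) := by
  have e : 3 * M = M + 2 * M := by ring
  rw [← quad_ite_lt (a := 2 * M) (N := M + 2 * M) (by omega), ← quad_ite_ge, ← quad_add, e]
  rfl

/-- Two minimizing chains with a common end, put together. -/
theorem IsChainMin.exists_glue {f : ℕ → ℝ} {M n : ℕ} {S : ℕ → ℕ → ℝ} (h : IsChainMin f M n S)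
    (hf : ∀ d, M ≤ d → f d = 0) (hn : 0 < n) (y : ℕ → ℝ) :
    ∃ v, quad ((2 * n + 1) * M) (chain f (2 * n * M)) v = quad (3 * M) (glue M S) y ∧
      ∀ i < M, v i = y i ∧ v (n * M + i) = y (M + i) ∧ v (2 * n * M + i) = y (2 * M + i) := by
  obtain ⟨v₁, h1, e1⟩ := h.exists_eq y
  obtain ⟨v₂, h2, e2⟩ := h.exists_eq fun i => y (M + i)
  have hM : M ≤ n * M := Nat.le_mul_of_pos_left M hn
  have m1 : (n + 1) * M = n * M + M := by ring
  have m2 : 2 * n * M = n * M + n * M := by ring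
  have a1 : ∀ i < M, v₁ i = y i := fun i hi => by
    simpa [ends, hi] using h1 i (by omega)
  have a2 : ∀ i < M, v₁ (n * M + i) = y (M + i) := fun i hi => by
    have := h1 (M + i) (by omega)
    simpa [ends] using this
  have b1 : ∀ i < M, v₂ i = y (M + i) := fun i hi => by
    simpa [ends, hi] using h2 i (by omega)
  have b2 : ∀ i < M, v₂ (n * M + i) = y (2 * M + i) := fun i hi => by
    have := h2 (M + i) (by omega)
    simpa [ends, two_mul, add_assoc] using this
  set v : ℕ → ℝ := fun i => if i < (n + 1) * M then v₁ i else v₂ (i - n * M) with hv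
  have c1 : ∀ i < (n + 1) * M, v i = v₁ i := fun i hi => by simp only [hv, if_pos hi]
  have c2 : ∀ i < (n + 1) * M, v (n * M + i) = v₂ i := by
    intro i hi
    by_cases hiM : i < M
    · rw [c1 _ (by omega), a2 i hiM, b1 i hiM]
    · simp only [hv]
      rw [if_neg (by omega), Nat.add_sub_cancel_left]
  refine ⟨v, ?_, fun i hi => ⟨?_, ?_, ?_⟩⟩
  · rw [chain_add hf hn, quad_glue, ← e1, ← e2]
    congr 1
    · exact quad_congr fun i hi j hj => by rw [c1 i hi, c1 j hj]
    · exact quad_congr fun i hi j hj => by rw [c2 i hi, c2 j hj]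
  · rw [c1 i (by omega), a1 i hi]
  · rw [c2 i (by omega), b1 i hi]
  · rw [m2, add_assoc, c2 _ (by omega), b2 i hi]

/-- A form that does not involve the block of the variables `M`, …, `2 M - 1`. -/
theorem quad_skip_block {M : ℕ} {E : ℕ → ℕ → ℝ} (hs : ∀ i j, E i j = E j i)
    (hz : ∀ i j, M ≤ i → i < M + M → E i j = 0) (y : ℕ → ℝ) :
    quad (3 * M) E y = quad (2 * M)
      (fun i j => E (if i < M then i else i + M) (if j < M then j else j + M))
      fun i => y (if i < M then i else i + M) := by
  have key : ∀ F : ℕ → ℝ, (∀ i, M ≤ i → i < M + M → F i = 0) →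
      ∑ i ∈ range (3 * M), F i = ∑ i ∈ range (2 * M), F (if i < M then i else i + M) := by
    intro F hF
    have e1 : 3 * M = M + M + M := by ring
    have h1 : ∑ i ∈ range M, F (M + i) = 0 :=
      sum_eq_zero fun i hi => hF _ (by omega) (by have := mem_range.1 hi; omega)
    rw [e1, two_mul, sum_range_add, sum_range_add, sum_range_add, h1, add_zero]
    congr 1
    · exact sum_congr rfl fun i hi => by rw [if_pos (mem_range.1 hi)]
    · exact sum_congr rfl fun i hi => by rw [if_neg (by omega)]; congr 1; omega
  rw [quad, key]
  · exact sum_congr rfl fun i _ => key _ fun j h1 h2 => by rw [hs, hz j _ h1 h2]; simp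
  · exact fun i h1 h2 => sum_eq_zero fun j _ => by rw [hz i j h1 h2]; simp

/-- Minimization over the inner blocks of a long chain can be done in two stages: over the inner
blocks of its two halves, and then over the block that they share. -/
theorem IsChainMin.double {f : ℕ → ℝ} {M n : ℕ} {S : ℕ → ℕ → ℝ} (h : IsChainMin f M n S)
    (hf : ∀ d, M ≤ d → f d = 0) (hn : 0 < n)
    (hpos : ∀ (m : ℕ) (v : ℕ → ℝ), (∃ i < m, v i ≠ 0) → 0 < quad m (toeplitz f) v) :
    IsChainMin f M (2 * n) (double M S) := by
  have hM : M ≤ n * M := Nat.le_mul_of_pos_left M hn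
  have m1 : (n + 1) * M = n * M + M := by ring
  have m2 : 2 * n * M = n * M + n * M := by ring
  obtain ⟨es, ez, el, ea⟩ := pivots_spec (M := M) (N := 3 * M) (by omega) (glue_symm h.symm)
    (by
      rintro y hy ⟨i, hi⟩
      obtain ⟨v, hv, hv'⟩ := h.exists_glue hf hn y
      have hiM : M ≤ i ∧ i < 2 * M := by
        by_contra hc
        exact hi (hy i (by omega))
      rw [← hv, chain_zero_end fun i hi => by rw [(hv' i hi).2.2, hy _ (by omega)]]
      refine hpos _ _ ⟨n * M + (i - M), by omega, ?_⟩
      rw [(hv' (i - M) (by omega)).2.1, Nat.add_sub_cancel' hiM.1]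
      exact hi) M le_rfl
  have hq : ∀ y, quad (3 * M) (pivots M (glue M S) M) y =
      quad (2 * M) (SpectralFactor.double M S) fun i => y (if i < M then i else i + M) :=
    fun y => quad_skip_block es ez y
  refine ⟨fun i j => es _ _, fun v => ?_, fun x => ?_⟩
  · set y : ℕ → ℝ := fun i => if i < 2 * M then ends M n v i else v (2 * n * M + (i - 2 * M))
      with hy
    have h1 : quad (2 * M) (SpectralFactor.double M S) (ends M (2 * n) v) =
        quad (3 * M) (pivots M (glue M S) M) y := by
      rw [hq]
      have : ∀ i < 2 * M, y (if i < M then i else i + M) = ends M (2 * n) v i := by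
        intro i hi
        by_cases hiM : i < M
        · simp [hy, ends, hiM, hi]
        · have a1 : ¬ i + M < 2 * M := by omega
          have a2 : i + M - 2 * M = i - M := by omega
          simp [hy, ends, hiM, a1, a2]
      exact quad_congr fun i hi j hj => by rw [this i hi, this j hj]
    rw [h1, chain_add hf hn]
    refine (el y).trans ?_
    rw [quad_glue]
    have h2 : quad (2 * M) S y = quad (2 * M) S (ends M n v) :=
      quad_congr fun i hi j hj => by simp only [hy, if_pos hi, if_pos hj]
    have h3 : quad (2 * M) S (fun i => y (M + i)) =
        quad (2 * M) S (ends M n fun i => v (n * M + i)) := by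
      have : ∀ i < 2 * M, y (M + i) = ends M n (fun i => v (n * M + i)) i := by
        intro i hi
        by_cases hiM : i < M
        · have a1 : M + i < 2 * M := by omega
          simp [hy, ends, a1, hiM]
        · have a1 : ¬ M + i < 2 * M := by omega
          have a2 : 2 * n * M + (M + i - 2 * M) = n * M + (n * M + (i - M)) := by omega
          simp [hy, ends, a1, a2, hiM]
      exact quad_congr fun i hi j hj => by rw [this i hi, this j hj]
    rw [h2, h3]
    exact add_le_add (h.le v) (h.le _)
  · obtain ⟨y', hy', he⟩ := ea fun i => if i < M then x i else x (i - M)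
    obtain ⟨v, hv, hv'⟩ := h.exists_glue hf hn y'
    refine ⟨v, fun i hi => ?_, ?_⟩
    · by_cases hiM : i < M
      · simp only [ends, if_pos hiM, (hv' i hiM).1, hy' i (.inl hiM)]
      · have a1 : i < M + M := by omega
        simp only [ends, if_neg hiM]
        rw [(hv' (i - M) (by omega)).2.2, hy' _ (by omega), if_neg (by omega)]
        congr 1; omega
    · rw [hv, he, hq]
      refine quad_congr fun i hi j hj => ?_
      have : ∀ i, (if (if i < M then i else i + M) < M then x (if i < M then i else i + M)
          else x ((if i < M then i else i + M) - M)) = x i := by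
        intro i
        by_cases hiM : i < M <;> simp [hiM]
      simp only [this]

/-- The forms of the chains of `2 ^ r + 1` blocks. -/
noncomputable def doubling (f : ℕ → ℝ) (M : ℕ) : ℕ → ℕ → ℕ → ℝ
  | 0 => chain f M
  | r + 1 => double M (doubling f M r)

/-- The number of blocks doubles with each step, so that exponentially long chains are reached in
linearly many steps. -/
theorem isChainMin_doubling {f : ℕ → ℝ} {M : ℕ} (hf : ∀ d, M ≤ d → f d = 0)
    (hpos : ∀ (m : ℕ) (v : ℕ → ℝ), (∃ i < m, v i ≠ 0) → 0 < quad m (toeplitz f) v) (r : ℕ) :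
    IsChainMin f M (2 ^ r) (doubling f M r) := by
  induction r with
  | zero => exact isChainMin_one f M
  | succ r ih => rw [pow_succ']; exact ih.double hf (by positivity) hpos

/-- Clamping the last block to zero: the minimum form in the first block bounds the Toeplitz form of
`n` blocks from below. -/
theorem IsChainMin.first_le {f : ℕ → ℝ} {M n : ℕ} {S : ℕ → ℕ → ℝ} (h : IsChainMin f M n S)
    (hn : 0 < n) (q : ℕ → ℝ) : quad M S q ≤ quad (n * M) (toeplitz f) q := by
  have hM : M ≤ n * M := Nat.le_mul_of_pos_left M hn
  set v : ℕ → ℝ := fun i => if i < n * M then q i else 0 with hv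
  have h1 : quad (n * M) (toeplitz f) v = quad (n * M) (toeplitz f) q :=
    quad_congr fun i hi j hj => by simp only [hv, if_pos hi, if_pos hj]
  rw [← h1, ← chain_zero_end fun i hi => by simp [hv], ← quad_ite_lt (N := 2 * M) (by omega)]
  refine le_of_eq_of_le (quad_congr fun i hi j hj => ?_) (h.le v)
  have a1 : ∀ i < M, ends M n v i = q i := fun i hi => by
    simp only [ends, hv, if_pos hi, if_pos (hi.trans_le hM)]
  have a2 : ∀ i, ¬ i < M → ends M n v i = 0 := fun i hi => by simp [ends, hv, hi]
  by_cases h1 : i < M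
  · by_cases h2 : j < M
    · simp [h1, h2, a1]
    · simp [h2, a2 j h2]
  · simp [h1, a2 i h1]

/-- The bound of `IsChainMin.first_le` is attained. -/
theorem IsChainMin.exists_first_eq {f : ℕ → ℝ} {M n : ℕ} {S : ℕ → ℕ → ℝ}
    (h : IsChainMin f M n S) (a : ℕ → ℝ) :
    ∃ q, (∀ i < M, q i = a i) ∧ quad (n * M) (toeplitz f) q = quad M S a := by
  obtain ⟨v, hv, he⟩ := h.exists_eq fun i => if i < M then a i else 0
  have h0 : ∀ i < M, v (n * M + i) = 0 := fun i hi => by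
    have := hv (M + i) (by omega)
    simpa [ends] using this
  refine ⟨v, fun i hi => ?_, ?_⟩
  · have := hv i (by omega)
    simpa [ends, hi] using this
  · rw [← chain_zero_end h0, he, ← quad_ite_lt (a := M) (N := 2 * M) (by omega)]
    refine quad_congr fun i hi j hj => ?_
    by_cases h1 : i < M <;> by_cases h2 : j < M <;> simp [h1, h2]

end SpectralFactor

/-! ### Approximate inverses of outer polynomials -/

namespace SpectralFactor

open Finset ComplexConjugate

/-- The coefficients of `p` have absolute sum at most `a`. -/
def L1Bound (p : ℂ[X]) (a : ℝ) : Prop := ∀ N, ∑ n ∈ range N, ‖p.coeff n‖ ≤ a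

theorem norm_coeff_mul_le (p q : ℂ[X]) (n : ℕ) :
    ‖(p * q).coeff n‖ ≤ ∑ k ∈ range (n + 1), ‖p.coeff k‖ * ‖q.coeff (n - k)‖ := by
  rw [coeff_mul, Finset.Nat.sum_antidiagonal_eq_sum_range_succ fun i j => p.coeff i * q.coeff j]
  exact (norm_sum_le _ _).trans (sum_le_sum fun k _ => norm_mul_le _ _)

theorem L1Bound.nonneg {p : ℂ[X]} {a : ℝ} (h : L1Bound p a) : 0 ≤ a := by simpa using h 0

theorem L1Bound.mono {p : ℂ[X]} {a b : ℝ} (h : L1Bound p a) (hab : a ≤ b) : L1Bound p b :=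
  fun N => (h N).trans hab

theorem L1Bound.add {p q : ℂ[X]} {a b : ℝ} (hp : L1Bound p a) (hq : L1Bound q b) :
    L1Bound (p + q) (a + b) := fun N => by
  refine (sum_le_sum fun n _ => ?_).trans (sum_add_distrib.le.trans (add_le_add (hp N) (hq N)))
  rw [coeff_add]; exact norm_add_le _ _

theorem L1Bound.neg {p : ℂ[X]} {a : ℝ} (hp : L1Bound p a) : L1Bound (-p) a := fun N => by
  simpa using hp N

theorem L1Bound.mul {p q : ℂ[X]} {a b : ℝ} (hp : L1Bound p a) (hq : L1Bound q b) :
    L1Bound (p * q) (a * b) := fun N => by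
  calc ∑ n ∈ range N, ‖(p * q).coeff n‖
      ≤ ∑ n ∈ range N, ∑ k ∈ range (n + 1), ‖p.coeff k‖ * ‖q.coeff (n - k)‖ :=
        sum_le_sum fun n _ => norm_coeff_mul_le p q n
    _ = ∑ m ∈ range N, ∑ k ∈ range (N - m), ‖p.coeff m‖ * ‖q.coeff k‖ :=
        sum_range_diag_flip N fun k j => ‖p.coeff k‖ * ‖q.coeff j‖
    _ ≤ ∑ m ∈ range N, ‖p.coeff m‖ * b := sum_le_sum fun m _ => by
        rw [← mul_sum]; exact mul_le_mul_of_nonneg_left (hq _) (norm_nonneg _)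
    _ ≤ a * b := by rw [← sum_mul]; exact mul_le_mul_of_nonneg_right (hp N) hq.nonneg

theorem L1Bound.coeff_le {p : ℂ[X]} {a : ℝ} (hp : L1Bound p a) (n : ℕ) : ‖p.coeff n‖ ≤ a :=
  (single_le_sum (f := fun n => ‖p.coeff n‖) (fun _ _ => norm_nonneg _)
    (mem_range.2 n.lt_succ_self)).trans (hp (n + 1))

theorem L1Bound.coeff_mul_le {p q : ℂ[X]} {a s : ℝ} (hp : L1Bound p a)
    (hq : ∀ n, ‖q.coeff n‖ ≤ s) (n : ℕ) : ‖(p * q).coeff n‖ ≤ a * s := by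
  have hs : 0 ≤ s := (norm_nonneg _).trans (hq 0)
  refine (norm_coeff_mul_le p q n).trans ?_
  refine (sum_le_sum fun k _ => mul_le_mul_of_nonneg_left (hq (n - k)) (norm_nonneg _)).trans ?_
  rw [← sum_mul]
  exact mul_le_mul_of_nonneg_right (hp _) hs

theorem l1Bound_monomial (n : ℕ) (a : ℂ) : L1Bound (monomial n a) ‖a‖ := fun N => by
  simp only [coeff_monomial, apply_ite norm, norm_zero]
  rw [sum_ite_eq (range N)]
  split_ifs <;> simp

theorem l1Bound_one : L1Bound (1 : ℂ[X]) 1 := by simpa using l1Bound_monomial 0 1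

theorem outerPoly_nil : outerPoly [] = 1 := rfl

theorem outerPoly_cons (b : ℂ) (bs : List ℂ) :
    outerPoly (b :: bs) = (1 - C b * X) * outerPoly bs := by simp [outerPoly]

theorem outerPoly_coeff_zero (bs : List ℂ) : (outerPoly bs).coeff 0 = 1 := by
  induction bs with
  | nil => simp [outerPoly_nil]
  | cons b bs ih => simp [outerPoly_cons, mul_coeff_zero, ih]

theorem outerPoly_ne_zero (bs : List ℂ) : outerPoly bs ≠ 0 := fun h => by
  simpa [h] using outerPoly_coeff_zero bs

theorem outerPoly_natDegree (bs : List ℂ) : (outerPoly bs).natDegree ≤ bs.length := by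
  induction bs with
  | nil => simp [outerPoly_nil]
  | cons b bs ih =>
    rw [outerPoly_cons, List.length_cons, add_comm]
    refine natDegree_mul_le_of_le ?_ ih
    compute_degree

/-- Each factor `1 - bz` has absolute coefficient sum at most `2`. -/
theorem outerPoly_l1Bound {bs : List ℂ} (hb : ∀ b ∈ bs, ‖b‖ ≤ 1) :
    L1Bound (outerPoly bs) (2 ^ bs.length) := by
  induction bs with
  | nil => simpa [outerPoly_nil] using l1Bound_one
  | cons b bs ih =>
    rw [outerPoly_cons, List.length_cons, pow_succ']
    refine L1Bound.mul ?_ (ih fun b hb' => hb b (List.mem_cons_of_mem _ hb'))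
    have h1 : L1Bound (C b * X) 1 := by
      rw [C_mul_X_eq_monomial]
      exact (l1Bound_monomial 1 b).mono (hb b List.mem_cons_self)
    have := l1Bound_one.add h1.neg
    rw [← sub_eq_add_neg] at this
    exact this.mono (by norm_num)

/-- The Fejér-type mean `∑ (1 - j / N) bʲ zʲ` of the partial sums of the series of
`1 / (1 - bz)`. -/
noncomputable def fejerSum (N : ℕ) (b : ℂ) : ℂ[X] :=
  ∑ j ∈ range N, monomial j ((1 - j / N) * b ^ j)

/-- The error `1 - (1 - bz) ∑ (1 - j / N) bʲ zʲ`. -/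
noncomputable def fejerError (N : ℕ) (b : ℂ) : ℂ[X] :=
  ∑ j ∈ range N, monomial (j + 1) (b ^ (j + 1) / N)

theorem mul_fejerSum {N : ℕ} (hN : 0 < N) (b : ℂ) :
    (1 - C b * X) * fejerSum N b = 1 - fejerError N b := by
  have key : ∀ n : ℕ, (1 - C b * X) * ∑ j ∈ range n, monomial j ((1 - j / N : ℂ) * b ^ j) =
      1 - ∑ j ∈ range n, monomial (j + 1) (b ^ (j + 1) / N : ℂ) -
        monomial n ((1 - n / N : ℂ) * b ^ n) := by
    intro n
    induction n with
    | zero => simp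
    | succ n ih =>
      rw [sum_range_succ, mul_add, ih, sum_range_succ, C_mul_X_eq_monomial,
        sub_mul 1 (monomial 1 b), monomial_mul_monomial]
      have : (monomial (n + 1) ((1 - ((n + 1 : ℕ) : ℂ) / N) * b ^ (n + 1)) : ℂ[X]) =
          monomial (1 + n) (b * ((1 - n / N) * b ^ n)) - monomial (n + 1) (b ^ (n + 1) / N) := by
        rw [add_comm 1 n, ← map_sub]; congr 1; push_cast; ring
      rw [this]; ring
  have hN' : (N : ℂ) ≠ 0 := by exact_mod_cast hN.ne'
  rw [fejerSum, key, div_self hN']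
  simp [fejerError]

theorem fejerError_coeff {N : ℕ} (b : ℂ) (n : ℕ) :
    (fejerError N b).coeff n = if 1 ≤ n ∧ n ≤ N then b ^ n / N else 0 := by
  rw [fejerError, finsetSum_coeff]
  simp only [coeff_monomial]
  split_ifs with h
  · rw [sum_eq_single (n - 1)]
    · rw [if_pos (by omega), show n - 1 + 1 = n by omega]
    · intro j _ hj; rw [if_neg (by omega)]
    · intro hn; exact absurd (mem_range.2 (by omega)) hn
  · exact sum_eq_zero fun j hj => if_neg (by have := mem_range.1 hj; omega)

/-- The error is small coefficient by coefficient even for `|b| = 1`, where the partial sums of `∑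
bʲ zʲ` themselves have an error that does not decay. -/
theorem fejerError_coeff_le {N : ℕ} {b : ℂ} (hb : ‖b‖ ≤ 1) (n : ℕ) :
    ‖(fejerError N b).coeff n‖ ≤ 1 / N := by
  rw [fejerError_coeff]
  split_ifs
  · rw [norm_div, norm_pow, RCLike.norm_natCast]
    gcongr
    exact pow_le_one₀ (norm_nonneg _) hb
  · simp

theorem fejerError_l1Bound {N : ℕ} (hN : 0 < N) {b : ℂ} (hb : ‖b‖ ≤ 1) :
    L1Bound (fejerError N b) 1 := by
  have h : ∀ n, L1Bound (∑ j ∈ range n, monomial (j + 1) (b ^ (j + 1) / N : ℂ)) (n / N) := by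
    intro n
    induction n with
    | zero => intro K; simp
    | succ n ih =>
      rw [sum_range_succ]
      refine (ih.add (l1Bound_monomial _ _)).mono ?_
      have : ‖b ^ (n + 1) / (N : ℂ)‖ ≤ 1 / N := by
        rw [norm_div, norm_pow, RCLike.norm_natCast]
        gcongr
        exact pow_le_one₀ (norm_nonneg _) hb
      push_cast
      rw [add_div]; linarith
  have := h N
  rwa [div_self (by exact_mod_cast hN.ne')] at this

theorem fejerSum_natDegree (N : ℕ) (b : ℂ) : (fejerSum N b).natDegree ≤ N - 1 := by
  refine natDegree_sum_le_of_forall_le _ _ fun j hj => (natDegree_monomial_le _).trans ?_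
  have := mem_range.1 hj; omega

theorem fejerSum_coeff_zero {N : ℕ} (hN : 0 < N) (b : ℂ) : (fejerSum N b).coeff 0 = 1 := by
  have := congrArg (fun p => p.coeff 0) (mul_fejerSum hN b)
  simpa [mul_coeff_zero, fejerError_coeff] using this

/-- An approximate inverse of `outerPoly bs`: a product of Fejér-type means. -/
theorem exists_approx_inverse {bs : List ℂ} (hb : ∀ b ∈ bs, ‖b‖ ≤ 1) {N : ℕ} (hN : 0 < N) :
    ∃ q e : ℂ[X], outerPoly bs * q = 1 + e ∧ q.natDegree ≤ bs.length * (N - 1) ∧ q.coeff 0 = 1 ∧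
      L1Bound e (2 ^ bs.length - 1) ∧ ∀ n, ‖e.coeff n‖ ≤ (2 ^ bs.length - 1) / N := by
  induction bs with
  | nil => exact ⟨1, 0, by simp [outerPoly_nil], by simp, by simp, fun K => by simp, by simp⟩
  | cons b bs ih =>
    obtain ⟨q, e, h1, h2, h3, h4, h5⟩ := ih fun b hb' => hb b (List.mem_cons_of_mem _ hb')
    have hb1 := hb b List.mem_cons_self
    refine ⟨fejerSum N b * q, e + (-fejerError N b + -(fejerError N b * e)), ?_, ?_, ?_, ?_,
      fun n => ?_⟩
    · rw [outerPoly_cons]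
      linear_combination (1 - C b * X) * fejerSum N b * h1 + (1 + e) * mul_fejerSum hN b
    · rw [List.length_cons, add_mul, one_mul, add_comm]
      exact natDegree_mul_le_of_le (fejerSum_natDegree N b) h2
    · rw [mul_coeff_zero, fejerSum_coeff_zero hN, h3, one_mul]
    · have hg := fejerError_l1Bound hN hb1
      refine (h4.add (hg.neg.add (hg.mul h4).neg)).mono (le_of_eq ?_)
      rw [List.length_cons, pow_succ]; ring
    · have hg := fejerError_l1Bound hN hb1
      have a1 := fejerError_coeff_le (N := N) hb1 n
      have a2 := hg.coeff_mul_le h5 n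
      rw [coeff_add, coeff_add, coeff_neg, coeff_neg]
      refine (norm_add_le _ _).trans ((add_le_add (h5 n) (norm_add_le _ _)).trans ?_)
      rw [norm_neg, norm_neg]
      have : ((2 : ℝ) ^ (b :: bs).length - 1) / N =
          (2 ^ bs.length - 1) / N + (1 / N + 1 * ((2 ^ bs.length - 1) / N)) := by
        rw [List.length_cons, pow_succ]; ring
      rw [this]
      gcongr

end SpectralFactor

/-! ### Parseval's identity for Toeplitz forms -/

namespace SpectralFactor

open Finset ComplexConjugate

/-- The polynomial with the first `D` coefficients `q`. -/
noncomputable def ofCoeffs (D : ℕ) (q : ℕ → ℂ) : ℂ[X] := ∑ i ∈ range D, monomial i (q i)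

theorem ofCoeffs_coeff (D : ℕ) (q : ℕ → ℂ) (n : ℕ) :
    (ofCoeffs D q).coeff n = if n < D then q n else 0 := by
  rw [ofCoeffs, finsetSum_coeff]
  simp only [coeff_monomial]
  rw [sum_ite_eq' (range D)]
  simp

theorem ofCoeffs_natDegree (D : ℕ) (q : ℕ → ℂ) : (ofCoeffs D q).natDegree ≤ D - 1 :=
  natDegree_le_iff_coeff_eq_zero.2 fun n hn => by rw [ofCoeffs_coeff, if_neg (by omega)]

/-- The coefficients of `|P|²`, for a polynomial `P` of degree at most `L`, as an even function of
the index: `G = z^L |P|²` has the coefficients `f d` in degree `L ± d`. -/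
structure IsAutocorrelation (L : ℕ) (P : ℂ[X]) (c : ℝ) (f : ℕ → ℝ) : Prop where
  natDegree_le : P.natDegree ≤ L
  coeff_add : ∀ d, (C (c : ℂ) * (P * reflect L (P.map (starRingEnd ℂ)))).coeff (L + d) = f d
  coeff_sub : ∀ d ≤ L, (C (c : ℂ) * (P * reflect L (P.map (starRingEnd ℂ)))).coeff (L - d) = f d

theorem natDegree_reflect_le {N : ℕ} {p : ℂ[X]} (hp : p.natDegree ≤ N) :
    (reflect N p).natDegree ≤ N :=
  natDegree_le_iff_coeff_eq_zero.2 fun n hn => by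
    rw [coeff_reflect, revAt_eq_self_of_lt hn]
    exact coeff_eq_zero_of_natDegree_lt (by omega)

variable {L : ℕ} {P : ℂ[X]} {c : ℝ} {f : ℕ → ℝ}

theorem IsAutocorrelation.eq_zero (h : IsAutocorrelation L P c f) {d : ℕ} (hd : L < d) :
    f d = 0 := by
  have h1 := h.coeff_add d
  rw [coeff_C_mul, coeff_eq_zero_of_natDegree_lt, mul_zero] at h1
  · exact_mod_cast h1.symm
  · refine lt_of_le_of_lt (natDegree_mul_le_of_le h.natDegree_le (natDegree_reflect_le
      (natDegree_map_le.trans h.natDegree_le))) (by omega)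

/-- The sum of the squares of the coefficients is a coefficient of `p p̄`. -/
theorem coeff_mul_reflect_conj (p : ℂ[X]) (N : ℕ) :
    (p * reflect N (p.map (starRingEnd ℂ))).coeff N =
      ((∑ n ∈ range (N + 1), ‖p.coeff n‖ ^ 2 : ℝ) : ℂ) := by
  rw [coeff_mul, Finset.Nat.sum_antidiagonal_eq_sum_range_succ fun i j =>
    p.coeff i * (reflect N (p.map (starRingEnd ℂ))).coeff j, Complex.ofReal_sum]
  refine sum_congr rfl fun n hn => ?_
  have hn' := mem_range.1 hn
  rw [coeff_reflect, revAt_le (by omega), show N - (N - n) = n by omega, coeff_map,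
    Complex.mul_conj, Complex.normSq_eq_norm_sq]

/-- Parseval's identity: the energy of `q` in the Toeplitz form of `c |P|²` is `c ‖q P‖²`. -/
theorem IsAutocorrelation.energy (h : IsAutocorrelation L P c f) {D : ℕ} (hD : 0 < D)
    (q : ℕ → ℂ) :
    quad D (toeplitz f) (fun i => (q i).re) + quad D (toeplitz f) (fun i => (q i).im) =
      c * ∑ n ∈ range (D + L), ‖(ofCoeffs D q * P).coeff n‖ ^ 2 := by
  set Q := ofCoeffs D q with hQ
  have hQd := ofCoeffs_natDegree D q
  have h1 := coeff_mul_reflect_conj (Q * P) (D - 1 + L)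
  rw [show D - 1 + L + 1 = D + L by omega, Polynomial.map_mul, reflect_mul _ _
    (natDegree_map_le.trans hQd) (natDegree_map_le.trans h.natDegree_le)] at h1
  have hQr : reflect (D - 1) (Q.map (starRingEnd ℂ)) =
      ∑ j ∈ range D, monomial (D - 1 - j) (conj (q j)) := by
    ext n
    rw [coeff_reflect, coeff_map, ofCoeffs_coeff, finsetSum_coeff]
    simp only [coeff_monomial]
    rcases Nat.lt_or_ge (D - 1) n with hn | hn
    · rw [revAt_eq_self_of_lt hn, if_neg (by omega), map_zero,
        sum_eq_zero fun j hj => if_neg (by omega)]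
    · rw [revAt_le hn, if_pos (by omega), sum_eq_single (D - 1 - n)]
      · rw [if_pos (by omega)]
      · intro j hj hj'
        have := mem_range.1 hj
        rw [if_neg (by omega)]
      · intro hn'; exact absurd (mem_range.2 (by omega)) hn'
  have hcoef : ∀ i ∈ range D, ∀ j ∈ range D,
      (monomial i (q i) * (monomial (D - 1 - j) (conj (q j)) *
        (C (c : ℂ) * (P * reflect L (P.map (starRingEnd ℂ)))))).coeff (D - 1 + L) =
        (toeplitz f i j : ℂ) * (q i * conj (q j)) := by
    intro i hi j hj
    have hi' := mem_range.1 hi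
    have hj' := mem_range.1 hj
    rw [← C_mul_X_pow_eq_monomial, ← C_mul_X_pow_eq_monomial, mul_assoc, mul_assoc, coeff_C_mul,
      mul_left_comm, coeff_C_mul, ← mul_assoc (X ^ i), ← pow_add, coeff_X_pow_mul']
    have key : (if i + (D - 1 - j) ≤ D - 1 + L then (C (c : ℂ) * (P * reflect L
        (P.map (starRingEnd ℂ)))).coeff (D - 1 + L - (i + (D - 1 - j))) else 0) =
        (toeplitz f i j : ℂ) := by
      rcases le_total i j with hij | hij
      · rw [if_pos (by omega), show D - 1 + L - (i + (D - 1 - j)) = L + (j - i) by omega,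
          h.coeff_add, toeplitz, Nat.sub_eq_zero_of_le hij, zero_add]
      · rw [toeplitz, Nat.sub_eq_zero_of_le hij, add_zero]
        split_ifs with hL
        · rw [show D - 1 + L - (i + (D - 1 - j)) = L - (i - j) by omega, h.coeff_sub _ (by omega)]
        · rw [h.eq_zero (by omega)]; simp
    rw [key]; ring
  have h2 : (c : ℂ) * ((Q * P) * (reflect (D - 1) (Q.map (starRingEnd ℂ)) *
      reflect L (P.map (starRingEnd ℂ)))).coeff (D - 1 + L) =
      ∑ i ∈ range D, ∑ j ∈ range D, (toeplitz f i j : ℂ) * (q i * conj (q j)) := by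
    rw [← coeff_C_mul, show C (c : ℂ) * ((Q * P) * (reflect (D - 1) (Q.map (starRingEnd ℂ)) *
      reflect L (P.map (starRingEnd ℂ)))) = Q * (reflect (D - 1) (Q.map (starRingEnd ℂ)) *
      (C (c : ℂ) * (P * reflect L (P.map (starRingEnd ℂ))))) by ring, hQr, hQ, ofCoeffs,
      sum_mul, finsetSum_coeff]
    refine sum_congr rfl fun i hi => ?_
    rw [sum_mul, mul_sum, finsetSum_coeff]
    exact sum_congr rfl fun j hj => hcoef i hi j hj
  rw [h1] at h2
  have h3 := congrArg Complex.re h2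
  rw [← Complex.ofReal_mul, Complex.ofReal_re] at h3
  rw [h3, Complex.re_sum, quad, quad, ← sum_add_distrib]
  refine sum_congr rfl fun i _ => ?_
  rw [Complex.re_sum, ← sum_add_distrib]
  refine sum_congr rfl fun j _ => ?_
  rw [Complex.re_ofReal_mul, Complex.mul_re, Complex.conj_re, Complex.conj_im]
  ring

theorem IsAutocorrelation.energy_real (h : IsAutocorrelation L P c f) {D : ℕ} (hD : 0 < D)
    (q : ℕ → ℝ) : quad D (toeplitz f) q =
      c * ∑ n ∈ range (D + L), ‖(ofCoeffs D (fun i => (q i : ℂ)) * P).coeff n‖ ^ 2 := by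
  rw [← h.energy hD]
  simp [quad]

/-- By Parseval's identity, the Toeplitz form at `v` is `c` times the squared norm of a product of
two nonzero polynomials. -/
theorem IsAutocorrelation.quad_pos (h : IsAutocorrelation L P c f) (hc : 0 < c) (hP : P ≠ 0)
    (D : ℕ) (v : ℕ → ℝ) (hv : ∃ i < D, v i ≠ 0) : 0 < quad D (toeplitz f) v := by
  obtain ⟨i, hi, hvi⟩ := hv
  rw [h.energy_real (by omega)]
  refine mul_pos hc ?_
  set Q := ofCoeffs D fun i => (v i : ℂ) with hQ
  have hQ0 : Q ≠ 0 := by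
    intro h0
    have := ofCoeffs_coeff D (fun i => (v i : ℂ)) i
    rw [← hQ, h0, coeff_zero, if_pos hi] at this
    exact hvi (by exact_mod_cast this.symm)
  have hQP : Q * P ≠ 0 := mul_ne_zero hQ0 hP
  refine sum_pos' (fun n _ => by positivity) ⟨(Q * P).natDegree, ?_, ?_⟩
  · have := natDegree_mul_le_of_le (ofCoeffs_natDegree D fun i => (v i : ℂ)) h.natDegree_le
    exact mem_range.2 (by rw [← hQ] at this; omega)
  · have : (Q * P).coeff (Q * P).natDegree ≠ 0 := leadingCoeff_ne_zero.2 hQP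
    positivity

theorem quad_add_smul {n : ℕ} {S : ℕ → ℕ → ℝ} (hs : ∀ i j, S i j = S j i) (x y : ℕ → ℝ) (t : ℝ) :
    quad n S (fun i => x i + t * y i) = quad n S x +
      2 * t * (∑ i ∈ range n, ∑ j ∈ range n, S i j * x i * y j) + t ^ 2 * quad n S y := by
  have h1 : ∑ i ∈ range n, ∑ j ∈ range n, S i j * y i * x j =
      ∑ i ∈ range n, ∑ j ∈ range n, S i j * x i * y j := by
    rw [sum_comm]
    refine sum_congr rfl fun i _ => sum_congr rfl fun j _ => ?_
    rw [hs j i]; ring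
  have h2 : quad n S (fun i => x i + t * y i) = quad n S x +
      t * (∑ i ∈ range n, ∑ j ∈ range n, S i j * x i * y j) +
      t * (∑ i ∈ range n, ∑ j ∈ range n, S i j * y i * x j) + t ^ 2 * quad n S y := by
    simp only [quad, mul_sum, ← sum_add_distrib]
    refine sum_congr rfl fun i _ => sum_congr rfl fun j _ => ?_
    ring
  rw [h2, h1]; ring

theorem eq_zero_of_forall_quadratic_nonneg {a b : ℝ} (h : ∀ t : ℝ, 0 ≤ t * a + t ^ 2 * b) :
    a = 0 := by
  by_contra ha
  have hb := abs_nonneg b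
  have h1 := h (-a / (|b| + 1))
  have h2 : -a / (|b| + 1) * a + (-a / (|b| + 1)) ^ 2 * b =
      a ^ 2 / (|b| + 1) ^ 2 * (b - (|b| + 1)) := by
    field_simp; ring
  rw [h2] at h1
  have h3 : 0 < a ^ 2 / (|b| + 1) ^ 2 := by positivity
  nlinarith [le_abs_self b]

/-- An entry in the last row of the first block of the minimum form is the bilinear form of the
minimizer with a unit vector, because the minimizer is orthogonal to the remaining variables. -/
theorem IsChainMin.last_row {M n : ℕ} {S : ℕ → ℕ → ℝ} (h : IsChainMin f M n S) (hn : 0 < n)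
    (hM : 0 < M) : ∃ q : ℕ → ℝ, (∀ i < M, q i = if i = M - 1 then 1 else 0) ∧
      quad (n * M) (toeplitz f) q = S (M - 1) (M - 1) ∧
      ∀ i < M, S (M - 1) i = ∑ k ∈ range (n * M), toeplitz f k i * q k := by
  obtain ⟨q, hq, he⟩ := h.exists_first_eq (Pi.single (M - 1) 1)
  have hMn : M ≤ n * M := Nat.le_mul_of_pos_left M hn
  rw [quad_single (by omega)] at he
  refine ⟨q, fun i hi => by rw [hq i hi, Pi.single_apply], he, fun i hi => ?_⟩
  have key : ∀ t : ℝ, 0 ≤ t * (2 * ((∑ k ∈ range (n * M), toeplitz f k i * q k) - S (M - 1) i)) +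
      t ^ 2 * (quad (n * M) (toeplitz f) (Pi.single i 1) - S i i) := by
    intro t
    have h1 := h.first_le hn fun k => q k + t * (Pi.single i 1 : ℕ → ℝ) k
    have h2 : quad M S (fun k => q k + t * (Pi.single i 1 : ℕ → ℝ) k) =
        quad M S (fun k => (Pi.single (M - 1) 1 : ℕ → ℝ) k + t * (Pi.single i 1 : ℕ → ℝ) k) :=
      quad_congr fun a ha b hb => by rw [hq a ha, hq b hb]
    rw [h2, quad_add_smul h.symm, quad_add_smul (toeplitz_symm f), he, quad_single (by omega),
      quad_single (by omega)] at h1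
    have h3 : ∑ a ∈ range M, ∑ b ∈ range M, S a b * (Pi.single (M - 1) 1 : ℕ → ℝ) a *
        (Pi.single i 1 : ℕ → ℝ) b = S (M - 1) i := by
      rw [sum_eq_single (M - 1), sum_eq_single i]
      · simp
      · intro b _ hb; simp [hb]
      · intro hb; exact absurd (mem_range.2 hi) hb
      · intro a _ ha; simp [ha]
      · intro ha; exact absurd (mem_range.2 (by omega)) ha
    have h4 : ∑ a ∈ range (n * M), ∑ b ∈ range (n * M), toeplitz f a b * q a *
        (Pi.single i 1 : ℕ → ℝ) b = ∑ k ∈ range (n * M), toeplitz f k i * q k := by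
      refine sum_congr rfl fun a _ => ?_
      rw [sum_eq_single i]
      · simp
      · intro b _ hb; simp [hb]
      · intro hb; exact absurd (mem_range.2 (by omega)) hb
    rw [h3, h4] at h1
    linarith
  have := eq_zero_of_forall_quadratic_nonneg key
  linarith

end SpectralFactor

/-! ### Convergence of the minimum form -/

namespace SpectralFactor

open Finset ComplexConjugate

variable {L N : ℕ} {bs : List ℂ} {c : ℝ} {f : ℕ → ℝ} {S : ℕ → ℕ → ℝ}

/-- The approximate inverse of the outer factor is a competitor in the minimum defining the last
diagonal entry of the first block. -/
theorem IsChainMin.last_le (hb : ∀ b ∈ bs, ‖b‖ ≤ 1) (hL : bs.length = L) (hc : 0 ≤ c)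
    (hf : IsAutocorrelation L (outerPoly bs) c f) (hN : 0 < N)
    (hS : IsChainMin f (L + 1) N S) : S L L ≤ c * (1 + 4 ^ L / N) := by
  obtain ⟨q, e, h1, h2, h3, h4, h5⟩ := exists_approx_inverse hb hN
  rw [hL] at h2 h4 h5
  set D := N * (L + 1) with hD
  have hLN : L + L * (N - 1) = L * N := by
    obtain ⟨k, rfl⟩ : ∃ k, N = k + 1 := ⟨N - 1, by omega⟩
    rw [Nat.add_sub_cancel]; ring
  have hLD : L * N + N = D := by rw [hD]; ring
  have hMD : L + 1 ≤ D := Nat.le_mul_of_pos_left _ hN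
  have he0 : e.coeff 0 = 0 := by
    have := congrArg (fun p => p.coeff 0) h1
    simpa [mul_coeff_zero, outerPoly_coeff_zero, h3] using this
  set u : ℕ → ℂ := fun k => (X ^ L * q).coeff k with hu
  have hQ : ofCoeffs D u = X ^ L * q := by
    ext k
    rw [ofCoeffs_coeff]
    split_ifs with hk
    · rfl
    · refine (coeff_eq_zero_of_natDegree_lt ?_).symm
      exact lt_of_le_of_lt (natDegree_mul_le_of_le (natDegree_X_pow_le L) h2) (by omega)
  have hE := hf.energy (D := D) (by omega) u
  have hv : 0 ≤ quad D (toeplitz f) fun i => (u i).im := by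
    rw [hf.energy_real (by omega)]
    exact mul_nonneg hc (sum_nonneg fun n _ => by positivity)
  have hfirst := hS.first_le hN fun i => (u i).re
  have hsing : quad (L + 1) S (fun i => (u i).re) = S L L := by
    rw [← quad_single (show L < L + 1 by omega) S]
    refine quad_congr fun i hi j hj => ?_
    have : ∀ k < L + 1, (u k).re = (Pi.single L 1 : ℕ → ℝ) k := by
      intro k hk
      rw [hu]
      dsimp only
      rw [coeff_X_pow_mul', Pi.single_apply]
      rcases (by omega : k < L ∨ k = L) with hk | rfl
      · rw [if_neg (by omega), if_neg (by omega), Complex.zero_re]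
      · simp [h3]
    rw [this i hi, this j hj]
  have hsum : ∑ n ∈ range (D + L), ‖(ofCoeffs D u * outerPoly bs).coeff n‖ ^ 2 ≤
      1 + 4 ^ L / N := by
    have hprod : ofCoeffs D u * outerPoly bs = X ^ L * (1 + e) := by rw [hQ, ← h1]; ring
    rw [hprod, add_comm D L, sum_range_add]
    have hz : ∑ n ∈ range L, ‖((X : ℂ[X]) ^ L * (1 + e)).coeff n‖ ^ 2 = 0 :=
      sum_eq_zero fun n hn => by
        have := mem_range.1 hn
        rw [coeff_X_pow_mul', if_neg (by omega)]; simp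
    rw [hz, zero_add]
    have ht : ∀ n, ‖((X : ℂ[X]) ^ L * (1 + e)).coeff (L + n)‖ ^ 2 =
        (if n = 0 then 1 else 0) + ‖e.coeff n‖ ^ 2 := by
      intro n
      rw [add_comm L n, coeff_X_pow_mul, coeff_add, coeff_one]
      split_ifs with hn
      · rw [hn, he0]; simp
      · simp
    simp only [ht]
    rw [sum_add_distrib, sum_ite_eq' (range D), if_pos (mem_range.2 (by omega))]
    refine add_le_add le_rfl ?_
    have h40 : (0 : ℝ) ≤ 2 ^ L - 1 := h4.nonneg
    calc ∑ n ∈ range D, ‖e.coeff n‖ ^ 2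
        ≤ ∑ n ∈ range D, ‖e.coeff n‖ * ((2 ^ L - 1) / N) := sum_le_sum fun n _ => by
          rw [sq]; exact mul_le_mul_of_nonneg_left (h5 n) (norm_nonneg _)
      _ ≤ (2 ^ L - 1) * ((2 ^ L - 1) / N) := by
          rw [← sum_mul]; exact mul_le_mul_of_nonneg_right (h4 D) (by positivity)
      _ ≤ 4 ^ L / N := by
          rw [← mul_div_assoc]
          gcongr
          have : (4 : ℝ) ^ L = 2 ^ L * 2 ^ L := by rw [← mul_pow]; norm_num
          rw [this]
          nlinarith
  calc S L L ≤ c * ∑ n ∈ range (D + L), ‖(ofCoeffs D u * outerPoly bs).coeff n‖ ^ 2 := by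
        rw [← hE]; linarith
    _ ≤ _ := mul_le_mul_of_nonneg_left hsum hc

/-- The last row of the first block of the minimum form converges to the coefficients of the outer
factor, at the rate `N ^ (-1/2)`. -/
theorem IsChainMin.last_row_approx (hb : ∀ b ∈ bs, ‖b‖ ≤ 1) (hL : bs.length = L) (hc : 0 < c)
    (hf : IsAutocorrelation L (outerPoly bs) c f) (hN : 0 < N)
    (hS : IsChainMin f (L + 1) N S) {η : ℝ} (hη : 0 ≤ η) (hNη : 4 ^ L / N ≤ η ^ 2) :
    c ≤ S L L ∧ S L L ≤ c * (1 + η ^ 2) ∧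
      ∀ i ≤ L, ‖(S L i : ℂ) - c * conj ((outerPoly bs).coeff (L - i))‖ ≤ c * (2 ^ L * η) := by
  have hup := hS.last_le hb hL hc.le hf hN
  have hup' : S L L ≤ c * (1 + η ^ 2) := hup.trans (by gcongr)
  obtain ⟨q, hq, hqS, hrow⟩ := hS.last_row hN (by omega)
  rw [Nat.add_sub_cancel] at hq hqS hrow
  set D := N * (L + 1) with hD
  have hMD : L + 1 ≤ D := Nat.le_mul_of_pos_left _ hN
  set O := outerPoly bs with hO
  set Q := ofCoeffs D (fun i => (q i : ℂ)) with hQ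
  have hQc : ∀ k, Q.coeff k = if k < D then (q k : ℂ) else 0 := ofCoeffs_coeff D _
  obtain ⟨Q₁, hQ₁⟩ : X ^ L ∣ Q := X_pow_dvd_iff.2 fun d hd => by
    rw [hQc, if_pos (by omega), hq d (by omega), if_neg (by omega), Complex.ofReal_zero]
  have hQ₁0 : Q₁.coeff 0 = 1 := by
    have := hQc L
    rw [hQ₁, if_pos (by omega), hq L (by omega), if_pos rfl, coeff_X_pow_mul', if_pos le_rfl,
      Nat.sub_self] at this
    simpa using this
  obtain ⟨e, he⟩ : ∃ e, O * Q₁ = 1 + e := ⟨O * Q₁ - 1, by ring⟩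
  have he0 : e.coeff 0 = 0 := by
    have := congrArg (fun p => p.coeff 0) he
    simpa [mul_coeff_zero, hO, outerPoly_coeff_zero, hQ₁0] using this
  have hQO : Q * O = X ^ L * (1 + e) := by rw [hQ₁, ← he]; ring
  have henergy : S L L = c * ∑ n ∈ range (D + L), ‖(Q * O).coeff n‖ ^ 2 := by
    rw [← hqS, hf.energy_real (by omega)]
  have hcoef : ∀ n, (Q * O).coeff (n + L) = (if n = 0 then 1 else 0) + e.coeff n := fun n => by
    rw [hQO, coeff_X_pow_mul, coeff_add, coeff_one]
  have hQOdeg : (Q * O).natDegree < D + L := by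
    have := natDegree_mul_le_of_le (ofCoeffs_natDegree D fun i => (q i : ℂ)) hf.natDegree_le
    rw [← hQ] at this; omega
  have hlow : c ≤ S L L := by
    have h1 := single_le_sum (f := fun n => ‖(Q * O).coeff n‖ ^ 2) (s := range (D + L)) (a := L)
      (fun _ _ => by positivity) (mem_range.2 (by omega))
    have h2 := hcoef 0
    rw [zero_add, if_pos rfl, he0, add_zero] at h2
    simp only [h2, norm_one, one_pow] at h1
    rw [henergy]; nlinarith
  have he_le : ∀ n, ‖e.coeff n‖ ≤ η := by
    intro n
    rcases Nat.eq_zero_or_pos n with rfl | hn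
    · rw [he0, norm_zero]; exact hη
    rcases Nat.lt_or_ge n D with hnD | hnD
    · have h1 : ∑ m ∈ ({0 + L, n + L} : Finset ℕ), ‖(Q * O).coeff m‖ ^ 2 ≤
          ∑ m ∈ range (D + L), ‖(Q * O).coeff m‖ ^ 2 := by
        refine sum_le_sum_of_subset_of_nonneg ?_ fun _ _ _ => by positivity
        intro m hm
        rw [mem_insert, mem_singleton] at hm
        exact mem_range.2 (by omega)
      rw [sum_pair (by omega), hcoef, hcoef, if_pos rfl, if_neg (by omega), he0] at h1
      simp only [add_zero, zero_add, norm_one, one_pow] at h1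
      have h2 : c * (1 + ‖e.coeff n‖ ^ 2) ≤ c * (1 + η ^ 2) := by
        refine le_trans ?_ hup'
        rw [henergy]
        exact mul_le_mul_of_nonneg_left h1 hc.le
      have h3 := le_of_mul_le_mul_left h2 hc
      exact (pow_le_pow_iff_left₀ (norm_nonneg _) hη two_ne_zero).1 (by linarith)
    · have h1 := hcoef n
      rw [if_neg (by omega), zero_add, coeff_eq_zero_of_natDegree_lt (by omega)] at h1
      rw [← h1, norm_zero]; exact hη
  refine ⟨hlow, hup', fun i hi => ?_⟩
  set R := reflect L (O.map (starRingEnd ℂ)) with hR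
  have hSi : (S L i : ℂ) = (C (c : ℂ) * (O * R) * Q).coeff (L + i) := by
    rw [hrow i (by omega), hQ, ofCoeffs, mul_sum, finsetSum_coeff, Complex.ofReal_sum]
    refine sum_congr rfl fun k hk => ?_
    have hk' := mem_range.1 hk
    rw [← C_mul_X_pow_eq_monomial, mul_left_comm, coeff_C_mul, coeff_mul_X_pow',
      Complex.ofReal_mul, mul_comm]
    congr 1
    rcases le_total k i with hki | hki
    · rw [if_pos (by omega), show L + i - k = L + (i - k) by omega, hf.coeff_add, toeplitz,
        Nat.sub_eq_zero_of_le hki, zero_add]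
    · rw [toeplitz, Nat.sub_eq_zero_of_le hki, add_zero]
      split_ifs with hL'
      · rw [show L + i - k = L - (k - i) by omega, hf.coeff_sub _ (by omega)]
      · rw [hf.eq_zero (by omega)]; simp
  have hSi' : (S L i : ℂ) = c * (conj (O.coeff (L - i)) + (R * e).coeff i) := by
    rw [hSi, hQ₁, show C (c : ℂ) * (O * R) * (X ^ L * Q₁) = C (c : ℂ) * (R * (O * Q₁)) * X ^ L by
      ring, he, add_comm L i, coeff_mul_X_pow, coeff_C_mul, mul_add, mul_one, coeff_add]
    congr 2
    rw [hR, coeff_reflect, revAt_le hi, coeff_map]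
  rw [hSi', ← mul_sub, add_sub_cancel_left, norm_mul, Complex.norm_real, Real.norm_of_nonneg hc.le]
  refine mul_le_mul_of_nonneg_left ?_ hc.le
  calc ‖(R * e).coeff i‖ ≤ ∑ k ∈ range (i + 1), ‖R.coeff k‖ * ‖e.coeff (i - k)‖ :=
        norm_coeff_mul_le R e i
    _ ≤ ∑ k ∈ range (i + 1), ‖R.coeff k‖ * η := sum_le_sum fun k _ =>
        mul_le_mul_of_nonneg_left (he_le _) (norm_nonneg _)
    _ ≤ ∑ k ∈ range (L + 1), ‖R.coeff k‖ * η :=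
        sum_le_sum_of_subset_of_nonneg (range_subset_range.2 (by omega)) fun _ _ _ => by positivity
    _ = (∑ k ∈ range (L + 1), ‖O.coeff k‖) * η := by
        rw [← sum_mul, ← sum_range_reflect (fun k => ‖O.coeff k‖)]
        congr 1
        refine sum_congr rfl fun k hk => ?_
        have := mem_range.1 hk
        rw [hR, coeff_reflect, revAt_le (by omega), coeff_map, RCLike.norm_conj,
          show L + 1 - 1 - k = L - k by omega]
    _ ≤ 2 ^ L * η := by
        refine mul_le_mul_of_nonneg_right ?_ hη
        rw [← hL]; exact outerPoly_l1Bound hb _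

end SpectralFactor

namespace CompositeGate

open Complex ComplexConjugate Finset

/-! ### Passing between the trigonometric and the algebraic form -/

/-- Horner's scheme for `lift`. -/
noncomputable def preLift (s : ℝ) (a : ℕ → ℝ) (L : ℕ) : ℕ → ℝ[X]
  | 0 => 0
  | i + 1 => C (s / 4) * preLift s a L i + C (1 / 2) * (X * preLift s a L i) +
      C (s / 4) * (X ^ 2 * preLift s a L i) + monomial i (a (L - 2 * i))

/-- For `L` odd and an odd polynomial `A` with coefficients `a`, the polynomial `h` of degree `L`
with `h (w²) = w ^ L A (cos t)` (for `s = 1`) or `h (w²) = i w ^ L A (sin t)` (for `s = -1`), where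
`w = exp (i t)`. -/
noncomputable def lift (s : ℝ) (a : ℕ → ℝ) (L : ℕ) : ℝ[X] :=
  C (s / 2) * preLift s a L (L / 2 + 1) + C (1 / 2) * (X * preLift s a L (L / 2 + 1))

theorem natDegree_sub_le_max_of_le {R : Type*} [Ring R] {p q : R[X]} {n : ℕ}
    (hp : p.natDegree ≤ n) (hq : q.natDegree ≤ n) : (p - q).natDegree ≤ n :=
  (natDegree_sub_le p q).trans (max_le hp hq)

theorem preLift_natDegree (s : ℝ) (a : ℕ → ℝ) (L i : ℕ) :
    (preLift s a L (i + 1)).natDegree ≤ 2 * i := by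
  induction i with
  | zero => simp [preLift]
  | succ i ih =>
    rw [preLift]
    refine natDegree_add_le_of_degree_le (natDegree_add_le_of_degree_le
      (natDegree_add_le_of_degree_le ?_ ?_) ?_) ((natDegree_monomial_le _).trans (by omega))
    · exact (natDegree_C_mul_le _ _).trans (by omega)
    · exact (natDegree_C_mul_le _ _).trans
        ((natDegree_mul_le_of_le natDegree_X_le ih).trans (by omega))
    · exact (natDegree_C_mul_le _ _).trans
        ((natDegree_mul_le_of_le (natDegree_X_pow_le 2) ih).trans (by omega))

theorem lift_natDegree (s : ℝ) (a : ℕ → ℝ) {L : ℕ} (hL : Odd L) : (lift s a L).natDegree ≤ L := by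
  obtain ⟨m, rfl⟩ := hL
  have h := preLift_natDegree s a (2 * m + 1) ((2 * m + 1) / 2)
  refine natDegree_add_le_of_degree_le ?_ ?_
  · exact (natDegree_C_mul_le _ _).trans (by omega)
  · exact (natDegree_C_mul_le _ _).trans
      ((natDegree_mul_le_of_le natDegree_X_le h).trans (by omega))

theorem IsOddPolynomial.coeff_even {A : ℝ[X]} (hA : IsOddPolynomial A) (k : ℕ) :
    A.coeff (2 * k) = 0 := by
  have h := congrArg (fun p => p.coeff (2 * k)) hA
  rw [show (-X : ℝ[X]) = C (-1) * X by simp] at h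
  simp only [comp_C_mul_X_coeff, coeff_neg, pow_mul] at h
  norm_num at h
  linarith

theorem IsOddPolynomial.eval_neg {A : ℝ[X]} (hA : IsOddPolynomial A) (y : ℂ) :
    aeval (-y) A = -aeval y A := by
  have h := congrArg (fun p => aeval y p) hA
  simpa [aeval_comp] using h

theorem sum_range_two_mul (n : ℕ) (F : ℕ → ℂ) :
    ∑ k ∈ range (2 * n), F k = ∑ i ∈ range n, (F (2 * i) + F (2 * i + 1)) := by
  induction n with
  | zero => simp
  | succ n ih => rw [show 2 * (n + 1) = 2 * n + 1 + 1 by ring, sum_range_succ, sum_range_succ, ih,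
      sum_range_succ, add_assoc]

theorem IsOddPolynomial.aeval_eq {A : ℝ[X]} (hA : IsOddPolynomial A) {m : ℕ}
    (hd : A.natDegree ≤ 2 * m + 1) (y : ℂ) :
    aeval y A = ∑ j ∈ range (m + 1), (A.coeff (2 * m + 1 - 2 * j) : ℂ) * y ^ (2 * (m - j) + 1) := by
  rw [aeval_eq_sum_range' (n := 2 * (m + 1)) (by omega), sum_range_two_mul,
    ← sum_range_reflect]
  refine sum_congr rfl fun j hj => ?_
  have := mem_range.1 hj
  rw [hA.coeff_even, show m + 1 - 1 - j = m - j by omega,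
    show 2 * m + 1 - 2 * j = 2 * (m - j) + 1 by omega]
  simp

/-- The relation between `w = exp (i t)` and `y = cos t` (for `s = κ = 1`) or `y = sin t` (for
`s = -1` and `κ = i`). -/
structure TrigPoint (s : ℝ) (κ w y : ℂ) : Prop where
  sq_s : s ^ 2 = 1
  sq_κ : κ ^ 2 = s
  ne_zero : w ≠ 0
  eq : 2 * κ * y * w = s + w ^ 2

namespace TrigPoint

variable {s : ℝ} {κ w y : ℂ}

theorem sq_s' (h : TrigPoint s κ w y) : (s : ℂ) ^ 2 = 1 := by exact_mod_cast h.sq_s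

theorem eq_one_or (h : TrigPoint s κ w y) : s = 1 ∨ s = -1 :=
  mul_self_eq_one_iff.1 (by rw [← sq, h.sq_s])

theorem preLift_eval (h : TrigPoint s κ w y) (a : ℕ → ℝ) (L i : ℕ) :
    aeval (w ^ 2) (preLift s a L (i + 1)) =
      w ^ (2 * i) * ∑ j ∈ range (i + 1), (a (L - 2 * j) : ℂ) * y ^ (2 * (i - j)) := by
  induction i with
  | zero => simp [preLift]
  | succ i ih =>
    have e : aeval (w ^ 2) (preLift s a L (i + 2)) =
        w ^ 2 * y ^ 2 * aeval (w ^ 2) (preLift s a L (i + 1)) +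
          (a (L - 2 * (i + 1)) : ℂ) * w ^ (2 * (i + 1)) := by
      rw [preLift]
      simp only [map_add, map_mul, aeval_C, aeval_X, map_pow, aeval_monomial, coe_algebraMap]
      push_cast
      have h1 := h.eq
      have h2 := h.sq_κ
      have h3 := h.sq_s'
      have key : (s : ℂ) / 4 + 1 / 2 * w ^ 2 + s / 4 * (w ^ 2) ^ 2 = w ^ 2 * y ^ 2 := by
        linear_combination (-(s : ℂ) / 4 * (2 * κ * y * w + s + w ^ 2)) * h1 +
          s * y ^ 2 * w ^ 2 * h2 + (y ^ 2 * w ^ 2 - s / 4 - w ^ 2 / 2) * h3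
      rw [← key]
      ring
    rw [e, ih, sum_range_succ _ (i + 1), mul_add (w ^ _), Nat.sub_self, mul_sum, mul_sum, mul_sum]
    congr 1
    · refine sum_congr rfl fun j hj => ?_
      have := mem_range.1 hj
      rw [show 2 * (i + 1 - j) = 2 * (i - j) + 2 by omega]
      ring
    · ring

/-- The defining property of `lift`. -/
theorem lift_eval (h : TrigPoint s κ w y) {A : ℝ[X]} (hA : IsOddPolynomial A) {L : ℕ} (hL : Odd L)
    (hd : A.natDegree ≤ L) : aeval (w ^ 2) (lift s A.coeff L) = w ^ L * κ * aeval y A := by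
  obtain ⟨m, rfl⟩ := hL
  rw [hA.aeval_eq hd, lift, show (2 * m + 1) / 2 = m by omega]
  simp only [map_add, map_mul, aeval_C, aeval_X, coe_algebraMap]
  rw [h.preLift_eval]
  have e : ∑ j ∈ range (m + 1), (A.coeff (2 * m + 1 - 2 * j) : ℂ) * y ^ (2 * (m - j) + 1) =
      y * ∑ j ∈ range (m + 1), (A.coeff (2 * m + 1 - 2 * j) : ℂ) * y ^ (2 * (m - j)) := by
    rw [mul_sum]; exact sum_congr rfl fun j _ => by ring
  rw [e]
  push_cast
  set T := ∑ j ∈ range (m + 1), (A.coeff (2 * m + 1 - 2 * j) : ℂ) * y ^ (2 * (m - j))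
  linear_combination (-w ^ (2 * m) * T / 2) * h.eq

/-- Replacing the angle `t` by `-t`, which fixes `cos t` and negates `sin t`. -/
theorem inv (h : TrigPoint s κ w y) : TrigPoint s κ w⁻¹ (s * y) where
  sq_s := h.sq_s
  sq_κ := h.sq_κ
  ne_zero := inv_ne_zero h.ne_zero
  eq := by
    have hw := h.ne_zero
    field_simp
    linear_combination s * h.eq + h.sq_s'

end TrigPoint

theorem exists_trigPoint {s : ℝ} {κ w : ℂ} (hs : s ^ 2 = 1) (hκ : κ ^ 2 = s) (hw : w ≠ 0) :
    ∃ y, TrigPoint s κ w y := by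
  have hκ0 : κ ≠ 0 := by
    rintro rfl
    have : s = 0 := by exact_mod_cast (by simpa using hκ.symm : (s : ℂ) = 0)
    simp [this] at hs
  exact ⟨(s + w ^ 2) / (2 * κ * w), hs, hκ, hw, by field_simp⟩

theorem aeval_reflect {N : ℕ} {p : ℝ[X]} (hp : p.natDegree ≤ N) {z : ℂ} (hz : z ≠ 0) :
    aeval z (reflect N p) = z ^ N * aeval z⁻¹ p := by
  rw [← eval_map_algebraMap, ← eval_map_algebraMap, ← reflect_map,
    SpectralFactor.eval_reflect (natDegree_map_le.trans hp) hz]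

theorem ext_aeval {p q : ℝ[X]} (h : ∀ w : ℂ, w ≠ 0 → aeval (w ^ 2) p = aeval (w ^ 2) q) :
    p = q := by
  refine map_injective _ (algebraMap ℝ ℂ).injective
    (SpectralFactor.eq_of_eval_circle fun z hz => ?_)
  obtain ⟨w, rfl⟩ := IsAlgClosed.exists_pow_nat_eq z two_pos
  rw [eval_map_algebraMap, eval_map_algebraMap]
  exact h w fun h0 => by simp [h0] at hz

/-- Parity of the trigonometric polynomial, as a symmetry of the coefficients of `lift`. -/
theorem reflect_lift {s : ℝ} {κ : ℂ} (hs : s ^ 2 = 1) (hκ : κ ^ 2 = s) {A : ℝ[X]}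
    (hA : IsOddPolynomial A) {L : ℕ} (hL : Odd L) (hd : A.natDegree ≤ L) :
    reflect L (lift s A.coeff L) = C s * lift s A.coeff L := by
  refine ext_aeval fun w hw => ?_
  obtain ⟨y, h⟩ := exists_trigPoint hs hκ hw
  have hA' : aeval (s * y) A = s * aeval y A := by
    rcases h.eq_one_or with rfl | rfl
    · simp
    · simp [hA.eval_neg]
  rw [aeval_reflect (lift_natDegree s _ hL) (pow_ne_zero _ hw), ← inv_pow, h.inv.lift_eval hA hL hd,
    map_mul, h.lift_eval hA hL hd, hA']
  simp only [aeval_C, coe_algebraMap]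
  have : w ^ L * w⁻¹ ^ L = 1 := by rw [← mul_pow, mul_inv_cancel₀ hw, one_pow]
  rw [pow_right_comm]
  linear_combination (w ^ L * κ * s * aeval y A) * this

/-- The odd polynomials `V` with `V (i + 1) (cos t) = cos ((2 i + 1) t)` (for `s = 1`) or
`V (i + 1) (sin t) = sin ((2 i + 1) t)` (for `s = -1`). -/
noncomputable def oddCheb (s : ℝ) : ℕ → ℝ[X]
  | 0 => C s * X
  | 1 => X
  | i + 2 => C (4 * s) * (X ^ 2 * oddCheb s (i + 1)) - C (2 * s) * oddCheb s (i + 1) - oddCheb s i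

theorem oddCheb_natDegree (s : ℝ) (i : ℕ) : (oddCheb s (i + 1)).natDegree ≤ 2 * i + 1 := by
  have : ∀ i, (oddCheb s i).natDegree ≤ 2 * i + 1 ∧ (oddCheb s (i + 1)).natDegree ≤ 2 * i + 1 := by
    intro i
    induction i with
    | zero =>
      refine ⟨(natDegree_C_mul_le _ _).trans natDegree_X_le, ?_⟩
      rw [oddCheb]; exact natDegree_X_le
    | succ i ih =>
      refine ⟨ih.2.trans (by omega), ?_⟩
      rw [oddCheb]
      refine natDegree_sub_le_max_of_le (natDegree_sub_le_max_of_le ?_ ?_) (ih.1.trans (by omega))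
      · exact (natDegree_C_mul_le _ _).trans
          ((natDegree_mul_le_of_le (natDegree_X_pow_le 2) ih.2).trans (by omega))
      · exact (natDegree_C_mul_le _ _).trans (ih.2.trans (by omega))
  exact (this i).2

/-- For `s = ± 1`, the polynomial of degree at most `L` corresponding to `(P ± P^*) / 2`, where `P`
has the coefficients `p` and `P^*` is the reciprocal polynomial. -/
noncomputable def outPoly (s : ℝ) (p : ℕ → ℝ) (L : ℕ) : ℝ[X] :=
  ∑ i ∈ range (L / 2 + 1), C (p (L / 2 + 1 + i) + s * p (L / 2 - i)) * oddCheb s (i + 1)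

theorem outPoly_natDegree (s : ℝ) (p : ℕ → ℝ) {L : ℕ} (hL : Odd L) :
    (outPoly s p L).natDegree ≤ L := by
  obtain ⟨m, rfl⟩ := hL
  refine natDegree_sum_le_of_forall_le _ _ fun i hi => (natDegree_C_mul_le _ _).trans ?_
  have := mem_range.1 hi
  exact (oddCheb_natDegree s i).trans (by omega)

/-- The identity `2 κ V (y) = w ^ (2 i - 1) + s w ^ (-(2 i - 1))` for the polynomial `V` of index
`i`, freed of negative exponents; `i = 0` is the start of the recurrence. -/
theorem TrigPoint.oddCheb_eval {s : ℝ} {κ w y : ℂ} (h : TrigPoint s κ w y) (i : ℕ) :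
    2 * κ * aeval y (oddCheb s i) * w ^ (2 * i + 1) = w ^ (4 * i) + s * w ^ 2 := by
  have h1 := h.eq
  have h2 := h.sq_κ
  have h3 := h.sq_s'
  have key : (s : ℂ) * (4 * y ^ 2 - 2) * w ^ 2 = 1 + w ^ 4 := by
    linear_combination (2 * κ * y * w + s + w ^ 2) * h1 - 4 * y ^ 2 * w ^ 2 * h2 + h3
  have main : ∀ i, 2 * κ * aeval y (oddCheb s i) * w ^ (2 * i + 1) = w ^ (4 * i) + s * w ^ 2 ∧
      2 * κ * aeval y (oddCheb s (i + 1)) * w ^ (2 * (i + 1) + 1) =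
        w ^ (4 * (i + 1)) + s * w ^ 2 := by
    intro i
    induction i with
    | zero =>
      simp only [oddCheb, map_mul, aeval_C, aeval_X, coe_algebraMap]
      exact ⟨by linear_combination s * h1 + h3, by linear_combination w ^ 2 * h1⟩
    | succ i ih =>
      refine ⟨ih.2, ?_⟩
      simp only [oddCheb, map_sub, map_mul, map_pow, aeval_C, aeval_X, coe_algebraMap]
      push_cast
      linear_combination (s * (4 * y ^ 2 - 2) * w ^ 2) * ih.2 - w ^ 4 * ih.1 +
        (w ^ (4 * (i + 1)) + s * w ^ 2) * key
  exact (main i).1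

theorem sum_range_middle (m : ℕ) (F : ℕ → ℂ) :
    ∑ k ∈ range (2 * m + 1 + 1), F k = ∑ i ∈ range (m + 1), (F (m + 1 + i) + F (m - i)) := by
  rw [show 2 * m + 1 + 1 = m + 1 + (m + 1) by ring, sum_range_add, ← sum_range_reflect,
    ← sum_add_distrib]
  refine sum_congr rfl fun i _ => ?_
  rw [add_comm, show m + 1 - 1 - i = m - i by omega]

/-- `outPoly` evaluates, up to the factor `2 κ w ^ L`, to `P + P^*` (for `s = 1`) or to `P - P^*`
(for `s = -1`), because it combines the Chebyshev polynomials with the coefficients of `P` in the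
degrees symmetric about `L / 2`. -/
theorem TrigPoint.outPoly_eval {s : ℝ} {κ w y : ℂ} (h : TrigPoint s κ w y) {P : ℝ[X]} {L : ℕ}
    (hL : Odd L) (hP : P.natDegree ≤ L) :
    2 * κ * w ^ L * aeval y (outPoly s P.coeff L) =
      aeval (w ^ 2) P + s * aeval (w ^ 2) (reflect L P) := by
  obtain ⟨m, rfl⟩ := hL
  have hr : (reflect (2 * m + 1) P).natDegree ≤ 2 * m + 1 :=
    natDegree_le_iff_coeff_eq_zero.2 fun n hn => by
      rw [coeff_reflect, revAt_eq_self_of_lt hn]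
      exact coeff_eq_zero_of_natDegree_lt (by omega)
  rw [aeval_eq_sum_range' (p := P) (n := 2 * m + 1 + 1) (by omega),
    aeval_eq_sum_range' (p := reflect _ P) (n := 2 * m + 1 + 1) (by omega), sum_range_middle,
    sum_range_middle,
    outPoly, show (2 * m + 1) / 2 = m by omega, map_sum, mul_sum, mul_sum, ← sum_add_distrib]
  refine sum_congr rfl fun i hi => ?_
  have hi' := mem_range.1 hi
  rw [coeff_reflect, coeff_reflect, revAt_le (by omega), revAt_le (by omega),
    show 2 * m + 1 - (m + 1 + i) = m - i by omega, show 2 * m + 1 - (m - i) = m + 1 + i by omega]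
  have h1 := h.oddCheb_eval (i + 1)
  have h2 : 2 * κ * w ^ (2 * m + 1) * aeval y (oddCheb s (i + 1)) =
      (w ^ 2) ^ (m + 1 + i) + s * (w ^ 2) ^ (m - i) := by
    have hz : w ^ 2 ≠ 0 := pow_ne_zero _ h.ne_zero
    refine mul_right_cancel₀ hz ?_
    have e : w ^ (2 * m + 1) * w ^ 2 = w ^ (2 * (i + 1) + 1) * (w ^ 2) ^ (m - i) := by
      rw [← pow_mul, ← pow_add, ← pow_add]; congr 1; omega
    have e2 : (w ^ 2) ^ (m + 1 + i) = (w ^ 2) ^ (m - i) * (w ^ 2) ^ (2 * i + 1) := by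
      rw [← pow_add]; congr 1; omega
    rw [e2]
    linear_combination (2 * κ * aeval y (oddCheb s (i + 1))) * e + (w ^ 2) ^ (m - i) * h1
  simp only [map_mul, aeval_C, coe_algebraMap, Algebra.smul_def]
  push_cast
  linear_combination ((P.coeff (m + 1 + i) : ℂ) + s * P.coeff (m - i)) * h2 +
    (P.coeff (m - i) : ℂ) * (w ^ 2) ^ (m - i) * h.sq_s'

/-- The polynomial `F` with `F (w²) = w ^ (2 L) (1 - A (cos t)² - C (sin t)²)`. -/
noncomputable def gapPoly (A C : ℝ[X]) (L : ℕ) : ℝ[X] :=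
  X ^ L - lift 1 A.coeff L ^ 2 + lift (-1) C.coeff L ^ 2

theorem trigPoint_cos (t : ℝ) : TrigPoint 1 1 (exp (I * t)) (Real.cos t) where
  sq_s := by norm_num
  sq_κ := by norm_num
  ne_zero := exp_ne_zero _
  eq := by
    rw [ofReal_cos, Complex.cos, mul_comm I (t : ℂ), neg_mul, exp_neg]
    have := exp_ne_zero (t * I)
    generalize exp (t * I) = w at this ⊢
    field_simp
    push_cast; ring

theorem trigPoint_sin (t : ℝ) : TrigPoint (-1) I (exp (I * t)) (Real.sin t) where
  sq_s := by norm_num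
  sq_κ := by simp
  ne_zero := exp_ne_zero _
  eq := by
    rw [ofReal_sin, Complex.sin, mul_comm I (t : ℂ), neg_mul, exp_neg]
    have := exp_ne_zero (t * I)
    generalize exp (t * I) = w at this ⊢
    field_simp
    push_cast
    linear_combination (1 - w ^ 2) * I_sq

theorem aeval_ofReal (P : ℝ[X]) (x : ℝ) : aeval (x : ℂ) P = ((P.eval x : ℝ) : ℂ) := by
  simpa using aeval_algebraMap_apply_eq_algebraMap_eval (A := ℂ) x P

/-- A real factorization of the gap polynomial gives the two missing polynomials. -/
theorem achievable_of_factor {A C P : ℝ[X]} {L : ℕ} (hL : Odd L) (hA : IsOddPolynomial A)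
    (hC : IsOddPolynomial C) (hdA : A.natDegree ≤ L) (hdC : C.natDegree ≤ L) (hA1 : A.eval 1 = 1)
    (hP : P.natDegree ≤ L) (hF : gapPoly A C L = P * reflect L P) :
    AchievableWithLength L A (outPoly 1 P.coeff L) C (outPoly (-1) P.coeff L) := by
  set h := lift 1 A.coeff L with hh
  set g := lift (-1) C.coeff L with hg
  set P' := reflect L P with hP'
  have hr : P'.natDegree ≤ L := natDegree_le_iff_coeff_eq_zero.2 fun n hn => by
    rw [hP', coeff_reflect, revAt_eq_self_of_lt hn]
    exact coeff_eq_zero_of_natDegree_lt (by omega)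
  have hhd : h.natDegree ≤ L := lift_natDegree _ _ hL
  have hgd : g.natDegree ≤ L := lift_natDegree _ _ hL
  set ι := algebraMap ℝ ℂ with hι
  have hmap : ∀ q : ℝ[X], (q.map ι).map (starRingEnd ℂ) = q.map ι := fun q => by
    rw [Polynomial.map_map]; congr 1; ext x; simp [hι]
  set a : ℂ[X] := h.map ι + Polynomial.C (I / 2) * (P + P').map ι with ha
  set b : ℂ[X] := g.map ι - Polynomial.C (I / 2) * (P - P').map ι with hb
  have hPP' : ∀ i ≤ L, P'.coeff (L - i) = P.coeff i ∧ P'.coeff i = P.coeff (L - i) := fun i hi => by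
    rw [hP', coeff_reflect, coeff_reflect, revAt_le (by omega), revAt_le hi]
    exact ⟨by congr 1; omega, rfl⟩
  have hsym : ∀ (s : ℝ) (κ : ℂ) (Q : ℝ[X]), s ^ 2 = 1 → κ ^ 2 = s → IsOddPolynomial Q →
      Q.natDegree ≤ L → ∀ i ≤ L, (lift s Q.coeff L).coeff (L - i) =
        s * (lift s Q.coeff L).coeff i := by
    intro s κ Q h1 h2 h3 h4 i hi
    rw [← coeff_C_mul, ← reflect_lift h1 h2 h3 hL h4, coeff_reflect, revAt_le hi]
  have hF' : (h.map ι) ^ 2 - (g.map ι) ^ 2 + P.map ι * P'.map ι = X ^ L := by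
    have := congrArg (Polynomial.map ι) hF
    rw [gapPoly, ← hh, ← hg] at this
    simp only [Polynomial.map_add, Polynomial.map_sub, Polynomial.map_pow, Polynomial.map_mul,
      map_X] at this
    linear_combination -this
  have hCI : (Polynomial.C (I / 2) : ℂ[X]) * Polynomial.C (I / 2) = -Polynomial.C (1 / 4) := by
    rw [← C_mul, ← C_neg]; congr 1; linear_combination I_sq / 4
  have hcI : (starRingEnd ℂ) (I / 2) = -(I / 2) := by
    rw [map_div₀, conj_I, map_ofNat, neg_div]
  have hC4 : (Polynomial.C (1 / 4) : ℂ[X]) * 4 = 1 := by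
    rw [← C_ofNat, ← C_mul]; norm_num
  refine (exists_phases L a b ?_ ?_ ?_ ?_ ?_ ?_).elim fun φ hφ => ?_
  · exact natDegree_add_le_of_degree_le (natDegree_map_le.trans hhd) ((natDegree_C_mul_le _ _).trans
      (natDegree_map_le.trans (natDegree_add_le_of_degree_le hP hr)))
  · exact natDegree_sub_le_max_of_le (natDegree_map_le.trans hgd) ((natDegree_C_mul_le _ _).trans
      (natDegree_map_le.trans (natDegree_sub_le_max_of_le hP hr)))
  · intro i hi
    have := hsym 1 1 A (by norm_num) (by norm_num) hA hdA i hi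
    rw [← hh, one_mul] at this
    simp only [ha, Polynomial.coeff_add, coeff_C_mul, coeff_map, this, (hPP' i hi).1,
      (hPP' i hi).2]
    rw [add_comm (P.coeff i)]
  · intro i hi
    have := hsym (-1) I C (by norm_num) (by simp) hC hdC i hi
    rw [← hg] at this
    simp only [hb, Polynomial.coeff_sub, coeff_C_mul, coeff_map, this, (hPP' i hi).1,
      (hPP' i hi).2, map_sub, map_mul, map_neg, map_one]
    ring
  · have ha' : a.map (starRingEnd ℂ) = h.map ι - Polynomial.C (I / 2) * (P + P').map ι := by
      rw [ha]
      simp only [Polynomial.map_add, Polynomial.map_mul, hmap, map_C, hcI, C_neg]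
      ring
    have hb' : b.map (starRingEnd ℂ) = g.map ι + Polynomial.C (I / 2) * (P - P').map ι := by
      rw [hb]
      simp only [Polynomial.map_sub, Polynomial.map_mul, hmap, map_C, hcI, C_neg]
      ring
    rw [ha', hb', ha, hb]
    simp only [Polynomial.map_add, Polynomial.map_sub]
    linear_combination hF' - ((P.map ι + P'.map ι) ^ 2 - (P.map ι - P'.map ι) ^ 2) * hCI +
      P.map ι * P'.map ι * hC4
  · -- `F (1) = 1 - A (1) ^ 2 - C (0) ^ 2 = 0`, so that `P (1) = 0` and `a (1) = A (1) = 1`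
    have tc := trigPoint_cos 0
    have ts := trigPoint_sin 0
    have v1 := tc.lift_eval hA hL hdA
    have v3 := ts.lift_eval hC hL hdC
    have hC0 : C.eval 0 = 0 := by
      have := hC.coeff_even 0
      rwa [mul_zero, coeff_zero_eq_eval_zero] at this
    rw [aeval_ofReal] at v1 v3
    simp only [Real.cos_zero, Real.sin_zero, hA1, hC0, ofReal_zero, mul_zero, exp_zero, one_pow,
      ofReal_one, mul_one] at v1 v3
    have hPr : aeval (1 : ℂ) P' = aeval (1 : ℂ) P := by
      rw [hP', aeval_reflect hP one_ne_zero]; simp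
    have h0 := congrArg (eval 1) hF'
    simp only [eval_add, eval_sub, eval_mul, eval_pow, eval_map_algebraMap, hι, eval_X, hPr,
      hh, hg, v1, v3] at h0
    have hP0 : aeval (1 : ℂ) P = 0 := by
      have : aeval (1 : ℂ) P ^ 2 = 0 := by linear_combination h0
      exact pow_eq_zero_iff two_ne_zero |>.1 this
    rw [ha]
    simp only [eval_add, eval_mul, eval_map_algebraMap, hι, map_add, hPr, hP0, hh, v1]
    simp
  · refine ⟨φ, fun θ => ?_⟩
    rw [hφ θ, polynomialForm, if_pos hL]
    have e : exp (I * (θ / 2)) = exp (I * (θ / 2 : ℝ)) := by push_cast; rfl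
    rw [e]
    set w := exp (I * (θ / 2 : ℝ)) with hw
    have hw0 : w ≠ 0 := exp_ne_zero _
    have hwL : w⁻¹ ^ L * w ^ L = 1 := by rw [← mul_pow, inv_mul_cancel₀ hw0, one_pow]
    have tc := trigPoint_cos (θ / 2)
    have ts := trigPoint_sin (θ / 2)
    have v1 := tc.lift_eval hA hL hdA
    have v2 := tc.outPoly_eval hL hP
    have v3 := ts.lift_eval hC hL hdC
    have v4 := ts.outPoly_eval hL hP
    rw [aeval_ofReal, ← hw] at v1 v2 v3 v4
    have va : w⁻¹ ^ L * a.eval (w ^ 2) = ((A.eval (Real.cos (θ / 2)) : ℝ) : ℂ) +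
        I * (((outPoly 1 P.coeff L).eval (Real.cos (θ / 2)) : ℝ) : ℂ) := by
      rw [ha]
      simp only [eval_add, eval_mul, eval_C, eval_map_algebraMap, hι, map_add]
      rw [v1]
      push_cast at v2
      linear_combination (-I / 2 * w⁻¹ ^ L) * v2 + (((A.eval (Real.cos (θ / 2)) : ℝ) : ℂ) +
        I * (((outPoly 1 P.coeff L).eval (Real.cos (θ / 2)) : ℝ) : ℂ)) * hwL
    have vb : w⁻¹ ^ L * b.eval (w ^ 2) =
        (((outPoly (-1) P.coeff L).eval (Real.sin (θ / 2)) : ℝ) : ℂ) +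
        I * ((C.eval (Real.sin (θ / 2)) : ℝ) : ℂ) := by
      rw [hb]
      simp only [eval_sub, eval_mul, eval_C, eval_map_algebraMap, hι, map_sub]
      rw [v3]
      push_cast at v4
      linear_combination (I / 2 * w⁻¹ ^ L) * v4 +
        ((((outPoly (-1) P.coeff L).eval (Real.sin (θ / 2)) : ℝ) : ℂ) +
          I * ((C.eval (Real.sin (θ / 2)) : ℝ) : ℂ)) * hwL -
        (w⁻¹ ^ L * w ^ L * (((outPoly (-1) P.coeff L).eval (Real.sin (θ / 2)) : ℝ) : ℂ)) * I_sq
    rw [va, vb]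
    ext i j
    fin_cases i <;> fin_cases j <;>
      simp [suMatrix, pauliX, pauliY, pauliZ]
    · linear_combination (((outPoly (-1) P.coeff L).eval (Real.sin (θ / 2)) : ℝ) : ℂ) * I_sq
    · linear_combination (-(((outPoly (-1) P.coeff L).eval (Real.sin (θ / 2)) : ℝ) : ℂ)) * I_sq

end CompositeGate

/-! ### The real outer factor and its normalization -/

namespace SpectralFactor

open Finset ComplexConjugate

/-- Heron's iteration for `√κ`, started at `2`. -/
noncomputable def heron (κ : ℝ) : ℕ → ℝ
  | 0 => 2
  | i + 1 => (heron κ i + κ / heron κ i) / 2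

/-- Each step of Heron's iteration at least halves the error, uniformly in `κ`, however small it is.
-/
theorem heron_bound {κ : ℝ} (h0 : 0 ≤ κ) (h4 : κ ≤ 4) (i : ℕ) :
    0 < heron κ i ∧ √κ ≤ heron κ i ∧ heron κ i - √κ ≤ 2 / 2 ^ i := by
  have hq := Real.sq_sqrt h0
  have hs := Real.sqrt_nonneg κ
  induction i with
  | zero =>
    refine ⟨by simp [heron], ?_, by simp [heron]⟩
    rw [heron, Real.sqrt_le_left (by norm_num)]; linarith
  | succ i ih =>
    obtain ⟨h1, h2, h3⟩ := ih
    rw [heron]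
    set x := heron κ i
    have e : (x + κ / x) / 2 - √κ = (x - √κ) ^ 2 / (2 * x) := by
      field_simp; linear_combination (-1 : ℝ) * hq
    have h5 : (x - √κ) ^ 2 / (2 * x) ≤ (x - √κ) / 2 := by
      rw [div_le_iff₀ (by positivity)]; nlinarith
    have h6 : (2 : ℝ) / 2 ^ (i + 1) = 2 / 2 ^ i / 2 := by rw [pow_succ]; field_simp
    refine ⟨by positivity, ?_, ?_⟩
    · have : 0 ≤ (x - √κ) ^ 2 / (2 * x) := by positivity
      linarith
    · rw [h6]; linarith

/-- Perturbation of `√c o = (c o) / c * √c`. -/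
theorem abs_div_mul_sub_le {c κ η T ε x o σ : ℝ} (hc : 0 < c) (hc1 : c ≤ 1) (hκ : c ≤ κ)
    (hκ' : κ ≤ c * (1 + η ^ 2)) (hη : 0 ≤ η) (hη1 : η ≤ 1) (hx : |x - c * o| ≤ c * (T * η))
    (ho : |o| ≤ T) (hσ : |σ - √κ| ≤ ε) : |x / κ * σ - √c * o| ≤ 2 * T * η + 2 * T * ε := by
  have hκ0 : 0 < κ := hc.trans_le hκ
  have hT : 0 ≤ T := (abs_nonneg o).trans ho
  have hb2 := Real.sq_sqrt hκ0.le
  have ha2 := Real.sq_sqrt hc.le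
  have hab : √c ≤ √κ := Real.sqrt_le_sqrt hκ
  have ha0 : 0 < √c := Real.sqrt_pos.2 hc
  have hb0 : 0 < √κ := Real.sqrt_pos.2 hκ0
  have ha1 : √c ≤ 1 := Real.sqrt_le_one.2 hc1
  set a := √c
  set b := √κ
  have e : x / κ * σ - a * o = x / κ * (σ - b) + (x - c * o) / b - o * (a - c / b) := by
    rw [← hb2]; field_simp; ring
  have hxc : |x| ≤ c * (2 * T) := by
    have h1 : |x| ≤ |x - c * o| + |c * o| := by
      have := abs_add_le (x - c * o) (c * o); simpa using this
    rw [abs_mul c, abs_of_pos hc] at h1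
    have h2 : c * |o| ≤ c * T := by gcongr
    have h3 : c * (T * η) ≤ c * (T * 1) := by gcongr
    linarith
  have t1 : |x / κ * (σ - b)| ≤ 2 * T * ε := by
    rw [abs_mul, abs_div, abs_of_pos hκ0]
    refine mul_le_mul ?_ hσ (abs_nonneg _) (by positivity)
    rw [div_le_iff₀ hκ0]
    calc |x| ≤ c * (2 * T) := hxc
      _ ≤ κ * (2 * T) := by gcongr
      _ = 2 * T * κ := mul_comm _ _
  have t2 : |(x - c * o) / b| ≤ T * η := by
    rw [abs_div, abs_of_pos hb0, div_le_iff₀ hb0]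
    refine hx.trans ?_
    have : c ≤ b := by nlinarith
    nlinarith [mul_nonneg hT hη]
  have t3 : |o * (a - c / b)| ≤ T * η := by
    rw [abs_mul]
    have e2 : a - c / b = a * (b - a) / b := by rw [← ha2]; field_simp
    have h1 : 0 ≤ a * (b - a) / b := by
      have : 0 ≤ b - a := by linarith
      positivity
    have h2 : b - a ≤ η := by
      by_contra! hlt
      have : a ^ 2 * η ^ 2 < (b - a) * (b + a) := by nlinarith
      nlinarith
    have h3 : a * (b - a) / b ≤ η := by
      rw [div_le_iff₀ hb0]; nlinarith
    rw [e2, abs_of_nonneg h1]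
    exact mul_le_mul ho h3 h1 hT
  rw [e]
  calc _ ≤ |x / κ * (σ - b)| + |(x - c * o) / b| + |o * (a - c / b)| :=
        (abs_sub _ _).trans (add_le_add (abs_add_le _ _) le_rfl)
    _ ≤ _ := by linarith

/-- For `f = 0` every quotient is `0 / 0 = 0`, and the iteration stays at `0`. -/
theorem doubling_zero (M r : ℕ) : doubling (fun _ => 0) M r = fun _ _ => 0 := by
  induction r with
  | zero => funext i j; simp [doubling, chain, toeplitz]
  | succ r ih =>
    have h : ∀ k, pivots M (glue M fun _ _ => 0) k = fun _ _ => 0 := by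
      intro k
      induction k with
      | zero => funext i j; simp [pivots, glue]
      | succ k ih => funext i j; simp [pivots, pivot, ih]
    funext i j
    simp [doubling, double, ih, h]

end SpectralFactor

namespace CompositeGate

open Finset ComplexConjugate SpectralFactor

theorem gapPoly_natDegree (A C : ℝ[X]) {L : ℕ} (hL : Odd L) :
    (gapPoly A C L).natDegree ≤ 2 * L := by
  have h1 : ∀ (s : ℝ) (a : ℕ → ℝ), (lift s a L ^ 2).natDegree ≤ 2 * L := fun s a =>
    natDegree_pow_le_of_le 2 (lift_natDegree s a hL)
  exact natDegree_add_le_of_degree_le (natDegree_sub_le_max_of_le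
    ((natDegree_X_pow_le L).trans (by omega)) (h1 _ _)) (h1 _ _)

/-- On the circle, `z⁻ᴸ F (z)` is `1 - A² - C²`. -/
theorem gapPoly_circleNonneg {A C : ℝ[X]} {L : ℕ} (hL : Odd L) (hA : IsOddPolynomial A)
    (hC : IsOddPolynomial C) (hdA : A.natDegree ≤ L) (hdC : C.natDegree ≤ L)
    (h : ∀ θ : ℝ, A.eval (Real.cos (θ / 2)) ^ 2 + C.eval (Real.sin (θ / 2)) ^ 2 ≤ 1) :
    CircleNonneg L ((gapPoly A C L).map (algebraMap ℝ ℂ)) := by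
  intro z hz
  obtain ⟨θ, rfl⟩ : ∃ θ : ℝ, Complex.exp (Complex.I * ((θ / 2 : ℝ) : ℂ)) ^ 2 = z := by
    refine ⟨z.arg, ?_⟩
    have := Complex.norm_mul_exp_arg_mul_I z
    rw [hz, Complex.ofReal_one, one_mul] at this
    rw [← Complex.exp_nat_mul]
    refine Eq.trans ?_ this
    congr 1
    push_cast; ring
  have v1 := (trigPoint_cos (θ / 2)).lift_eval hA hL hdA
  have v2 := (trigPoint_sin (θ / 2)).lift_eval hC hL hdC
  rw [aeval_ofReal] at v1 v2
  set w := Complex.exp (Complex.I * ((θ / 2 : ℝ) : ℂ)) with hw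
  have hw0 : w ≠ 0 := Complex.exp_ne_zero _
  have e : ((gapPoly A C L).map (algebraMap ℝ ℂ)).eval (w ^ 2) * conj (w ^ 2) ^ L =
      ((1 - (A.eval (Real.cos (θ / 2)) ^ 2 + C.eval (Real.sin (θ / 2)) ^ 2) : ℝ) : ℂ) := by
    rw [conj_eq_inv_of_norm_eq_one hz, eval_map_algebraMap, gapPoly]
    simp only [map_add, map_sub, map_pow, aeval_X, v1, v2]
    have hwL : (w ^ 2)⁻¹ ^ L * (w ^ L) ^ 2 = 1 := by
      rw [pow_right_comm, ← mul_pow, inv_mul_cancel₀ (pow_ne_zero _ hw0), one_pow]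
    rw [pow_right_comm w 2 L]
    push_cast
    linear_combination (1 - ((Polynomial.eval (Real.cos (θ / 2)) A : ℝ) : ℂ) ^ 2 -
      ((Polynomial.eval (Real.sin (θ / 2)) C : ℝ) : ℂ) ^ 2) * hwL +
      (w ^ 2)⁻¹ ^ L * (w ^ L) ^ 2 * ((Polynomial.eval (Real.sin (θ / 2)) C : ℝ) : ℂ) ^ 2 *
        Complex.I_sq
  rw [e, Complex.ofReal_re, Complex.ofReal_im]
  exact ⟨by linarith [h θ], rfl⟩

/-- The middle coefficient of the square of a polynomial with symmetric or antisymmetric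
coefficients is `±` the sum of their squares. -/
theorem coeff_sq_of_reflect {p : ℝ[X]} {L : ℕ} {s : ℝ} (h : reflect L p = C s * p) :
    ∃ t, 0 ≤ t ∧ (p ^ 2).coeff L = s * t := by
  refine ⟨∑ k ∈ range (L + 1), p.coeff k ^ 2, sum_nonneg fun _ _ => sq_nonneg _, ?_⟩
  rw [sq, coeff_mul, Finset.Nat.sum_antidiagonal_eq_sum_range_succ fun i j =>
    p.coeff i * p.coeff j, mul_sum]
  refine sum_congr rfl fun k hk => ?_
  have h1 := congrArg (fun q => q.coeff k) h
  have hk' := mem_range.1 hk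
  simp only [coeff_C_mul, coeff_reflect] at h1
  rw [revAt_le (by omega)] at h1
  rw [h1]; ring

/-- The mean value of `1 - A² - C²` over the circle is at most `1`. It bounds the constant `c` of
the Fejér–Riesz factorization. -/
theorem gapPoly_coeff_le {A C : ℝ[X]} {L : ℕ} (hL : Odd L) (hA : IsOddPolynomial A)
    (hC : IsOddPolynomial C) (hdA : A.natDegree ≤ L) (hdC : C.natDegree ≤ L) :
    (gapPoly A C L).coeff L ≤ 1 := by
  obtain ⟨t, ht, h1⟩ := coeff_sq_of_reflect
    (reflect_lift (s := 1) (κ := 1) (by norm_num) (by norm_num) hA hL hdA)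
  obtain ⟨t', ht', h2⟩ := coeff_sq_of_reflect
    (reflect_lift (s := -1) (κ := Complex.I) (by norm_num) (by simp) hC hL hdC)
  rw [gapPoly, coeff_add, coeff_sub, coeff_X_pow, if_pos rfl, h1, h2]
  linarith

/-- The outer factor of the gap polynomial is real, and the doubling iteration, followed by Heron's
iteration for its normalization, computes it. -/
theorem exists_factor {A C : ℝ[X]} {L : ℕ} (hL : Odd L) (hA : IsOddPolynomial A)
    (hC : IsOddPolynomial C) (hdA : A.natDegree ≤ L) (hdC : C.natDegree ≤ L)
    (h : ∀ θ : ℝ, A.eval (Real.cos (θ / 2)) ^ 2 + C.eval (Real.sin (θ / 2)) ^ 2 ≤ 1)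
    {f : ℕ → ℝ} (hf : ∀ d, f d = (gapPoly A C L).coeff (L + d)) :
    ∃ P : ℝ[X], P.natDegree ≤ L ∧ gapPoly A C L = P * reflect L P ∧
      ∀ r, L ≤ r → ∀ S, S = doubling f (L + 1) (2 * r) → ∀ j ≤ L,
        |S L (L - j) / S L L * heron (S L L) (2 * r) - P.coeff j| ≤ 8 * 4 ^ L / 2 ^ r := by
  set F := gapPoly A C L with hF
  set ι := algebraMap ℝ ℂ with hι
  have hFd : F.natDegree ≤ 2 * L := gapPoly_natDegree A C hL
  have hGd : (F.map ι).natDegree ≤ 2 * L := natDegree_map_le.trans hFd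
  have hG := gapPoly_circleNonneg hL hA hC hdA hdC h
  rw [← hF, ← hι] at hG
  obtain ⟨c, bs, hc0, hlen, hb, hfac⟩ := fejer_riesz L (F.map ι) hGd hG
  set O := outerPoly bs with hO
  have hOd : O.natDegree ≤ L := by rw [← hlen]; exact outerPoly_natDegree bs
  have hGO : F.map ι = Polynomial.C (c : ℂ) * (O * reflect L (O.map (starRingEnd ℂ))) := by
    refine eq_of_eval_circle fun z hz => ?_
    have hz0 : z ≠ 0 := by rintro rfl; simp at hz
    have h1 := hfac z hz
    rw [eval_mul, eval_C, eval_mul, eval_reflect (natDegree_map_le.trans hOd) hz0, eval_map_conj,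
      ← conj_eq_inv_of_norm_eq_one hz, Complex.conj_conj]
    have h2 : conj z ^ L * z ^ L = 1 := by
      rw [← mul_pow, conj_eq_inv_of_norm_eq_one hz, inv_mul_cancel₀ hz0, one_pow]
    push_cast at h1
    rw [← Complex.mul_conj'] at h1
    linear_combination z ^ L * h1 - (F.map ι).eval z * h2
  have hsymm : ∀ d ≤ L, F.coeff (L - d) = F.coeff (L + d) := fun d hd => by
    have h1 := congrArg (fun p => p.coeff (L - d)) (hG.reflect_eq hGd)
    simp only [coeff_reflect, coeff_map] at h1
    rw [revAt_le (by omega), show 2 * L - (L - d) = L + d by omega] at h1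
    simp only [hι, Complex.coe_algebraMap, Complex.conj_ofReal] at h1
    exact_mod_cast h1.symm
  have hauto : IsAutocorrelation L O c f := by
    refine ⟨hOd, fun d => ?_, fun d hd => ?_⟩
    · rw [← hGO, coeff_map, hf]; rfl
    · rw [← hGO, coeff_map, hf, hsymm d hd]; rfl
  rcases hc0.eq_or_lt with rfl | hc
  · -- `F = 0`, where the factor is `0` and the iteration divides `0` by `0`, with the value `0`
    have hF0 : F = 0 := by
      rw [Complex.ofReal_zero, C_0, zero_mul] at hGO
      exact (Polynomial.map_eq_zero ι).1 hGO
    have hf0 : f = fun _ => 0 := by funext d; rw [hf, hF0, coeff_zero]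
    refine ⟨0, by simp, by simp [hF0], fun r hr S hS j hj => ?_⟩
    rw [hS, hf0, doubling_zero]
    simp only [zero_div, zero_mul, coeff_zero, sub_zero, abs_zero]
    positivity
  · have hc1 : c ≤ 1 := by
      refine le_trans ?_ (gapPoly_coeff_le hL hA hC hdA hdC)
      have h1 := congrArg (fun p => p.coeff L) hGO
      simp only [coeff_C_mul, coeff_map] at h1
      rw [coeff_mul_reflect_conj, ← Complex.ofReal_mul] at h1
      have h2 : F.coeff L = c * ∑ n ∈ range (L + 1), ‖O.coeff n‖ ^ 2 := Complex.ofReal_injective h1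
      have h3 := single_le_sum (f := fun n => ‖O.coeff n‖ ^ 2) (s := range (L + 1)) (a := 0)
        (fun _ _ => by positivity) (mem_range.2 (by omega))
      simp only [hO, outerPoly_coeff_zero, norm_one, one_pow] at h3
      rw [← hF, h2]
      exact le_mul_of_one_le_right hc.le h3
    have hpos := hauto.quad_pos hc (outerPoly_ne_zero bs)
    have happrox : ∀ r, L ≤ r → ∀ S, S = doubling f (L + 1) (2 * r) → c ≤ S L L ∧
        S L L ≤ c * (1 + (2 ^ L / 2 ^ r) ^ 2) ∧ ∀ i ≤ L,
        ‖(S L i : ℂ) - c * conj (O.coeff (L - i))‖ ≤ c * (2 ^ L * (2 ^ L / 2 ^ r)) := by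
      rintro r hr S rfl
      refine (isChainMin_doubling (fun d hd => hauto.eq_zero hd) hpos (2 * r)).last_row_approx hb
        hlen hc hauto (by positivity) (by positivity) (le_of_eq ?_)
      push_cast
      rw [div_pow, ← pow_mul, ← pow_mul, mul_comm L, mul_comm r, pow_mul, pow_mul]; norm_num
    -- the coefficients of the outer factor are limits of the real numbers `S L i / c`
    have hreal : ∀ j ≤ L, (O.coeff j).im = 0 := by
      intro j hj
      have h1 : ∀ r, L ≤ r → |(O.coeff j).im| ≤ 4 ^ L / 2 ^ r := by
        intro r hr
        have h2 := (happrox r hr _ rfl).2.2 (L - j) (by omega)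
        rw [show L - (L - j) = j by omega] at h2
        have h3 := (Complex.abs_im_le_norm _).trans h2
        rw [Complex.sub_im, Complex.ofReal_im, Complex.im_ofReal_mul, Complex.conj_im, zero_sub,
          mul_neg, neg_neg, abs_mul, abs_of_pos hc] at h3
        refine (le_of_mul_le_mul_left h3 hc).trans (le_of_eq ?_)
        rw [← mul_div_assoc, ← mul_pow]; norm_num
      refine abs_eq_zero.1 (le_antisymm (le_of_forall_pos_le_add fun ε hε => ?_) (abs_nonneg _))
      obtain ⟨n, hn⟩ := exists_pow_lt_of_lt_one (show 0 < ε / 4 ^ L by positivity)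
        (show (1 / 2 : ℝ) < 1 by norm_num)
      refine (h1 (L + n) (by omega)).trans ?_
      rw [lt_div_iff₀ (by positivity)] at hn
      have h2 : (4 : ℝ) ^ L / 2 ^ (L + n) ≤ 4 ^ L / 2 ^ n := by
        gcongr
        · norm_num
        · omega
      have h3 : (4 : ℝ) ^ L / 2 ^ n = (1 / 2) ^ n * 4 ^ L := by
        rw [one_div, inv_pow]; field_simp
      linarith
    set P : ℝ[X] := ∑ j ∈ range (L + 1), monomial j (√c * (O.coeff j).re) with hP
    have hPc : ∀ j, P.coeff j = if j ≤ L then √c * (O.coeff j).re else 0 := by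
      intro j
      rw [hP, finsetSum_coeff]
      simp only [coeff_monomial]
      rw [sum_ite_eq' (range (L + 1))]
      simp only [mem_range, Nat.lt_succ_iff]
    have hPO : P.map ι = Polynomial.C (√c : ℂ) * O := by
      ext j
      rw [coeff_map, coeff_C_mul, hPc]
      split_ifs with hj
      · refine Complex.ext ?_ ?_
        · simp [hι]
        · simp [hι, hreal j hj]
      · rw [coeff_eq_zero_of_natDegree_lt (by omega : O.natDegree < j)]; simp
    have hPd : P.natDegree ≤ L := natDegree_le_iff_coeff_eq_zero.2 fun n hn => by
      rw [hPc, if_neg (by omega)]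
    refine ⟨P, hPd, ?_, fun r hr S hS j hj => ?_⟩
    · refine map_injective ι ι.injective ?_
      have hOc : O.map (starRingEnd ℂ) = O := by
        ext j
        rw [coeff_map]
        rcases Nat.lt_or_ge L j with hj | hj
        · rw [coeff_eq_zero_of_natDegree_lt (by omega)]; simp
        · exact Complex.conj_eq_iff_im.2 (hreal j hj)
      rw [Polynomial.map_mul, ← reflect_map, hPO, reflect_C_mul, hGO, hOc]
      have : Polynomial.C (c : ℂ) = Polynomial.C (√c : ℂ) * Polynomial.C (√c : ℂ) := by
        rw [← C_mul, ← Complex.ofReal_mul, Real.mul_self_sqrt hc.le]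
      rw [this]; ring
    · obtain ⟨h1, h2, h3⟩ := happrox r hr S hS
      have hη1 : (2 : ℝ) ^ L / 2 ^ r ≤ 1 := by
        rw [div_le_one (by positivity)]
        exact pow_le_pow_right₀ (by norm_num) hr
      have hη0 : (0 : ℝ) ≤ 2 ^ L / 2 ^ r := by positivity
      have h4 := h3 (L - j) (by omega)
      rw [show L - (L - j) = j by omega] at h4
      have h5 := (Complex.abs_re_le_norm _).trans h4
      rw [Complex.sub_re, Complex.ofReal_re, Complex.re_ofReal_mul, Complex.conj_re] at h5
      have hκ4 : S L L ≤ 4 := by nlinarith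
      have hσ := heron_bound (hc.le.trans h1) hκ4 (2 * r)
      have h6 : |heron (S L L) (2 * r) - √(S L L)| ≤ 2 / 2 ^ r := by
        rw [abs_of_nonneg (by linarith [hσ.2.1])]
        refine hσ.2.2.trans ?_
        gcongr
        · norm_num
        · omega
      have h7 : |(O.coeff j).re| ≤ 2 ^ L := by
        refine (Complex.abs_re_le_norm _).trans ?_
        rw [← hlen]
        exact (outerPoly_l1Bound hb).coeff_le j
      have h8 := abs_div_mul_sub_le hc hc1 h1 h2 hη0 hη1 h5 h7 h6
      rw [hPc, if_pos hj]
      refine h8.trans ?_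
      rw [← mul_div_assoc, ← mul_div_assoc, ← add_div]
      gcongr
      have h9 : (1 : ℝ) ≤ 2 ^ L := one_le_pow₀ (by norm_num)
      have h10 : (4 : ℝ) ^ L = 2 ^ L * 2 ^ L := by rw [← mul_pow]; norm_num
      rw [h10]; nlinarith

end CompositeGate

/-! ### Statements of the array language -/

namespace RealRAM

open Finset

-- arithmetic notation for the constructors of expressions
instance : Add IExp := ⟨.add⟩
instance : Sub IExp := ⟨.sub⟩
instance : Mul IExp := ⟨.mul⟩
instance : Add RExp := ⟨.op .add⟩
instance : Sub RExp := ⟨.op .sub⟩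
instance : Mul RExp := ⟨.op .mul⟩
instance : Div RExp := ⟨.op .div⟩

section Eval

variable (ρ : Fin 16 → ℕ) (μ : Fin 16 → ℕ → ℝ)

@[simp] theorem IExp.eval_add (a b : IExp) : (a + b).eval ρ = a.eval ρ + b.eval ρ := rfl
@[simp] theorem IExp.eval_sub (a b : IExp) : (a - b).eval ρ = a.eval ρ - b.eval ρ := rfl
@[simp] theorem IExp.eval_mul (a b : IExp) : (a * b).eval ρ = a.eval ρ * b.eval ρ := rfl
@[simp] theorem RExp.eval_add (a b : RExp) : (a + b).eval ρ μ = a.eval ρ μ + b.eval ρ μ := rfl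
@[simp] theorem RExp.eval_sub (a b : RExp) : (a - b).eval ρ μ = a.eval ρ μ - b.eval ρ μ := rfl
@[simp] theorem RExp.eval_mul (a b : RExp) : (a * b).eval ρ μ = a.eval ρ μ * b.eval ρ μ := rfl
@[simp] theorem RExp.eval_div (a b : RExp) : (a / b).eval ρ μ = a.eval ρ μ / b.eval ρ μ := rfl

end Eval

/-- Assignment to the first `W` cells of an array; in cell `p` the variable `15` stands for `p`. -/
def Stmt.vec (a : Fin 16) (W : IExp) (e : RExp) : Stmt := .par a (.lit 1) W e

theorem Stmt.vec_run (a : Fin 16) (W : IExp) (e : RExp) (ρ : Fin 16 → ℕ) (μ : Fin 16 → ℕ → ℝ) :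
    (Stmt.vec a W e).run ρ μ = Function.update μ a fun p => if p < W.eval ρ then
      e.eval (Function.update (Function.update ρ 14 0) 15 p) μ else μ a p := by
  simp only [vec, run, IExp.eval, one_mul]
  congr 1
  funext p
  split_ifs with h
  · rw [Nat.div_eq_of_lt h, Nat.mod_eq_of_lt h]
  · rfl

theorem Stmt.par_run_apply (a : Fin 16) (N W : IExp) (e : RExp) (ρ : Fin 16 → ℕ)
    (μ : Fin 16 → ℕ → ℝ) {i j : ℕ} (hi : i < N.eval ρ) (hj : j < W.eval ρ) :
    (Stmt.par a N W e).run ρ μ a (i * W.eval ρ + j) =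
      e.eval (Function.update (Function.update ρ 14 i) 15 j) μ := by
  have h0 : 0 < W.eval ρ := by omega
  have h1 : i * W.eval ρ + j < N.eval ρ * W.eval ρ := by
    have := Nat.mul_le_mul_right (W.eval ρ) (show i + 1 ≤ N.eval ρ by omega)
    rw [add_mul, one_mul] at this
    omega
  simp only [run, Function.update_self, if_pos h1]
  rw [Nat.mul_comm i, Nat.mul_add_div h0, Nat.div_eq_of_lt hj, Nat.mul_add_mod,
    Nat.mod_eq_of_lt hj, Nat.add_zero]

/-- The arrays to which a statement assigns. -/
@[simp] def Stmt.Writes : Stmt → Fin 16 → Prop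
  | par a _ _ _, b => b = a
  | seq c₁ c₂, b => c₁.Writes b ∨ c₂.Writes b
  | loop _ _ c, b => c.Writes b

@[simp] theorem Stmt.vec_writes (a : Fin 16) (W : IExp) (e : RExp) (b : Fin 16) :
    (Stmt.vec a W e).Writes b ↔ b = a := Iff.rfl

/-- The rule for loops of the array language: `I` is an invariant. -/
theorem iter_induction {α : Type*} {F : ℕ → α → α} {I : ℕ → α → Prop} {x : α} (n : ℕ)
    (h0 : I 0 x) (h : ∀ k < n, ∀ y, I k y → I (k + 1) (F k y)) : I n (iter F x n) := by
  have : ∀ k ≤ n, I k (iter F x k) := by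
    intro k
    induction k with
    | zero => exact fun _ => h0
    | succ k ih => exact fun hk => h k (by omega) _ (ih (by omega))
  exact this n le_rfl

/-- A statement changes only the arrays to which it assigns. -/
theorem Stmt.run_of_not_writes {a : Fin 16} :
    ∀ (c : Stmt) (ρ : Fin 16 → ℕ) (μ : Fin 16 → ℕ → ℝ), ¬ c.Writes a → c.run ρ μ a = μ a := by
  intro c
  induction c with
  | par b N W e => exact fun ρ μ h => Function.update_of_ne h _ _
  | seq c₁ c₂ h₁ h₂ =>
    intro ρ μ h
    rw [Writes, not_or] at h
    rw [run, h₂ _ _ h.2, h₁ _ _ h.1]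
  | loop r N c ih =>
    intro ρ μ h
    exact iter_induction (I := fun _ (ν : Fin 16 → ℕ → ℝ) => ν a = μ a) _ rfl
      fun k _ ν hν => by rw [ih _ _ h, hν]

end RealRAM

namespace CompositeGate

open Finset SpectralFactor RealRAM

/-- The cell `p - k` of an array if `k ≤ p`, and `0` otherwise, where `p` is variable `15`. -/
def shifted (a : Fin 16) (k : ℕ) : RExp :=
  .ite (.var 15) (.lit k) (.lit 0) (.cell a (.var 15 - .lit k))

/-- A Kronecker delta in two index expressions, multiplied by a real expression. -/
def deltaMul (i j : IExp) (e : RExp) : RExp := .ite i j (.lit 0) (.ite j i (.lit 0) e)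

theorem deltaMul_eval (i j : IExp) (e : RExp) (ρ : Fin 16 → ℕ) (μ : Fin 16 → ℕ → ℝ) :
    (deltaMul i j e).eval ρ μ = if i.eval ρ = j.eval ρ then e.eval ρ μ else 0 := by
  simp only [deltaMul, RExp.eval, Rat.cast_zero]
  split_ifs <;> first | rfl | omega

theorem coeff_X_mul_ite (q : ℝ[X]) (p : ℕ) :
    (X * q).coeff p = if p < 1 then 0 else q.coeff (p - 1) := by
  rcases p with _ | p
  · simp
  · simp [coeff_X_mul]

theorem coeff_X_pow_mul_ite (q : ℝ[X]) (k p : ℕ) :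
    (X ^ k * q).coeff p = if p < k then 0 else q.coeff (p - k) := by
  rw [coeff_X_pow_mul']
  split_ifs <;> first | rfl | omega

/-! ### The program -/

/-- Computes `lift s` of the coefficients in array `src` into array `dst`. -/
def liftStmt (s : ℚ) (src dst : Fin 16) : Stmt :=
  .seq
    (.loop 2 (.half (.var 0) + .lit 1) (.vec dst (.var 0 + .lit 1)
      (.lit (s / 4) * .cell dst (.var 15) + .lit (1 / 2) * shifted dst 1 +
        .lit (s / 4) * shifted dst 2 +
        deltaMul (.var 2) (.var 15) (.cell src (.var 0 - .lit 2 * .var 2)))))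
    (.vec dst (.var 0 + .lit 1)
      (.lit (s / 2) * .cell dst (.var 15) + .lit (1 / 2) * shifted dst 1))

theorem liftStmt_run (s : ℚ) {src dst : Fin 16} (hsd : src ≠ dst) {ρ : Fin 16 → ℕ}
    {μ : Fin 16 → ℕ → ℝ} (hL : Odd (ρ 0)) (hμ : μ dst = 0) :
    (liftStmt s src dst).run ρ μ = Function.update μ dst (lift s (μ src) (ρ 0)).coeff := by
  obtain ⟨m, hm⟩ := hL
  have hloop : iter (fun k => (Stmt.vec dst (.var 0 + .lit 1)
      (.lit (s / 4) * .cell dst (.var 15) + .lit (1 / 2) * shifted dst 1 +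
        .lit (s / 4) * shifted dst 2 +
        deltaMul (.var 2) (.var 15) (.cell src (.var 0 - .lit 2 * .var 2)))).run
      (Function.update ρ 2 k)) μ (ρ 0 / 2 + 1) =
      Function.update μ dst (preLift s (μ src) (ρ 0) (ρ 0 / 2 + 1)).coeff := by
    refine iter_induction (I := fun k ν => ν = Function.update μ dst
      (preLift s (μ src) (ρ 0) k).coeff) _ ?_ ?_
    · rw [preLift]
      refine (Function.update_eq_self_iff.2 ?_).symm
      rw [hμ]; funext p; simp
    · rintro k hk _ rfl
      rw [Stmt.vec_run, Function.update_idem]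
      congr 1
      funext p
      have hd := preLift_natDegree s (μ src) (ρ 0) k
      split_ifs with hp
      · rw [preLift]
        simp [shifted, deltaMul_eval, Function.update_of_ne hsd, coeff_X_mul_ite,
          coeff_X_pow_mul_ite, coeff_monomial]
      · have hp' : ρ 0 + 1 ≤ p := by simpa using hp
        rw [coeff_eq_zero_of_natDegree_lt (p := preLift s (μ src) (ρ 0) (k + 1)) (by omega)]
        rcases k with _ | k
        · simp [preLift]
        · have := preLift_natDegree s (μ src) (ρ 0) k
          rw [Function.update_self, coeff_eq_zero_of_natDegree_lt (by omega)]
  have hd := lift_natDegree (s : ℝ) (μ src) ⟨m, hm⟩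
  have hd' := preLift_natDegree s (μ src) (ρ 0) (ρ 0 / 2)
  rw [liftStmt, Stmt.run, Stmt.run]
  simp only [IExp.eval]
  rw [hloop, Stmt.vec_run, Function.update_idem]
  congr 1
  funext p
  split_ifs with hp
  · simp [lift, shifted, coeff_X_mul_ite]
  · have hp' : ρ 0 + 1 ≤ p := by simpa using hp
    rw [Function.update_self, coeff_eq_zero_of_natDegree_lt (by omega),
      coeff_eq_zero_of_natDegree_lt (by omega)]

/-- Computes `X ^ L - h² + g²` into array `6`, from `h` in array `4` and `g` in array `5`. -/
def gapStmt : Stmt :=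
  .seq (.vec 6 (.lit 2 * .var 0 + .lit 1) (deltaMul (.var 15) (.var 0) (.lit 1)))
    (.loop 2 (.var 0 + .lit 1) (.vec 6 (.lit 2 * .var 0 + .lit 1)
      (.cell 6 (.var 15) + .ite (.var 15) (.var 2) (.lit 0)
        (.cell 5 (.var 2) * .cell 5 (.var 15 - .var 2) -
          .cell 4 (.var 2) * .cell 4 (.var 15 - .var 2)))))

theorem eq_sum_C_mul_X_pow {L : ℕ} {h : ℝ[X]} (hd : h.natDegree ≤ L) :
    h ^ 2 = ∑ j ∈ range (L + 1), C (h.coeff j) * (X ^ j * h) := by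
  conv_lhs => rw [sq]
  conv_lhs => enter [1]; rw [as_sum_range_C_mul_X_pow' h (show h.natDegree < L + 1 by omega)]
  rw [sum_mul]
  exact sum_congr rfl fun j _ => by ring

theorem gapStmt_run {ρ : Fin 16 → ℕ} {μ : Fin 16 → ℕ → ℝ} {g h : ℝ[X]} (hh : h.natDegree ≤ ρ 0)
    (hg : g.natDegree ≤ ρ 0) (h4 : μ 4 = h.coeff) (h5 : μ 5 = g.coeff) (h6 : μ 6 = 0) :
    gapStmt.run ρ μ = Function.update μ 6 (X ^ (ρ 0) - h ^ 2 + g ^ 2 : ℝ[X]).coeff := by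
  set G : ℕ → ℝ[X] := fun k => X ^ (ρ 0) + ∑ j ∈ range k,
    (C (g.coeff j) * (X ^ j * g) - C (h.coeff j) * (X ^ j * h)) with hG
  have hGd : ∀ k ≤ ρ 0 + 1, (G k).natDegree ≤ 2 * ρ 0 := by
    intro k hk
    refine natDegree_add_le_of_degree_le ((natDegree_X_pow_le _).trans (by omega))
      (natDegree_sum_le_of_forall_le _ _ fun j hj => ?_)
    have := mem_range.1 hj
    refine natDegree_sub_le_max_of_le ?_ ?_
    · exact (natDegree_C_mul_le _ _).trans
        ((natDegree_mul_le_of_le (natDegree_X_pow_le j) hg).trans (by omega))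
    · exact (natDegree_C_mul_le _ _).trans
        ((natDegree_mul_le_of_le (natDegree_X_pow_le j) hh).trans (by omega))
  have hend : (X ^ (ρ 0) - h ^ 2 + g ^ 2 : ℝ[X]) = G (ρ 0 + 1) := by
    rw [hG, eq_sum_C_mul_X_pow hh, eq_sum_C_mul_X_pow hg]
    simp only [sum_sub_distrib]; ring
  rw [gapStmt, Stmt.run, Stmt.run, hend]
  refine iter_induction (I := fun k ν => ν = Function.update μ 6 (G k).coeff) _ ?_ ?_
  · rw [Stmt.vec_run]
    congr 1
    funext p
    split_ifs with hp
    · simp [hG, deltaMul_eval, coeff_X_pow]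
    · have hp' : 2 * ρ 0 + 1 ≤ p := by simpa using hp
      rw [h6, coeff_eq_zero_of_natDegree_lt (by have := hGd 0 (by omega); omega)]; rfl
  · rintro k hk _ rfl
    have hk' : k < ρ 0 + 1 := by simpa using hk
    rw [Stmt.vec_run, Function.update_idem]
    congr 1
    funext p
    have hGk : G (k + 1) = G k + (C (g.coeff k) * (X ^ k * g) - C (h.coeff k) * (X ^ k * h)) := by
      simp only [hG, sum_range_succ, add_assoc]
    split_ifs with hp
    · rw [hGk]
      simp [coeff_X_pow_mul_ite, h4, h5]
      split_ifs <;> simp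
    · have hp' : 2 * ρ 0 + 1 ≤ p := by simpa using hp
      rw [Function.update_self, coeff_eq_zero_of_natDegree_lt (by have := hGd k (by omega); omega),
        coeff_eq_zero_of_natDegree_lt (by have := hGd (k + 1) (by omega); omega)]

end CompositeGate

/-! ### The matrix iteration and the output -/

namespace CompositeGate

open Finset SpectralFactor RealRAM

/-- Array `v` holds, row by row, the leading `K × K` block of the matrix `S`. -/
def HoldsMatrix (v : ℕ → ℝ) (K : ℕ) (S : ℕ → ℕ → ℝ) : Prop :=
  ∀ i < K, ∀ j < K, v (i * K + j) = S i j

theorem holdsMatrix_par {a : Fin 16} {W : IExp} {e : RExp} {ρ : Fin 16 → ℕ}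
    {μ : Fin 16 → ℕ → ℝ} {K : ℕ} {S : ℕ → ℕ → ℝ} (hW : W.eval ρ = K)
    (h : ∀ i < K, ∀ j < K,
      e.eval (Function.update (Function.update ρ 14 i) 15 j) μ = S i j) :
    HoldsMatrix ((Stmt.par a W W e).run ρ μ a) K S := by
  subst hW
  intro i hi j hj
  rw [Stmt.par_run_apply a W W e ρ μ hi hj, h i hi j hj]

/-- The number of variables in a block. -/
def blockSize : IExp := .var 0 + .lit 1

/-- The entry of the matrix in array `7`, of size `2 M`. -/
def formEntry (i j : IExp) : RExp := .cell 7 (i * (.lit 2 * blockSize) + j)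

/-- The entry of the matrix in array `8`, of size `3 M`. -/
def gluedEntry (i j : IExp) : RExp := .cell 8 (i * (.lit 3 * blockSize) + j)

theorem formEntry_eval {ρ' : Fin 16 → ℕ} {μ : Fin 16 → ℕ → ℝ} {M : ℕ} {S : ℕ → ℕ → ℝ}
    (h : HoldsMatrix (μ 7) (2 * M) S) (hM : ρ' 0 + 1 = M) {i j : IExp} (hi : i.eval ρ' < 2 * M)
    (hj : j.eval ρ' < 2 * M) : (formEntry i j).eval ρ' μ = S (i.eval ρ') (j.eval ρ') := by
  rw [← h _ hi _ hj]
  simp [formEntry, blockSize, hM]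

theorem gluedEntry_eval {ρ' : Fin 16 → ℕ} {μ : Fin 16 → ℕ → ℝ} {M : ℕ} {S : ℕ → ℕ → ℝ}
    (h : HoldsMatrix (μ 8) (3 * M) S) (hM : ρ' 0 + 1 = M) {i j : IExp} (hi : i.eval ρ' < 3 * M)
    (hj : j.eval ρ' < 3 * M) : (gluedEntry i j).eval ρ' μ = S (i.eval ρ') (j.eval ρ') := by
  rw [← h _ hi _ hj]
  simp [gluedEntry, blockSize, hM]

/-- Computes `chain f M` into array `7`, where `f d` is cell `L + d` of array `6`. -/
def chainStmt : Stmt :=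
  .par 7 (.lit 2 * blockSize) (.lit 2 * blockSize)
    (.ite (.var 14) blockSize
      (.cell 6 (.var 0 + ((.var 14 - .var 15) + (.var 15 - .var 14))))
      (.ite (.var 15) blockSize
        (.cell 6 (.var 0 + ((.var 14 - .var 15) + (.var 15 - .var 14)))) (.lit 0)))

theorem chainStmt_run {ρ : Fin 16 → ℕ} {μ : Fin 16 → ℕ → ℝ} {f : ℕ → ℝ}
    (hf : ∀ d, f d = μ 6 (ρ 0 + d)) :
    HoldsMatrix (chainStmt.run ρ μ 7) (2 * (ρ 0 + 1)) (chain f (ρ 0 + 1)) := by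
  refine holdsMatrix_par (by simp [blockSize]) fun i hi j hj => ?_
  simp only [RExp.eval, IExp.eval_add, IExp.eval_sub, IExp.eval, blockSize, Function.update_self,
    chain, toeplitz, hf]
  simp only [ne_eq, Fin.reduceEq, not_false_eq_true, Function.update_of_ne, Function.update_self]
  split_ifs <;> first | rfl | (exfalso; omega) | simp

/-- Computes `glue M S` into array `8`. -/
def glueStmt : Stmt :=
  .par 8 (.lit 3 * blockSize) (.lit 3 * blockSize)
    (.ite (.var 14) (.lit 2 * blockSize)
      (.ite (.var 15) (.lit 2 * blockSize) (formEntry (.var 14) (.var 15)) (.lit 0)) (.lit 0) +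
    .ite (.var 14) blockSize (.lit 0)
      (.ite (.var 15) blockSize (.lit 0)
        (formEntry (.var 14 - blockSize) (.var 15 - blockSize))))

theorem glueStmt_run {ρ : Fin 16 → ℕ} {μ : Fin 16 → ℕ → ℝ} {S : ℕ → ℕ → ℝ}
    (h : HoldsMatrix (μ 7) (2 * (ρ 0 + 1)) S) :
    HoldsMatrix (glueStmt.run ρ μ 8) (3 * (ρ 0 + 1)) (glue (ρ 0 + 1) S) := by
  refine holdsMatrix_par (by simp [blockSize]) fun i hi j hj => ?_
  set ρ' := Function.update (Function.update ρ 14 i) 15 j with hρ'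
  have h0 : ρ' 0 = ρ 0 := by simp [hρ']
  have h14 : ρ' 14 = i := by simp [hρ']
  have h15 : ρ' 15 = j := by simp [hρ']
  simp only [RExp.eval, IExp.eval_add, IExp.eval, blockSize, h0, h14, h15, glue, Rat.cast_zero]
  have e1 : (if i < 2 * (ρ 0 + 1) then if j < 2 * (ρ 0 + 1) then
      (formEntry (.var 14) (.var 15)).eval ρ' μ else 0 else 0) =
      if i < 2 * (ρ 0 + 1) ∧ j < 2 * (ρ 0 + 1) then S i j else 0 := by
    by_cases hi : i < 2 * (ρ 0 + 1)
    · by_cases hj : j < 2 * (ρ 0 + 1)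
      · rw [if_pos hi, if_pos hj, if_pos ⟨hi, hj⟩, formEntry_eval h (by rw [h0])
          (by simpa [h14]) (by simpa [h15])]
        simp [h14, h15]
      · simp [hj]
    · simp [hi]
  have e2 : (if i < ρ 0 + 1 then 0 else if j < ρ 0 + 1 then 0 else
      (formEntry (.var 14 - (.var 0 + .lit 1)) (.var 15 - (.var 0 + .lit 1))).eval ρ' μ) =
      if ρ 0 + 1 ≤ i ∧ ρ 0 + 1 ≤ j then S (i - (ρ 0 + 1)) (j - (ρ 0 + 1)) else 0 := by
    by_cases hi : i < ρ 0 + 1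
    · rw [if_pos hi, if_neg (by omega)]
    · by_cases hj : j < ρ 0 + 1
      · rw [if_neg hi, if_pos hj, if_neg (by omega)]
      · rw [if_neg hi, if_neg hj, if_pos (by omega), formEntry_eval h (by rw [h0])
          (by simp [h14, h0]; omega) (by simp [h15, h0]; omega)]
        simp [h14, h15, h0]
  rw [e1, e2]
  rfl

/-- Eliminates the variables of the middle block from the form in array `8`. -/
def pivotsStmt : Stmt :=
  .loop 3 blockSize (.par 8 (.lit 3 * blockSize) (.lit 3 * blockSize)
    (gluedEntry (.var 14) (.var 15) -
      gluedEntry (.var 14) (blockSize + .var 3) * gluedEntry (blockSize + .var 3) (.var 15) /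
        gluedEntry (blockSize + .var 3) (blockSize + .var 3)))

theorem pivotsStmt_run {ρ : Fin 16 → ℕ} {μ : Fin 16 → ℕ → ℝ} {W : ℕ → ℕ → ℝ}
    (h : HoldsMatrix (μ 8) (3 * (ρ 0 + 1)) W) :
    HoldsMatrix (pivotsStmt.run ρ μ 8) (3 * (ρ 0 + 1)) (pivots (ρ 0 + 1) W (ρ 0 + 1)) := by
  rw [pivotsStmt, Stmt.run]
  have hb : blockSize.eval ρ = ρ 0 + 1 := by simp [blockSize]
  rw [hb]
  refine iter_induction (I := fun k (ν : Fin 16 → ℕ → ℝ) =>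
    HoldsMatrix (ν 8) (3 * (ρ 0 + 1)) (pivots (ρ 0 + 1) W k)) _ h fun k hk ν hν => ?_
  refine holdsMatrix_par (by simp [blockSize]) fun i hi j hj => ?_
  set ρ' := Function.update (Function.update (Function.update ρ 3 k) 14 i) 15 j with hρ'
  have h0 : ρ' 0 = ρ 0 := by simp [hρ']
  have h3 : ρ' 3 = k := by simp [hρ']
  have h14 : ρ' 14 = i := by simp [hρ']
  have h15 : ρ' 15 = j := by simp [hρ']
  have e14 : (IExp.var 14).eval ρ' = i := h14
  have e15 : (IExp.var 15).eval ρ' = j := h15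
  have e3 : (blockSize + IExp.var 3).eval ρ' = ρ 0 + 1 + k := by simp [blockSize, h0, h3]
  have hM : ρ' 0 + 1 = ρ 0 + 1 := by rw [h0]
  simp only [RExp.eval_sub, RExp.eval_div, RExp.eval_mul]
  rw [gluedEntry_eval hν hM (by omega) (by omega), gluedEntry_eval hν hM (by omega) (by omega),
    gluedEntry_eval hν hM (by omega) (by omega), gluedEntry_eval hν hM (by omega) (by omega),
    e14, e15, e3]
  rfl

/-- Copies the first and the last block of the form in array `8` to array `7`. -/
def selectStmt : Stmt :=
  .par 7 (.lit 2 * blockSize) (.lit 2 * blockSize)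
    (.ite (.var 14) blockSize
      (.ite (.var 15) blockSize (gluedEntry (.var 14) (.var 15))
        (gluedEntry (.var 14) (.var 15 + blockSize)))
      (.ite (.var 15) blockSize (gluedEntry (.var 14 + blockSize) (.var 15))
        (gluedEntry (.var 14 + blockSize) (.var 15 + blockSize))))

theorem selectStmt_run {ρ : Fin 16 → ℕ} {μ : Fin 16 → ℕ → ℝ} {W : ℕ → ℕ → ℝ}
    (h : HoldsMatrix (μ 8) (3 * (ρ 0 + 1)) W) :
    HoldsMatrix (selectStmt.run ρ μ 7) (2 * (ρ 0 + 1)) fun i j =>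
      W (if i < ρ 0 + 1 then i else i + (ρ 0 + 1)) (if j < ρ 0 + 1 then j else j + (ρ 0 + 1)) := by
  refine holdsMatrix_par (by simp [blockSize]) fun i hi j hj => ?_
  set ρ' := Function.update (Function.update ρ 14 i) 15 j with hρ'
  have h0 : ρ' 0 = ρ 0 := by simp [hρ']
  have e14 : (IExp.var 14).eval ρ' = i := by simp [hρ']
  have e15 : (IExp.var 15).eval ρ' = j := by simp [hρ']
  have eb : blockSize.eval ρ' = ρ 0 + 1 := by simp [blockSize, h0]
  have hM : ρ' 0 + 1 = ρ 0 + 1 := by rw [h0]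
  simp only [RExp.eval]
  rw [e14, e15, eb]
  split_ifs <;> rw [gluedEntry_eval h hM (by simp only [IExp.eval_add, e14, eb]; omega)
    (by simp only [IExp.eval_add, e15, eb]; omega)] <;>
    simp only [IExp.eval_add, e14, e15, eb]

/-- The doubling iteration, `R` times. -/
def doublingStmt (R : IExp) : Stmt :=
  .seq chainStmt (.loop 2 R (.seq glueStmt (.seq pivotsStmt selectStmt)))

theorem doublingStmt_run (R : IExp) {ρ : Fin 16 → ℕ} {μ : Fin 16 → ℕ → ℝ} {f : ℕ → ℝ}
    (hf : ∀ d, f d = μ 6 (ρ 0 + d)) :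
    HoldsMatrix ((doublingStmt R).run ρ μ 7) (2 * (ρ 0 + 1)) (doubling f (ρ 0 + 1) (R.eval ρ)) := by
  rw [doublingStmt, Stmt.run, Stmt.run]
  refine iter_induction (I := fun k (ν : Fin 16 → ℕ → ℝ) =>
    HoldsMatrix (ν 7) (2 * (ρ 0 + 1)) (doubling f (ρ 0 + 1) k)) _ (chainStmt_run hf)
    fun k hk ν hν => ?_
  rw [Stmt.run, Stmt.run]
  have hρ : Function.update ρ 2 k 0 = ρ 0 := by simp
  have h1 := glueStmt_run (ρ := Function.update ρ 2 k) (by rwa [hρ])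
  have h2 := selectStmt_run (pivotsStmt_run h1)
  rw [hρ] at h2
  exact h2

/-- Heron's iteration for the square root of the last diagonal entry of the first block, `R` times,
in cell `0` of array `9`. -/
def heronStmt (R : IExp) : Stmt :=
  .seq (.vec 9 (.lit 1) (.lit 2)) (.loop 2 R (.vec 9 (.lit 1)
    ((.cell 9 (.lit 0) + formEntry (.var 0) (.var 0) / .cell 9 (.lit 0)) / .lit 2)))

theorem heronStmt_run (R : IExp) {ρ : Fin 16 → ℕ} {μ : Fin 16 → ℕ → ℝ} {S : ℕ → ℕ → ℝ}
    (h : HoldsMatrix (μ 7) (2 * (ρ 0 + 1)) S) :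
    (heronStmt R).run ρ μ 9 0 = heron (S (ρ 0) (ρ 0)) (R.eval ρ) := by
  rw [heronStmt, Stmt.run, Stmt.run]
  refine (iter_induction (I := fun k (ν : Fin 16 → ℕ → ℝ) =>
    HoldsMatrix (ν 7) (2 * (ρ 0 + 1)) S ∧ ν 9 0 = heron (S (ρ 0) (ρ 0)) k) _ ?_ ?_).2
  · rw [Stmt.vec_run]
    exact ⟨by simpa using h, by simp [heron]⟩
  · rintro k hk ν ⟨h1, h2⟩
    rw [Stmt.vec_run]
    refine ⟨by simpa using h1, ?_⟩
    rw [Function.update_self, IExp.eval, if_pos one_pos]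
    simp only [RExp.eval_div, RExp.eval_add]
    rw [formEntry_eval h1 (by simp) (by simp; omega) (by simp; omega)]
    simp [h2, heron]

/-- Computes the normalized outer factor into array `10`. -/
def factorStmt : Stmt :=
  .vec 10 (.var 0 + .lit 1) (formEntry (.var 0) (.var 0 - .var 15) / formEntry (.var 0) (.var 0) *
    .cell 9 (.lit 0))

theorem factorStmt_run {ρ : Fin 16 → ℕ} {μ : Fin 16 → ℕ → ℝ} {S : ℕ → ℕ → ℝ}
    (h : HoldsMatrix (μ 7) (2 * (ρ 0 + 1)) S) {j : ℕ} (hj : j ≤ ρ 0) :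
    factorStmt.run ρ μ 10 j = S (ρ 0) (ρ 0 - j) / S (ρ 0) (ρ 0) * μ 9 0 := by
  rw [factorStmt, Stmt.vec_run, Function.update_self, if_pos (by simpa using Nat.lt_succ_of_le hj)]
  simp only [RExp.eval_div, RExp.eval_mul]
  rw [formEntry_eval h (by simp) (by simp; omega) (by simp; omega),
    formEntry_eval h (by simp) (by simp; omega) (by simp; omega)]
  simp

/-- Computes `outPoly s` of the coefficients in array `10` into array `dst`. The arrays `11` and
`12` hold two consecutive polynomials of the recurrence. -/
def outStmt (s : ℚ) (dst : Fin 16) : Stmt :=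
  .seq (.vec 11 (.var 0 + .lit 1) (deltaMul (.var 15) (.lit 1) (.lit s)))
    (.seq (.vec 12 (.var 0 + .lit 1) (deltaMul (.var 15) (.lit 1) (.lit 1)))
      (.loop 2 (.half (.var 0) + .lit 1)
        (.seq (.vec dst (.var 0 + .lit 1) (.cell dst (.var 15) +
            (.cell 10 (.half (.var 0) + .lit 1 + .var 2) +
              .lit s * .cell 10 (.half (.var 0) - .var 2)) * .cell 12 (.var 15)))
          (.seq (.vec 13 (.var 0 + .lit 1) (.lit (4 * s) * shifted 12 2 -
              .lit (2 * s) * .cell 12 (.var 15) - .cell 11 (.var 15)))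
            (.seq (.vec 11 (.var 0 + .lit 1) (.cell 12 (.var 15)))
              (.vec 12 (.var 0 + .lit 1) (.cell 13 (.var 15))))))))

theorem outStmt_run (s : ℚ) {dst : Fin 16} (hdst : dst < 10) {ρ : Fin 16 → ℕ}
    {μ : Fin 16 → ℕ → ℝ} (h0 : μ dst = 0) {k : ℕ} (hk : k ≤ ρ 0) :
    (outStmt s dst).run ρ μ dst k = (outPoly s (μ 10) (ρ 0)).coeff k := by
  have n10 : dst ≠ 10 := by rintro rfl; exact absurd hdst (by decide)
  have n11 : dst ≠ 11 := by rintro rfl; exact absurd hdst (by decide)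
  have n12 : dst ≠ 12 := by rintro rfl; exact absurd hdst (by decide)
  have n13 : dst ≠ 13 := by rintro rfl; exact absurd hdst (by decide)
  rw [outStmt, Stmt.run, Stmt.run, Stmt.run]
  refine (iter_induction (I := fun i (ν : Fin 16 → ℕ → ℝ) => ν 10 = μ 10 ∧
    (∀ p < ρ 0 + 1, ν dst p = (∑ j ∈ range i, C (μ 10 (ρ 0 / 2 + 1 + j) +
      s * μ 10 (ρ 0 / 2 - j)) * oddCheb s (j + 1)).coeff p) ∧
    (∀ p < ρ 0 + 1, ν 11 p = (oddCheb s i).coeff p) ∧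
    ∀ p < ρ 0 + 1, ν 12 p = (oddCheb s (i + 1)).coeff p) _ ?_ ?_).2.1 k (by omega)
  · simp only [Stmt.vec_run]
    refine ⟨by simp, fun p hp => ?_, fun p hp => ?_, fun p hp => ?_⟩ <;>
      have hp' : p ≤ ρ 0 := by omega
    · simp [n11, n12, h0]
    · simp [deltaMul_eval, hp', oddCheb, coeff_X, eq_comm]
    · simp [deltaMul_eval, hp', oddCheb, coeff_X, eq_comm]
  · rintro i hi ν ⟨i1, i2, i3, i4⟩
    simp only [Stmt.run, Stmt.vec_run]
    refine ⟨?_, fun p hp => ?_, fun p hp => ?_, fun p hp => ?_⟩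
    · simp [n10.symm, i1]
    · have hp' : p ≤ ρ 0 := by omega
      rw [sum_range_succ, coeff_add, coeff_C_mul, ← i2 p hp, ← i4 p hp]
      simp [n11, n12, n13, hp', i1]
    · have hp' : p ≤ ρ 0 := by omega
      simp [n12.symm, hp', i4 p hp]
    · have hp' : p ≤ ρ 0 := by omega
      have i4' := i4 (p - 2) (by omega)
      rw [oddCheb, coeff_sub, coeff_sub, coeff_C_mul, coeff_C_mul, coeff_X_pow_mul_ite, ← i3 p hp,
        ← i4 p hp, ← i4']
      simp [n11.symm, n12.symm, hp', shifted]

end CompositeGate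

/-! ### Accuracy of the output -/

namespace CompositeGate

open Finset SpectralFactor RealRAM

/-- In the recurrence a coefficient is a combination of earlier ones with weights `4`, `2` and `1`.
-/
theorem abs_oddCheb_coeff_le {s : ℝ} (hs : |s| ≤ 1) (i k : ℕ) :
    |(oddCheb s (i + 1)).coeff k| ≤ 7 ^ i := by
  have main : ∀ i, (∀ k, |(oddCheb s i).coeff k| ≤ 7 ^ i) ∧
      ∀ k, |(oddCheb s (i + 1)).coeff k| ≤ 7 ^ i := by
    intro i
    induction i with
    | zero =>
      have hX : ∀ k, |(X : ℝ[X]).coeff k| ≤ 1 := fun k => by rw [coeff_X]; split_ifs <;> simp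
      refine ⟨fun k => ?_, fun k => by simpa [oddCheb] using hX k⟩
      rw [oddCheb, coeff_C_mul, abs_mul, pow_zero]
      exact mul_le_one₀ hs (abs_nonneg _) (hX k)
    | succ i ih =>
      have h7 : (0 : ℝ) ≤ 7 ^ i := by positivity
      refine ⟨fun k => (ih.2 k).trans (pow_le_pow_right₀ (by norm_num) (by omega)), fun k => ?_⟩
      rw [oddCheb, coeff_sub, coeff_sub, coeff_C_mul, coeff_C_mul, coeff_X_pow_mul_ite]
      have h1 : |if k < 2 then 0 else (oddCheb s (i + 1)).coeff (k - 2)| ≤ 7 ^ i := by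
        split_ifs
        · simp
        · exact ih.2 _
      set x := if k < 2 then 0 else (oddCheb s (i + 1)).coeff (k - 2)
      have h2 : |s * x| ≤ 7 ^ i := by
        rw [abs_mul]; exact (mul_le_of_le_one_left (abs_nonneg _) hs).trans h1
      have h3 : |s * (oddCheb s (i + 1)).coeff k| ≤ 7 ^ i := by
        rw [abs_mul]; exact (mul_le_of_le_one_left (abs_nonneg _) hs).trans (ih.2 k)
      rw [abs_le] at h2 h3 ⊢
      have h4 := abs_le.1 (ih.1 k)
      rw [pow_succ]
      constructor <;> linarith
  exact (main i).2 k

/-- The dependence of the output on the coefficients of the factor. With `L = 2 m + 1` the constant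
`32 ^ L / 4 ^ L` is `8 ^ L`, and it exceeds `2 (m + 1) 7 ^ m`, the bound from the `m + 1` Chebyshev
polynomials. -/
theorem outPoly_coeff_sub_le {s ε : ℝ} (hs : |s| ≤ 1) {p p' : ℕ → ℝ} {L : ℕ} (hL : Odd L)
    (h : ∀ j ≤ L, |p j - p' j| ≤ ε) (k : ℕ) :
    |(outPoly s p L).coeff k - (outPoly s p' L).coeff k| ≤ 32 ^ L / 4 ^ L * ε := by
  obtain ⟨m, rfl⟩ := hL
  have hε : 0 ≤ ε := (abs_nonneg _).trans (h 0 (by omega))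
  rw [outPoly, outPoly, finsetSum_coeff, finsetSum_coeff, ← sum_sub_distrib,
    show (2 * m + 1) / 2 = m by omega]
  have hterm : ∀ i ∈ range (m + 1),
      |(C (p (m + 1 + i) + s * p (m - i)) * oddCheb s (i + 1)).coeff k -
        (C (p' (m + 1 + i) + s * p' (m - i)) * oddCheb s (i + 1)).coeff k| ≤ 2 * ε * 7 ^ m := by
    intro i hi
    have hi' := mem_range.1 hi
    rw [coeff_C_mul, coeff_C_mul, ← sub_mul, abs_mul]
    refine mul_le_mul ?_ ((abs_oddCheb_coeff_le hs i k).trans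
      (pow_le_pow_right₀ (by norm_num) (by omega))) (abs_nonneg _) (by positivity)
    have e : p (m + 1 + i) + s * p (m - i) - (p' (m + 1 + i) + s * p' (m - i)) =
        (p (m + 1 + i) - p' (m + 1 + i)) + s * (p (m - i) - p' (m - i)) := by ring
    rw [e]
    refine (abs_add_le _ _).trans ?_
    rw [abs_mul]
    have h1 := h (m + 1 + i) (by omega)
    have h2 := mul_le_mul hs (h (m - i) (by omega)) (abs_nonneg _) zero_le_one
    linarith
  refine (abs_sum_le_sum_abs _ _).trans ((sum_le_sum hterm).trans ?_)
  rw [sum_const, card_range, nsmul_eq_mul]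
  have h1 : ((m + 1 : ℕ) : ℝ) ≤ 2 ^ m := by exact_mod_cast Nat.lt_two_pow_self
  have h2 : (7 : ℝ) ^ m ≤ 32 ^ m := pow_le_pow_left₀ (by norm_num) (by norm_num) m
  have h3 : (32 : ℝ) ^ (2 * m + 1) / 4 ^ (2 * m + 1) = 8 * (2 ^ m * 32 ^ m) := by
    rw [← div_pow, ← mul_pow, pow_succ, pow_mul]; norm_num; ring
  rw [h3]
  calc ((m + 1 : ℕ) : ℝ) * (2 * ε * 7 ^ m) ≤ 2 ^ m * (2 * ε * 32 ^ m) := by gcongr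
    _ = 2 * (2 ^ m * 32 ^ m) * ε := by ring
    _ ≤ _ := by gcongr; norm_num

/-- Half the number of iterations that give `n` correct digits. After `2 r` iterations the factor
has an error of at most `8 * 4 ^ L / 2 ^ r`, which the passage to the output multiplies by at most
`32 ^ L / 4 ^ L`; the total `2 ^ (5 L + 3) / 2 ^ r` is `2 ^ (-n)` for `r = n + (5 L + 3)`. -/
def accuracy : IExp := .var 1 + (.lit 5 * .var 0 + .lit 3)

/-- The computation of the coefficients of `B` in array `2` and of `D` in array `3`, from those of
`A` in array `0` and of `C` in array `1`. -/
def factorizationStmt : Stmt :=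
  .seq (liftStmt 1 0 4) (.seq (liftStmt (-1) 1 5) (.seq gapStmt
    (.seq (doublingStmt (.lit 2 * accuracy)) (.seq (heronStmt (.lit 2 * accuracy))
      (.seq factorStmt (.seq (outStmt 1 2) (outStmt (-1) 3)))))))

/-- Exact description of the output: it is `outPoly` of the approximate factor `p`. -/
theorem factorizationStmt_run {A C : ℝ[X]} {ρ : Fin 16 → ℕ} {μ : Fin 16 → ℕ → ℝ} {f : ℕ → ℝ}
    {R : ℕ} {S : ℕ → ℕ → ℝ} (hL : Odd (ρ 0)) (hA : μ 0 = A.coeff) (hC : μ 1 = C.coeff)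
    (h0 : ∀ a, 2 ≤ a → μ a = 0) (hf : ∀ d, f d = (gapPoly A C (ρ 0)).coeff (ρ 0 + d))
    (hR : R = 2 * (ρ 1 + (5 * ρ 0 + 3))) (hS : S = doubling f (ρ 0 + 1) R) :
    ∃ p : ℕ → ℝ, (∀ j ≤ ρ 0, p j = S (ρ 0) (ρ 0 - j) / S (ρ 0) (ρ 0) * heron (S (ρ 0) (ρ 0)) R) ∧
      ∀ k ≤ ρ 0, factorizationStmt.run ρ μ 2 k = (outPoly 1 p (ρ 0)).coeff k ∧
        factorizationStmt.run ρ μ 3 k = (outPoly (-1) p (ρ 0)).coeff k := by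
  have hR' : (IExp.lit 2 * accuracy).eval ρ = R := by simp [accuracy, hR]
  simp only [factorizationStmt, Stmt.run]
  rw [liftStmt_run 1 (by decide) hL (h0 4 (by decide))]
  rw [liftStmt_run (-1) (by decide) hL (by
    rw [Function.update_of_ne (by decide)]; exact h0 5 (by decide))]
  rw [Function.update_of_ne (show (1 : Fin 16) ≠ 4 by decide), hA, hC]
  simp only [Rat.cast_neg, Rat.cast_one]
  set μ₂ := Function.update (Function.update μ 4 (lift 1 A.coeff (ρ 0)).coeff) 5
    (lift (-1) C.coeff (ρ 0)).coeff with hμ₂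
  have z₂ : ∀ a, a ≠ 4 → a ≠ 5 → μ₂ a = μ a := fun a h4 h5 => by
    rw [hμ₂, Function.update_of_ne h5, Function.update_of_ne h4]
  rw [gapStmt_run (lift_natDegree _ _ hL) (lift_natDegree _ _ hL)
    (by rw [hμ₂, Function.update_of_ne (by decide), Function.update_self])
    (by rw [hμ₂, Function.update_self])
    ((z₂ 6 (by decide) (by decide)).trans (h0 6 (by decide)))]
  set μ₃ := Function.update μ₂ 6 _ with hμ₃
  have h3 := doublingStmt_run (.lit 2 * accuracy) (ρ := ρ) (μ := μ₃) (f := f) fun d => by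
    rw [hf, hμ₃, Function.update_self]; rfl
  rw [hR', ← hS] at h3
  have z₃ : ∀ a, a ≠ 4 → a ≠ 5 → a ≠ 6 → μ₃ a = μ a := fun a h4 h5 h6 => by
    rw [hμ₃, Function.update_of_ne h6, z₂ a h4 h5]
  set μ₄ := (doublingStmt (.lit 2 * accuracy)).run ρ μ₃ with hμ₄
  have h4 := heronStmt_run (.lit 2 * accuracy) h3
  rw [hR'] at h4
  set μ₅ := (heronStmt (.lit 2 * accuracy)).run ρ μ₄ with hμ₅
  have h5 : HoldsMatrix (μ₅ 7) (2 * (ρ 0 + 1)) S := by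
    rwa [hμ₅, Stmt.run_of_not_writes _ _ _ (by simp [heronStmt])]
  have h6 : ∀ j ≤ ρ 0, _ := fun j hj => factorStmt_run h5 (j := j) hj
  rw [h4] at h6
  set μ₆ := factorStmt.run ρ μ₅ with hμ₆
  have z₆ : ∀ a, a = 2 ∨ a = 3 → μ₆ a = 0 := by
    intro a ha
    have ha2 : 2 ≤ a := by rcases ha with rfl | rfl <;> decide
    have e4 : a ≠ 4 ∧ a ≠ 5 ∧ a ≠ 6 := by rcases ha with rfl | rfl <;> decide
    rw [hμ₆, Stmt.run_of_not_writes _ _ _ (by rcases ha with rfl | rfl <;> simp [factorStmt]),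
      hμ₅, Stmt.run_of_not_writes _ _ _ (by rcases ha with rfl | rfl <;> simp [heronStmt]),
      hμ₄, Stmt.run_of_not_writes _ _ _ (by rcases ha with rfl | rfl <;>
        simp [doublingStmt, chainStmt, glueStmt, pivotsStmt, selectStmt]),
      z₃ a e4.1 e4.2.1 e4.2.2, h0 a ha2]
  refine ⟨μ₆ 10, h6, fun k hk => ⟨?_, ?_⟩⟩
  · rw [Stmt.run_of_not_writes _ _ _ (by simp [outStmt]),
      outStmt_run 1 (by decide) (z₆ 2 (.inl rfl)) hk]
    simp
  · rw [outStmt_run (-1) (by decide) _ hk]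
    · rw [Stmt.run_of_not_writes (a := 10) _ _ _ (by simp [outStmt])]
      simp
    · rw [Stmt.run_of_not_writes _ _ _ (by simp [outStmt]), z₆ 3 (.inr rfl)]

end CompositeGate

theorem lemma6 :
    ∃ (prog : RealRAM.Program) (p : Polynomial ℕ),
      ∀ (L : ℕ) (A C : Polynomial ℝ), Odd L →
        A.natDegree ≤ L → C.natDegree ≤ L →
        CompositeGate.IsOddPolynomial A → CompositeGate.IsOddPolynomial C →
        A.eval 1 = 1 →
        (∀ θ : ℝ, A.eval (Real.cos (θ / 2)) ^ 2 + C.eval (Real.sin (θ / 2)) ^ 2 ≤ 1) →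
        ∃ B D : Polynomial ℝ,
          B.natDegree ≤ L ∧ D.natDegree ≤ L ∧
          CompositeGate.AchievableWithLength L A B C D ∧
          ∀ n : ℕ, ∃ (t : ℕ) (s : RealRAM.State),
            RealRAM.Exec prog (RealRAM.input L n A C) t s ∧
            t ≤ p.eval (L + n) ∧
            RealRAM.OutputApproximates s L n B D := by
  obtain ⟨prog, p, hprog⟩ := CompositeGate.factorizationStmt.computable 16 le_rfl
  refine ⟨prog, p, fun L A C hL hdA hdC hA hC hA1 hAC => ?_⟩
  obtain ⟨P, hPd, hPF, hP⟩ := CompositeGate.exists_factor hL hA hC hdA hdC hAC (fun _ => rfl)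
  refine ⟨CompositeGate.outPoly 1 P.coeff L, CompositeGate.outPoly (-1) P.coeff L,
    CompositeGate.outPoly_natDegree _ _ hL, CompositeGate.outPoly_natDegree _ _ hL,
    CompositeGate.achievable_of_factor hL hA hC hdA hdC hA1 hPd hPF, fun n => ?_⟩
  set s₀ := RealRAM.input L n A C with hs₀
  obtain ⟨s, ⟨t, ht, hexec⟩, -, hs⟩ := hprog s₀ (L + n) fun r => by
    simp only [RealRAM.State.vars, hs₀, RealRAM.input]
    split_ifs <;> omega
  refine ⟨t, s, hexec, ht, fun k hk => ?_⟩
  have v0 : s₀.vars 0 = L := by simp [RealRAM.State.vars, hs₀, RealRAM.input]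
  have v1 : s₀.vars 1 = n := by simp [RealRAM.State.vars, hs₀, RealRAM.input]
  obtain ⟨q, hq, hout⟩ := CompositeGate.factorizationStmt_run (A := A) (C := C) (ρ := s₀.vars)
    (μ := s₀.arrs) (by rwa [v0]) (by funext k; simp [RealRAM.State.arrs, hs₀, RealRAM.input])
    (by funext k; simp [RealRAM.State.arrs, hs₀, RealRAM.input])
    (fun a ha => by
      have h0 : (a : ℕ) ≠ 0 := by have : 2 ≤ (a : ℕ) := ha; omega
      have h1 : (a : ℕ) ≠ 1 := by have : 2 ≤ (a : ℕ) := ha; omega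
      funext k; simp only [RealRAM.State.arrs, hs₀, RealRAM.input, if_neg h0, if_neg h1]; rfl)
    (fun _ => rfl) rfl rfl
  rw [v0, v1] at hq
  rw [v0] at hout
  have hqP : ∀ j ≤ L, |q j - P.coeff j| ≤ 8 * 4 ^ L / 2 ^ (n + (5 * L + 3)) := fun j hj => by
    rw [hq j hj]
    exact hP (n + (5 * L + 3)) (by omega) _ rfl j hj
  have hbound : (32 : ℝ) ^ L / 4 ^ L * (8 * 4 ^ L / 2 ^ (n + (5 * L + 3))) = (1 / 2) ^ n := by
    rw [pow_add, pow_add, pow_mul, one_div, inv_pow]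
    norm_num
    field_simp
  have e2 : s.mem 2 k = CompositeGate.factorizationStmt.run s₀.vars s₀.arrs 2 k :=
    congrFun (congrFun hs 2) k
  have e3 : s.mem 3 k = CompositeGate.factorizationStmt.run s₀.vars s₀.arrs 3 k :=
    congrFun (congrFun hs 3) k
  rw [e2, e3, (hout k hk).1, (hout k hk).2, ← hbound]
  exact ⟨CompositeGate.outPoly_coeff_sub_le (by simp) hL hqP k,
    CompositeGate.outPoly_coeff_sub_le (by simp) hL hqP k⟩
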